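/- Let $\mathfrak g$ be a finite-dimensional complex simple Lie algebra, $\mathfrak t\subset\mathfrak g$ a Cartan subalgebra, $R$ the set of roots, and $\mathfrak g_\alpha$ the root space of $\alpha\in R$. Let $0\neq z\in\mathfrak t$ be such that $\langle\alpha,z\rangle\in\{-2,0,2\}$ for all $\alpha\in R$ (as is the case when $\mathfrak g$ is the complexified Lie algebra of a simple noncompact Hermitian Lie group $G_{\mathbb R}$, $\mathfrak t\subset\mathfrak k$ where $\mathfrak k$ is the complexified Lie algebra of a maximal compact subgroup of $G_{\mathbb R}$, and $z$ is a suitably normalized central element of $\mathfrak k$). Let $\Pi$ be a basis of $R$ such that $\langle\beta,z\rangle\ge 0$ for all $\beta\in\Pi$, let $\zeta\in\Pi$ be the (unique) simple root with $\langle\zeta,z\rangle\neq0$, and let $\varpi$ be the fundamental weight of $\zeta$. Put $$\mathfrak k=\mathfrak t\oplus\bigoplus_{\langle\alpha,z\rangle=0}\mathfrak g_\alpha,\qquad \mathfrak u_\pm=\bigoplus_{\langle\alpha,z\rangle=\pm2}\mathfrak g_\alpha .$$ Let $G$ be the simply connected complex Lie group with Lie algebra $\mathfrak g$, and let $\mathbb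 E$ be the irreducible (cominuscule) representation of $G$ with highest weight $\varpi$; write $\mathbb E_\chi$ for its weight spaces. Define roots $\alpha_1,\alpha_2,\dots$ and subsets $\Pi_1,\Pi_2,\dots$ of $\Pi$ as follows: $\Pi_1=\Pi$; $\alpha_i$ is the highest root of the root system generated by $\Pi_i$; put $\Sigma_i=\{\beta\in\Pi_i:\langle\beta,\alpha_i^\vee\rangle\neq0\}$; if $\zeta\in\Sigma_i$ the process stops after $\alpha_i$, and otherwise $\Pi_{i+1}$ is the connected component of $\Pi_i\setminus\Sigma_i$ (in the Dynkin diagram) containing $\zeta$. Let $(\alpha_1,\dots,\alpha_r)$ be an initial segment of the resulting sequence (a dominant orthogonal sequence; $r=0$ is allowed). Let $y=y_{\alpha_1}+\dots+y_{\alpha_r}\in\mathfrak u_-$ with $0\neq y_{\alpha_i}\in\mathfrak g_{-\alpha_i}$ (an element of rank $r$ of $\mathfrak u_-$), and let $h=\alpha_1^\vee+\dots+\alpha_r^\vee\in\mathfrak t$. For $i\in\mathbb Z$ let $$\mathbb V_i=\bigoplus_{\chi:\ \langle\chi,z\rangle=\langle\varpi,z\rangle-2i,\ \langle\chi,h\rangle=r-2i}\mathbb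 E_\chi,\qquad \mathbb V=\bigoplus_{i\in\mathbb Z}\mathbb V_i\subset\mathbb E .$$ Let $\mathfrak q=\mathfrak t\oplus\bigoplus_{\langle\alpha,h\rangle\le\langle\alpha,z\rangle}\mathfrak g_\alpha$, a parabolic subalgebra of $\mathfrak g$, and let $Q$ and $K$ be the connected subgroups of $G$ with Lie algebras $\mathfrak q$ and $\mathfrak k$. Then: 1. $\mathbb V$ is stable under $\mathfrak q$; 2. every $\mathbb V_i$ is stable under $K\cap Q$; 3. the nilradical (the largest nilpotent ideal) of $\mathfrak q$ acts trivially on $\mathbb V$; 4. the subgroup of the elements $g\in G$ with $g\mathbb V=\mathbb V$ is exactly $Q$; 5. $y\cdot\mathbb V_i\subset\mathbb V_{i+1}$ and $\mathfrak u_+\cdot\mathbb V_i\subset\mathbb V_{i-1}$ for all $i$. -/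

import Mathlib

open LieAlgebra LieAlgebra.IsKilling

noncomputable section

namespace Cominuscule

/-! ### Dominant orthogonal sequences in a root system -/

section Cascade

variable {ι R M N : Type*} [CommRing R] [AddCommGroup M] [Module R M] [AddCommGroup N] [Module R N]

/-- The roots of the root subsystem generated by a set `S` of (simple) roots: those roots which are
integral linear combinations of elements of `S`. -/
def rootsGenerated (P : RootPairing ι R M N) (S : Set ι) : Set ι :=
  {γ | P.root γ ∈ Submodule.span ℤ (P.root '' S)}

/-- `θ` is the highest root of the root system generated by the set `S` of simple roots. -/
def IsHighestRoot (P : RootPairing ι R M N) (S : Set ι) (θ : ι) : Prop :=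
  θ ∈ rootsGenerated P S ∧
    ∀ γ ∈ rootsGenerated P S, P.root θ - P.root γ ∈ AddSubmonoid.closure (P.root '' S)

/-- The elements `β` of `S` with `⟨θ^∨, β⟩ ≠ 0`. -/
def nonOrthogonal (P : RootPairing ι R M N) (S : Set ι) (θ : ι) : Set ι :=
  {β ∈ S | P.pairing β θ ≠ 0}

/-- For `ζ ∈ S`, the vertices of the connected component of `ζ` in the full subgraph with vertex
set `S` of the Dynkin diagram (two simple roots are linked when they are not orthogonal). -/
def dynkinComponent (P : RootPairing ι R M N) (S : Set ι) (ζ : ι) : Set ι :=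
  {β | Relation.ReflTransGen (fun γ δ => δ ∈ S ∧ P.pairing γ δ ≠ 0) ζ β}

/-- `α 0, …, α (r - 1)` is the dominant orthogonal sequence of length `r` for the fundamental weight
of the simple root `ζ`. Here `S i` is the set of simple roots at the `i`-th step of the algorithm:
`S 0` is the base; `α i` is the highest root of the system generated by `S i`; and the algorithm
goes on to a step `i + 1` only if `ζ` is orthogonal to `α i`, in which case `S (i + 1)` is the
connected component of `ζ` in the set of the elements of `S i` orthogonal to `α i`. -/
def IsDominantOrthogonal {P : RootPairing ι R M N} (b : P.Base) (ζ : ι) {r : ℕ}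
    (α : Fin r → ι) : Prop :=
  ∃ S : Fin r → Set ι,
    (∀ i : Fin r, (i : ℕ) = 0 → S i = b.support) ∧
    (∀ i, IsHighestRoot P (S i) (α i)) ∧
    (∀ i j : Fin r, (j : ℕ) = (i : ℕ) + 1 →
      ζ ∉ nonOrthogonal P (S i) (α i) ∧
      S j = dynkinComponent P (S i \ nonOrthogonal P (S i) (α i)) ζ)

end Cascade

/-! ### The simply connected group of a complex semisimple Lie algebra -/

section Group

attribute [local instance] LieRing.ofAssociativeRing

variable (𝔤 : Type*) [LieRing 𝔤] [LieAlgebra ℂ 𝔤]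

/-- A finite-dimensional representation of `𝔤`, on a space `ℂ ^ dim`. -/
structure MatrixRep where
  dim : ℕ
  toHom : 𝔤 →ₗ⁅ℂ⁆ Module.End ℂ (Fin dim → ℂ)

variable {𝔤} in
/-- The exponential of `x`, acting on all finite-dimensional representations of `𝔤`. -/
def totalExp (x : 𝔤) : ∀ i : MatrixRep 𝔤, GL (Fin i.dim) ℂ :=
  fun i => (Matrix.isUnit_exp (LinearMap.toMatrix' (i.toHom x))).unit

/-- The simply connected complex Lie group `G` with (semisimple) Lie algebra `𝔤`, as an abstract
group: it is connected, hence generated by exponentials; all finite-dimensional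
representations of `𝔤` integrate to `G`, and they are jointly faithful on `G`. So `G` is the group
generated by the exponentials of the elements of `𝔤`, acting on all finite-dimensional
representations simultaneously. -/
def SCGroup : Subgroup (∀ i : MatrixRep 𝔤, GL (Fin i.dim) ℂ) :=
  Subgroup.closure (Set.range totalExp)

variable {𝔤}

/-- The exponential map `𝔤 → G`. -/
def gexp (x : 𝔤) : SCGroup 𝔤 :=
  ⟨totalExp x, Subgroup.subset_closure ⟨x, rfl⟩⟩

/-- For a Lie subalgebra `𝔰` of `𝔤`, the connected Lie subgroup of `G` with Lie algebra `𝔰`, i.e.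
the subgroup generated by the exponentials of the elements of `𝔰`. -/
def connectedSubgroup (𝔰 : Submodule ℂ 𝔤) : Subgroup (SCGroup 𝔤) :=
  Subgroup.closure (gexp '' (𝔰 : Set 𝔤))

variable (E : Type*) [AddCommGroup E] [Module ℂ E] [LieRingModule 𝔤 E] [LieModule ℂ 𝔤 E]
  [FiniteDimensional ℂ E]

variable (𝔤) in
/-- A finite-dimensional `𝔤`-module `E`, transported to `ℂ ^ dim E` by some basis of `E`. -/
def matrixRep : MatrixRep 𝔤 where
  dim := Module.finrank ℂ E
  toHom := (Module.finBasis ℂ E).equivFun.lieConj.toLieHom.comp (LieModule.toEnd ℂ 𝔤 E)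

variable (𝔤) in
/-- The representation of `G` on `E` which integrates the action of `𝔤`: the element `gexp x` acts
by the exponential of the action of `x`. -/
def groupRep : Representation ℂ (SCGroup 𝔤) E :=
  ((Matrix.toLinAlgEquiv (Module.finBasis ℂ E)).toMulEquiv.toMonoidHom.comp
    (Units.coeHom _)).comp
    ((Pi.evalMonoidHom _ (matrixRep 𝔤 E)).comp (SCGroup 𝔤).subtype)

end Group

/-- The nilradical of a finite-dimensional complex Lie algebra: its largest nilpotent ideal, i.e.
the sum of its ideals that are nilpotent as Lie algebras. -/
def nilradical (𝔮 : Type*) [LieRing 𝔮] [LieAlgebra ℂ 𝔮] : LieIdeal ℂ 𝔮 :=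
  sSup {I : LieIdeal ℂ 𝔮 | LieRing.IsNilpotent I}

/-! ### Subalgebras of `𝔤`, the representation and its subspaces -/

section Setup

variable {𝔤 : Type*} [LieRing 𝔤] [LieAlgebra ℂ 𝔤] [FiniteDimensional ℂ 𝔤] [IsSimple ℂ 𝔤]
  {𝔱 : LieSubalgebra ℂ 𝔤} [𝔱.IsCartanSubalgebra]

/-- `z ∈ 𝔱` is the element that defines a Hermitian structure: it is nonzero, all roots take values
in `{-2, 0, 2}` on `z`, and the base is such that the roots with value `2` are positive. -/
structure IsHermitianElement (b : (rootSystem 𝔱).Base) (z : 𝔱) : Prop where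
  ne_zero : z ≠ 0
  root_apply : ∀ α : 𝔱.root,
    (rootSystem 𝔱).root α z = -2 ∨ (rootSystem 𝔱).root α z = 0 ∨ (rootSystem 𝔱).root α z = 2
  base : ∀ β ∈ b.support, (rootSystem 𝔱).root β z ≠ -2

variable (𝔱) in
/-- The sum of the root spaces `𝔤_α` for the roots `α` that satisfy `p`. -/
def rootSum (p : 𝔱.root → Prop) : Submodule ℂ 𝔤 :=
  ⨆ (α : 𝔱.root) (_ : p α), (rootSpace 𝔱 (α : LieModule.Weight ℂ 𝔱 𝔤)).toSubmodule

/-- `𝔨 = 𝔱 ⊕ ⨁_{⟨α, z⟩ = 0} 𝔤_α`. -/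
def kAlg (z : 𝔱) : Submodule ℂ 𝔤 :=
  𝔱.toSubmodule ⊔ rootSum 𝔱 fun α => (rootSystem 𝔱).root α z = 0

/-- `𝔲₊ = ⨁_{⟨α, z⟩ = 2} 𝔤_α`. -/
def uPlus (z : 𝔱) : Submodule ℂ 𝔤 :=
  rootSum 𝔱 fun α => (rootSystem 𝔱).root α z = 2

/-- `𝔱 ⊕ ⨁_{⟨α, h⟩ ≤ ⟨α, z⟩} 𝔤_α` as a linear subspace. Real parts are only there to compare
elements of `ℂ`: the roots take integral values on the `h` and `z` of interest. -/
def qSub (z h : 𝔱) : Submodule ℂ 𝔤 :=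
  𝔱.toSubmodule ⊔
    rootSum 𝔱 fun α => ((rootSystem 𝔱).root α h).re ≤ ((rootSystem 𝔱).root α z).re

theorem qSub_eq (z h : 𝔱) :
    qSub z h = ⨆ (χ : {χ : 𝔱 → ℂ // (χ h).re ≤ (χ z).re}), (rootSpace 𝔱 χ.1).toSubmodule := by
  apply le_antisymm
  · refine sup_le ?_ (iSup₂_le fun α hα => ?_)
    · refine le_trans ?_ (le_iSup _ (⟨0, by simp⟩ : {χ : 𝔱 → ℂ // (χ h).re ≤ (χ z).re}))
      exact toLieSubmodule_le_rootSpace_zero ℂ 𝔤 𝔱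
    · exact le_iSup (fun χ : {χ : 𝔱 → ℂ // (χ h).re ≤ (χ z).re} => (rootSpace 𝔱 χ.1).toSubmodule)
        ⟨_, hα⟩
  · refine iSup_le fun χ => ?_
    by_cases h0 : rootSpace 𝔱 χ.1 = ⊥
    · rw [h0]; simp
    by_cases h1 : χ.1 = 0
    · rw [h1, rootSpace_zero_eq]
      exact le_sup_left
    · let w : LieModule.Weight ℂ 𝔱 𝔤 := ⟨χ.1, h0⟩
      have hw : w ∈ 𝔱.root := by
        simp only [LieSubalgebra.root, Finset.mem_filter, Finset.mem_univ, true_and]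
        exact h1
      refine le_trans ?_ le_sup_right
      exact le_iSup₂_of_le (ι := 𝔱.root) ⟨w, hw⟩ χ.2 le_rfl

/-- The parabolic subalgebra `𝔮 = 𝔱 ⊕ ⨁_{⟨α, h⟩ ≤ ⟨α, z⟩} 𝔤_α`. -/
def qAlg (z h : 𝔱) : LieSubalgebra ℂ 𝔤 where
  __ := qSub z h
  lie_mem' := by
    intro x y hx hy
    change x ∈ qSub z h at hx
    change y ∈ qSub z h at hy
    change ⁅x, y⁆ ∈ qSub z h
    rw [qSub_eq] at hx hy ⊢
    induction hx using Submodule.iSup_induction' with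
    | zero => simp
    | add x x' _ _ h1 h2 => rw [add_lie]; exact add_mem h1 h2
    | mem χ x hx =>
      induction hy using Submodule.iSup_induction' with
      | zero => simp
      | add y y' _ _ h1 h2 => rw [lie_add]; exact add_mem h1 h2
      | mem ψ y hy =>
        refine Submodule.mem_iSup_of_mem
          (⟨χ.1 + ψ.1, ?_⟩ : {χ : 𝔱 → ℂ // (χ h).re ≤ (χ z).re}) ?_
        · simpa using add_le_add χ.2 ψ.2
        · exact lie_mem_genWeightSpace_of_mem_genWeightSpace hx hy

/-- The fundamental weight of the simple root `ζ`: `⟨ϖ, β^∨⟩ = δ_{β, ζ}` for `β` in the base. -/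
def fundamentalWeight (b : (rootSystem 𝔱).Base) (ζ : b.support) : Module.Dual ℂ 𝔱 :=
  b.toCoweightBasis.coord ζ

variable (E : Type*) [AddCommGroup E] [Module ℂ E] [LieRingModule 𝔤 E] [LieModule ℂ 𝔤 E]

/-- `E` is an irreducible `𝔤`-module with highest weight `ϖ`: it is irreducible and has a nonzero
vector of weight `ϖ` killed by the root spaces of all positive roots. -/
def IsIrreducibleOfHighestWeight (b : (rootSystem 𝔱).Base) (ϖ : Module.Dual ℂ 𝔱) : Prop :=
  LieModule.IsIrreducible ℂ 𝔤 E ∧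
    ∃ v : E, v ≠ 0 ∧ v ∈ LieModule.weightSpace E (ϖ : 𝔱 → ℂ) ∧
      ∀ α : 𝔱.root, b.IsPos α → ∀ x ∈ rootSpace 𝔱 (α : LieModule.Weight ℂ 𝔱 𝔤), ⁅x, v⁆ = 0

/-- `V_i`, the sum of the weight spaces `E_χ` with `⟨χ, z⟩ = ⟨ϖ, z⟩ - 2i` (i.e. those contained in
`E_i`) and `⟨χ, h⟩ = r - 2i`. -/
def gradedPiece (ϖ : Module.Dual ℂ 𝔱) (z h : 𝔱) (r : ℕ) (i : ℤ) : Submodule ℂ E :=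
  ⨆ (χ : Module.Dual ℂ 𝔱) (_ : χ z = ϖ z - 2 * i ∧ χ h = r - 2 * i),
    (LieModule.weightSpace E (χ : 𝔱 → ℂ)).toSubmodule

/-- `V = ⨁ V_i`. -/
def gradedSubspace (ϖ : Module.Dual ℂ 𝔱) (z h : 𝔱) (r : ℕ) : Submodule ℂ E :=
  ⨆ i : ℤ, gradedPiece E ϖ z h r i

end Setup

end Cominuscule

end

/-! Write f γ = ⟨γ, z⟩, g γ = ⟨γ, h⟩ and d = h - z. Everything rests on one fact: V is the
eigenspace of d on E for its smallest eigenvalue ϖ(d), whereas 𝔮 is the sum of the eigenspaces of ad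
d with eigenvalue ≤ 0. Indeed E is spanned by the vectors obtained from a highest weight vector by
applying root vectors with f δ = -2 (`iSup_lowerSpace`), and each such step changes the d-eigenvalue
by g δ + 2, which is ≥ 0 because f γ = 2 forces g γ ≤ 2 (`sum_pairingIn_le_two`). Hence 𝔮 preserves
V and the root spaces with g γ < f γ kill it. The z-grading cuts V into the V_i, so the claims on K
∩ Q, y and 𝔲₊ follow by comparing eigenvalues.

Conversely, a root space that preserves V lies in 𝔮 (`le_of_stable`). If g γ > f γ, both root spaces
of ±γ would kill V, hence so would γ^∨. Then ϖ(γ^∨) = 0, so f γ = 0, because ϖ is proportional to z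
under the invariant form (`two_mul_apply_coroot_mul`). So g γ ≠ 0, and γ is not orthogonal to some
α_i. But V contains a nonzero vector of weight ϖ - α_i, on which γ^∨ does not vanish. That vector is
nonzero because ϖ(α_i^∨) = 1, which holds since each α_i has minimal coroot length
(`IsHighestRoot.corootLength_le`).

To pass from root spaces to the group, a Borel subgroup is chosen inside Q. By the Bruhat
decomposition (`mem_bruhatSet`) a subgroup containing it is governed by its Weyl group
representatives, and these permute the roots of 𝔮 if they stabilize V; an exchange argument puts
them in Q (`le_of_forall_actsBy`). The decomposition needs connected subgroups to be generated by
torus and root exponentials (`gexp_mem_closure_of_span_eq`).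

A nilpotent ideal of 𝔮 is a sum of weight parts. It meets neither 𝔱 nor the root spaces with g γ = f
γ, since it would then contain some a and b ≠ 0 with ⁅a, b⁆ = c b and c ≠ 0; what is left kills V.
-/

namespace Cominuscule

/-! ### Conjugation and the exponential of a commutator -/

section ExpSeries

open NormedSpace

theorem hasSum_congr {M : Type*} [AddCommMonoid M] [TopologicalSpace M] {f k : ℕ → M} {a : M}
    (h : ∀ n, f n = k n) : HasSum f a ↔ HasSum k a := by
  rw [funext h]

/-- The exponential of the commutator with `a` is conjugation by the exponential of `a`. -/
theorem hasSum_exp_conj {𝔸 : Type*} [NormedRing 𝔸] [NormedAlgebra ℂ 𝔸] [CompleteSpace 𝔸]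
    (a x : 𝔸) :
    HasSum (fun n : ℕ => (n.factorial⁻¹ : ℂ) • (fun y => a * y - y * a)^[n] x)
      (exp a * x * exp (-a)) := by
  let _ : NormedAlgebra ℚ 𝔸 := NormedAlgebra.restrictScalars ℚ ℂ 𝔸
  let _ : NormedAlgebra ℚ (𝔸 →L[ℂ] 𝔸) := NormedAlgebra.restrictScalars ℚ ℂ _
  -- The commutator with a is left multiplication by a plus right multiplication by -a. These
  -- commute, so the exponential of their sum is the product of their exponentials.
  let l : 𝔸 →L[ℂ] 𝔸 := ContinuousLinearMap.mul ℂ 𝔸 a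
  let r : 𝔸 →L[ℂ] 𝔸 := (ContinuousLinearMap.mul ℂ 𝔸).flip (-a)
  have hlr : Commute l r := by
    ext y
    simp [l, r, mul_assoc]
  have hl : ∀ y, exp l y = exp a * y := by
    intro y
    have h1 := (exp_series_hasSum_exp' (𝕂 := ℂ) l).mapL (ContinuousLinearMap.apply ℂ 𝔸 y)
    have h2 := (exp_series_hasSum_exp' (𝕂 := ℂ) a).mul_right y
    have : ∀ n : ℕ, (l ^ n) y = a ^ n * y := by
      intro n
      induction n with
      | zero => simp
      | succ n ih => rw [pow_succ', mul_apply_eq_comp, ih]; simp [l, pow_succ', mul_assoc]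
    exact ((hasSum_congr fun n => by simp [this]).mp h1).unique h2
  have hr : ∀ y, exp r y = y * exp (-a) := by
    intro y
    have h1 := (exp_series_hasSum_exp' (𝕂 := ℂ) r).mapL (ContinuousLinearMap.apply ℂ 𝔸 y)
    have h2 := (exp_series_hasSum_exp' (𝕂 := ℂ) (-a)).mul_left y
    have : ∀ n : ℕ, (r ^ n) y = y * (-a) ^ n := by
      intro n
      induction n with
      | zero => simp
      | succ n ih => rw [pow_succ', mul_apply_eq_comp, ih]; simp [r, pow_succ, mul_assoc]
    exact ((hasSum_congr fun n => by simp [this]).mp h1).unique h2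
  have h := (exp_series_hasSum_exp' (𝕂 := ℂ) (l + r)).mapL (ContinuousLinearMap.apply ℂ 𝔸 x)
  rw [exp_add_of_commute hlr] at h
  have e1 : (ContinuousLinearMap.apply ℂ 𝔸 x) (exp l * exp r) = exp a * x * exp (-a) := by
    simp [hl, hr, mul_assoc]
  rw [e1] at h
  have : ∀ n : ℕ, ((l + r) ^ n) x = (fun y => a * y - y * a)^[n] x := by
    intro n
    induction n with
    | zero => simp
    | succ n ih =>
      rw [pow_succ', mul_apply_eq_comp, ih, Function.iterate_succ_apply']
      simp [l, r, sub_eq_add_neg]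
  exact (hasSum_congr fun n => by simp [this]).mp h

end ExpSeries

/-! ### The simply connected group -/

section Group

attribute [local instance] LieRing.ofAssociativeRing

variable {𝔤 : Type*} [LieRing 𝔤] [LieAlgebra ℂ 𝔤]

/-- The matrix by which `x ∈ 𝔤` acts in a matrix representation. -/
noncomputable def MatrixRep.mat (i : MatrixRep 𝔤) : 𝔤 →ₗ[ℂ] Matrix (Fin i.dim) (Fin i.dim) ℂ :=
  LinearMap.toMatrix'.toLinearMap ∘ₗ (i.toHom : 𝔤 →ₗ[ℂ] Module.End ℂ (Fin i.dim → ℂ))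

theorem MatrixRep.mat_lie (i : MatrixRep 𝔤) (x y : 𝔤) :
    i.mat ⁅x, y⁆ = i.mat x * i.mat y - i.mat y * i.mat x := by
  simp only [MatrixRep.mat, LinearMap.comp_apply, LieHom.coe_toLinearMap, LieHom.map_lie,
    Ring.lie_def, map_sub, LinearEquiv.coe_coe]
  simp [Module.End.mul_eq_comp, LinearMap.toMatrix'_comp]

@[simp] theorem gexp_apply (x : 𝔤) (i : MatrixRep 𝔤) :
    ((gexp x).1 i : Matrix (Fin i.dim) (Fin i.dim) ℂ) = NormedSpace.exp (i.mat x) := rfl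

theorem SCGroup.ext_coe {g k : SCGroup 𝔤}
    (h : ∀ i : MatrixRep 𝔤, (g.1 i : Matrix (Fin i.dim) (Fin i.dim) ℂ) = k.1 i) : g = k :=
  Subtype.ext (funext fun i => Units.ext (h i))

@[simp] theorem gexp_zero : gexp (0 : 𝔤) = 1 :=
  SCGroup.ext_coe fun i => by
    rw [gexp_apply, map_zero, NormedSpace.exp_zero]; rfl

theorem gexp_add {x y : 𝔤} (h : ⁅x, y⁆ = 0) : gexp (x + y) = gexp x * gexp y :=
  SCGroup.ext_coe fun i => by
    have hc : Commute (i.mat x) (i.mat y) := by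
      have := i.mat_lie x y
      rw [h, map_zero] at this
      exact (sub_eq_zero.1 this.symm)
    rw [gexp_apply, map_add, Matrix.exp_add_of_commute _ _ hc]
    rfl

theorem gexp_neg (x : 𝔤) : gexp (-x) = (gexp x)⁻¹ := by
  rw [eq_inv_iff_mul_eq_one, ← gexp_add (by simp)]
  simp

theorem gexp_nsmul (n : ℕ) (x : 𝔤) : gexp (n • x) = gexp x ^ n := by
  induction n with
  | zero => simp
  | succ n ih => rw [succ_nsmul, gexp_add (by simp [nsmul_lie]), ih, pow_succ]

/-- `G` is generated by exponentials. -/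
theorem closure_range_gexp : Subgroup.closure (Set.range (gexp : 𝔤 → SCGroup 𝔤)) = ⊤ := by
  rw [eq_top_iff]
  rintro ⟨g, hg⟩ -
  have : Subgroup.map (SCGroup 𝔤).subtype (Subgroup.closure (Set.range (gexp : 𝔤 → SCGroup 𝔤)))
      = SCGroup 𝔤 := by
    rw [MonoidHom.map_closure, ← Set.range_comp]
    rfl
  rw [← this] at hg
  obtain ⟨k, hk, rfl⟩ := hg
  exact hk

/-! ### Integrated representations and stabilizers -/

section Rep

variable (E : Type*) [AddCommGroup E] [Module ℂ E] [LieRingModule 𝔤 E] [LieModule ℂ 𝔤 E]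
  [FiniteDimensional ℂ E]

theorem matrixRep_mat (x : 𝔤) : (matrixRep 𝔤 E).mat x =
    LinearMap.toMatrix (Module.finBasis ℂ E) (Module.finBasis ℂ E) (LieModule.toEnd ℂ 𝔤 E x) :=
  rfl

variable {E}

-- E carries no topology, so the exponential series is tested against linear functionals; these
-- separate points.
open scoped Matrix.Norms.Operator in
theorem hasSum_groupRep_gexp (x : 𝔤) (v : E) (l : Module.Dual ℂ E) :
    HasSum (fun n : ℕ => (n.factorial⁻¹ : ℂ) * l ((LieModule.toEnd ℂ 𝔤 E x ^ n) v))
      (l (groupRep 𝔤 E (gexp x) v)) := by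
  let b := Module.finBasis ℂ E
  let φ : Matrix (Fin (Module.finrank ℂ E)) (Fin (Module.finrank ℂ E)) ℂ →ₗ[ℂ] ℂ :=
    l ∘ₗ LinearMap.applyₗ v ∘ₗ (Matrix.toLin b b).toLinearMap
  have h := (NormedSpace.exp_series_hasSum_exp' (𝕂 := ℂ)
    (LinearMap.toMatrix b b (LieModule.toEnd ℂ 𝔤 E x))).mapL φ.toContinuousLinearMap
  have hp : ∀ n : ℕ, LinearMap.toMatrix b b (LieModule.toEnd ℂ 𝔤 E x) ^ n
      = LinearMap.toMatrix b b (LieModule.toEnd ℂ 𝔤 E x ^ n) := fun n =>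
    (map_pow (LinearMap.toMatrixAlgEquiv b) _ n).symm
  exact (hasSum_congr fun n => by simp [φ, hp]).mp h

theorem groupRep_gexp_unique (x : 𝔤) (v w : E)
    (h : ∀ l : Module.Dual ℂ E,
      HasSum (fun n : ℕ => (n.factorial⁻¹ : ℂ) * l ((LieModule.toEnd ℂ 𝔤 E x ^ n) v)) (l w)) :
    groupRep 𝔤 E (gexp x) v = w := by
  rw [← sub_eq_zero, ← Module.forall_dual_apply_eq_zero_iff ℂ]
  intro l
  rw [map_sub, sub_eq_zero]
  exact (hasSum_groupRep_gexp x v l).unique (h l)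

theorem groupRep_gexp_of_lie_eq_smul {x : 𝔤} {v : E} {c : ℂ} (h : ⁅x, v⁆ = c • v) :
    groupRep 𝔤 E (gexp x) v = Complex.exp c • v := by
  have hp : ∀ n : ℕ, (LieModule.toEnd ℂ 𝔤 E x ^ n) v = c ^ n • v := by
    intro n
    induction n with
    | zero => simp
    | succ n ih => rw [pow_succ', Module.End.mul_apply, ih]; simp [h, pow_succ, smul_smul]
  refine groupRep_gexp_unique x v _ fun l => ?_
  have := (NormedSpace.exp_series_hasSum_exp' (𝕂 := ℂ) c).mul_right (l v)
  rw [Complex.exp_eq_exp_ℂ, map_smul]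
  simpa [hp, mul_assoc] using this

/-- The exponential series stops after the quadratic term. -/
theorem groupRep_gexp_eq {x : 𝔤} {v v₁ v₂ : E} (h₁ : ⁅x, v⁆ = v₁) (h₂ : ⁅x, v₁⁆ = v₂)
    (h₃ : ⁅x, v₂⁆ = 0) :
    groupRep 𝔤 E (gexp x) v = v + v₁ + (2⁻¹ : ℂ) • v₂ := by
  have hp : ∀ n : ℕ, (LieModule.toEnd ℂ 𝔤 E x ^ (n + 3)) v = 0 := by
    intro n
    rw [pow_add]
    simp [pow_succ, h₁, h₂, h₃]
  refine groupRep_gexp_unique x v _ fun l => ?_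
  have := hasSum_sum_of_ne_finset_zero (s := Finset.range 3) (L := .unconditional ℕ)
    (f := fun n : ℕ => (n.factorial⁻¹ : ℂ) * l ((LieModule.toEnd ℂ 𝔤 E x ^ n) v)) (by
      intro n hn
      obtain ⟨m, rfl⟩ : ∃ m, n = m + 3 := ⟨n - 3, by simp at hn; omega⟩
      simp [hp])
  have e : l (v + v₁ + (2⁻¹ : ℂ) • v₂) = ∑ n ∈ Finset.range 3,
      (n.factorial⁻¹ : ℂ) * l ((LieModule.toEnd ℂ 𝔤 E x ^ n) v) := by
    simp [Finset.sum_range_succ, pow_succ, h₁, h₂]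
  rw [e]
  exact this

theorem groupRep_gexp_of_lie_eq_zero {x : 𝔤} {v : E} (h : ⁅x, v⁆ = 0) :
    groupRep 𝔤 E (gexp x) v = v := by
  simp [groupRep_gexp_eq h (lie_zero x) (lie_zero x)]

/-- The subspace is the common kernel of the functionals that vanish on it, and such a functional
annihilates every term of the series. -/
theorem groupRep_gexp_mem {x : 𝔤} {U : Submodule ℂ E} (h : ∀ u ∈ U, ⁅x, u⁆ ∈ U) {u : E}
    (hu : u ∈ U) : groupRep 𝔤 E (gexp x) u ∈ U := by
  have hp : ∀ n : ℕ, (LieModule.toEnd ℂ 𝔤 E x ^ n) u ∈ U := by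
    intro n
    induction n with
    | zero => simpa
    | succ n ih => rw [pow_succ', Module.End.mul_apply]; exact h _ ih
  rw [← Subspace.dualAnnihilator_dualCoannihilator_eq (W := U), Submodule.mem_dualCoannihilator]
  intro l hl
  rw [Submodule.mem_dualAnnihilator] at hl
  refine (hasSum_groupRep_gexp x u l).unique ?_
  simp [hl _ (hp _)]

@[simp] theorem groupRep_inv_apply (g : SCGroup 𝔤) (v : E) :
    groupRep 𝔤 E g⁻¹ (groupRep 𝔤 E g v) = v := by
  rw [← Module.End.mul_apply, ← map_mul]; simp

@[simp] theorem groupRep_apply_inv (g : SCGroup 𝔤) (v : E) :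
    groupRep 𝔤 E g (groupRep 𝔤 E g⁻¹ v) = v := by
  rw [← Module.End.mul_apply, ← map_mul]; simp

theorem groupRep_injective (g : SCGroup 𝔤) : Function.Injective (groupRep 𝔤 E g) :=
  Function.LeftInverse.injective (groupRep_inv_apply g)

variable (E) in
/-- The stabilizer in `G` of a subspace. -/
def stab (U : Submodule ℂ E) : Subgroup (SCGroup 𝔤) where
  carrier := {g | U.map (groupRep 𝔤 E g) = U}
  one_mem' := by simp [Module.End.one_eq_id]
  mul_mem' {a b} ha hb := by
    change U.map (groupRep 𝔤 E (a * b)) = U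
    rw [map_mul, Module.End.mul_eq_comp, Submodule.map_comp, hb, ha]
  inv_mem' {a} ha := by
    change U.map (groupRep 𝔤 E a⁻¹) = U
    conv_lhs => rw [← show U.map (groupRep 𝔤 E a) = U from ha]
    rw [← Submodule.map_comp, ← Module.End.mul_eq_comp, ← map_mul]
    simp [Module.End.one_eq_id]

theorem mem_stab {U : Submodule ℂ E} {g : SCGroup 𝔤} :
    g ∈ stab E U ↔ U.map (groupRep 𝔤 E g) = U := Iff.rfl

theorem mem_stab_of_forall_mem {U : Submodule ℂ E} {g : SCGroup 𝔤}
    (h : ∀ u ∈ U, groupRep 𝔤 E g u ∈ U) : g ∈ stab E U := by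
  refine Submodule.eq_of_le_of_finrank_eq ?_ ?_
  · rintro _ ⟨u, hu, rfl⟩
    exact h u hu
  · exact (Submodule.equivMapOfInjective _ (groupRep_injective g) U).finrank_eq.symm

theorem groupRep_mem_of_mem_stab {U : Submodule ℂ E} {g : SCGroup 𝔤} (h : g ∈ stab E U) {u : E}
    (hu : u ∈ U) : groupRep 𝔤 E g u ∈ U := by
  rw [mem_stab] at h
  rw [← h]
  exact Submodule.mem_map_of_mem hu

theorem connectedSubgroup_le_stab {𝔰 : Submodule ℂ 𝔤} {U : Submodule ℂ E}
    (h : ∀ x ∈ 𝔰, ∀ u ∈ U, ⁅x, u⁆ ∈ U) : connectedSubgroup 𝔰 ≤ stab E U := by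
  rw [connectedSubgroup, Subgroup.closure_le]
  rintro _ ⟨x, hx, rfl⟩
  exact mem_stab_of_forall_mem fun u hu => groupRep_gexp_mem (h x hx) hu

end Rep

/-! ### The adjoint action of the group -/

section Ad

variable [FiniteDimensional ℂ 𝔤]

open scoped Matrix.Norms.Operator in
theorem mat_groupRep_gexp (i : MatrixRep 𝔤) (x y : 𝔤) :
    i.mat (groupRep 𝔤 𝔤 (gexp y) x) =
      NormedSpace.exp (i.mat y) * i.mat x * NormedSpace.exp (-i.mat y) := by
  ext j k
  let l : Module.Dual ℂ 𝔤 := Matrix.entryLinearMap ℂ ℂ j k ∘ₗ i.mat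
  have h1 := hasSum_groupRep_gexp y x l
  have h2 := (hasSum_exp_conj (i.mat y) (i.mat x)).mapL
    (Matrix.entryLinearMap ℂ ℂ j k).toContinuousLinearMap
  have : ∀ n : ℕ, i.mat ((LieModule.toEnd ℂ 𝔤 𝔤 y ^ n) x)
      = (fun w => i.mat y * w - w * i.mat y)^[n] (i.mat x) := by
    intro n
    induction n with
    | zero => simp
    | succ n ih =>
      rw [pow_succ', Module.End.mul_apply, Function.iterate_succ_apply', ← ih,
        LieModule.toEnd_apply_apply, i.mat_lie]
  exact ((hasSum_congr fun n => by simp [l, this]).mp h1).unique h2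

/-- For exponentials this is the conjugation series; it passes to products and inverses, and
exponentials generate G. It makes `groupRep 𝔤 𝔤` the adjoint action, compatible with every
representation. -/
theorem coe_mul_mat (i : MatrixRep 𝔤) (g : SCGroup 𝔤) (x : 𝔤) :
    (g.1 i : Matrix (Fin i.dim) (Fin i.dim) ℂ) * i.mat x =
      i.mat (groupRep 𝔤 𝔤 g x) * (g.1 i : Matrix (Fin i.dim) (Fin i.dim) ℂ) := by
  have hg : g ∈ Subgroup.closure (Set.range (gexp : 𝔤 → SCGroup 𝔤)) := by
    rw [closure_range_gexp]; trivial
  induction hg using Subgroup.closure_induction generalizing x with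
  | mem g hg =>
    obtain ⟨y, rfl⟩ := hg
    rw [mat_groupRep_gexp, gexp_apply, mul_assoc, ← Matrix.exp_add_of_commute _ _ (by simp)]
    simp
  | one => simp
  | mul a b _ _ ha hb =>
    rw [map_mul, Module.End.mul_apply]
    change (a.1 i * b.1 i : Matrix (Fin i.dim) (Fin i.dim) ℂ) * _ = _ * (a.1 i * b.1 i : Matrix _ _ ℂ)
    rw [mul_assoc, hb, ← mul_assoc, ha, mul_assoc]
    rfl
  | inv a _ ha =>
    have := ha (groupRep 𝔤 𝔤 a⁻¹ x)
    rw [groupRep_apply_inv] at this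
    change ((a.1 i)⁻¹ : GL _ ℂ).1 * _ = _ * ((a.1 i)⁻¹ : GL _ ℂ).1
    rw [Units.inv_mul_eq_iff_eq_mul, ← mul_assoc, Units.eq_mul_inv_iff_mul_eq]
    exact this.symm

theorem groupRep_lie {E : Type*} [AddCommGroup E] [Module ℂ E] [LieRingModule 𝔤 E]
    [LieModule ℂ 𝔤 E] [FiniteDimensional ℂ E] (g : SCGroup 𝔤) (x : 𝔤) (v : E) :
    groupRep 𝔤 E g ⁅x, v⁆ = ⁅groupRep 𝔤 𝔤 g x, groupRep 𝔤 E g v⁆ := by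
  let b := Module.finBasis ℂ E
  have h : ∀ A B X Y : Matrix (Fin (Module.finrank ℂ E)) (Fin (Module.finrank ℂ E)) ℂ,
      A * X = Y * B → Matrix.toLin b b A (Matrix.toLin b b X v) =
        Matrix.toLin b b Y (Matrix.toLin b b B v) := by
    intro A B X Y h
    rw [← LinearMap.comp_apply, ← Matrix.toLin_mul b b b, h, Matrix.toLin_mul b b b,
      LinearMap.comp_apply]
  have := h _ _ _ _ (coe_mul_mat (matrixRep 𝔤 E) g x)
  rw [matrixRep_mat, matrixRep_mat, Matrix.toLin_toMatrix, Matrix.toLin_toMatrix] at this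
  exact this

theorem mul_gexp_mul_inv (g : SCGroup 𝔤) (x : 𝔤) :
    g * gexp x * g⁻¹ = gexp (groupRep 𝔤 𝔤 g x) :=
  SCGroup.ext_coe fun i => by
    rw [gexp_apply]
    have : i.mat (groupRep 𝔤 𝔤 g x) =
        (g.1 i : Matrix (Fin i.dim) (Fin i.dim) ℂ) * i.mat x * ((g.1 i)⁻¹ : GL _ ℂ).1 := by
      rw [coe_mul_mat, mul_assoc, Units.mul_inv, mul_one]
    rw [this, Matrix.exp_units_conj]
    rfl

theorem mul_gexp (g : SCGroup 𝔤) (x : 𝔤) : g * gexp x = gexp (groupRep 𝔤 𝔤 g x) * g := by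
  rw [← mul_gexp_mul_inv, inv_mul_cancel_right]

theorem gexp_mul (g : SCGroup 𝔤) (x : 𝔤) : gexp x * g = g * gexp (groupRep 𝔤 𝔤 g⁻¹ x) := by
  rw [mul_gexp, groupRep_apply_inv]

end Ad

end Group

end Cominuscule


namespace Cominuscule

/-! ### Generating a connected subgroup by one-parameter groups -/

section Generation

open NormedSpace Filter Topology
open scoped Matrix.Norms.Operator

variable {𝔤 : Type*} [LieRing 𝔤] [LieAlgebra ℂ 𝔤]

section Products

variable {n : ℕ}

/-- The `k`-th coordinate on `ℂ ^ n`, which is zero if `n ≤ k`. -/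
noncomputable def coordNat (n k : ℕ) : (Fin n → ℂ) →L[ℂ] ℂ :=
  if h : k < n then ContinuousLinearMap.proj ⟨k, h⟩ else 0

theorem coordNat_val (i : Fin n) (a : Fin n → ℂ) : coordNat n i a = a i := by
  simp [coordNat]

/-- The product of the exponentials of `a 0 • e 0, …, a (k - 1) • e (k - 1)`. -/
noncomputable def expProd (e : ℕ → 𝔤) (a : Fin n → ℂ) : ℕ → SCGroup 𝔤
  | 0 => 1
  | k + 1 => expProd e a k * gexp (coordNat n k a • e k)

theorem expProd_zero (e : ℕ → 𝔤) (k : ℕ) : expProd e (0 : Fin n → ℂ) k = 1 := by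
  induction k with
  | zero => rfl
  | succ k ih => simp [expProd, ih]

theorem contDiff_expProd (e : ℕ → 𝔤) (i : MatrixRep 𝔤) (k : ℕ) :
    ContDiff ℂ 1 (fun a : Fin n → ℂ =>
      ((expProd e a k).1 i : Matrix (Fin i.dim) (Fin i.dim) ℂ)) := by
  induction k with
  | zero =>
    simp only [expProd]
    exact contDiff_const
  | succ k ih =>
    have hexp : ContDiff ℂ 1 (exp : Matrix (Fin i.dim) (Fin i.dim) ℂ → _) :=
      AnalyticOnNhd.contDiff fun x _ => exp_analytic x
    have h1 : ContDiff ℂ 1 (fun a : Fin n → ℂ => exp (coordNat n k a • i.mat (e k))) :=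
      hexp.comp ((coordNat n k).contDiff.smul contDiff_const)
    have e1 : ∀ a : Fin n → ℂ,
        ((expProd e a (k + 1)).1 i : Matrix (Fin i.dim) (Fin i.dim) ℂ) =
        ((expProd e a k).1 i : Matrix (Fin i.dim) (Fin i.dim) ℂ) *
          exp (coordNat n k a • i.mat (e k)) := by
      intro a
      rw [← map_smul, ← gexp_apply]
      rfl
    simp only [e1]
    exact ih.mul h1

variable [FiniteDimensional ℂ 𝔤]

theorem contDiff_groupRep_expProd (e : ℕ → 𝔤) (l : Module.Dual ℂ 𝔤) (w : 𝔤) (k : ℕ) :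
    ContDiff ℂ 1 (fun a : Fin n → ℂ => l (groupRep 𝔤 𝔤 (expProd e a k) w)) := by
  let φ : Matrix (Fin (matrixRep 𝔤 𝔤).dim) (Fin (matrixRep 𝔤 𝔤).dim) ℂ →ₗ[ℂ] ℂ :=
    l ∘ₗ LinearMap.applyₗ w ∘ₗ
      (Matrix.toLin (Module.finBasis ℂ 𝔤) (Module.finBasis ℂ 𝔤)).toLinearMap
  have hφ : ∀ a : Fin n → ℂ, l (groupRep 𝔤 𝔤 (expProd e a k) w) =
      φ.toContinuousLinearMap ((expProd e a k).1 (matrixRep 𝔤 𝔤)).1 := fun a => rfl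
  simp only [hφ]
  exact φ.toContinuousLinearMap.contDiff.comp (contDiff_expProd e (matrixRep 𝔤 𝔤) k)

/-- The product rule yields one term e_j inside the product for each factor; moving it to the far
left past the earlier factors turns it into its adjoint transform. -/
theorem hasDerivAt_expProd (e : ℕ → 𝔤) (i : MatrixRep 𝔤) {a : ℝ → Fin n → ℂ} {a' : Fin n → ℂ}
    {t : ℝ} (ha : HasDerivAt a a' t) (k : ℕ) :
    HasDerivAt (fun s => ((expProd e (a s) k).1 i : Matrix (Fin i.dim) (Fin i.dim) ℂ))
      (i.mat (∑ j ∈ Finset.range k, coordNat n j a' • groupRep 𝔤 𝔤 (expProd e (a t) j) (e j)) *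
        ((expProd e (a t) k).1 i : Matrix (Fin i.dim) (Fin i.dim) ℂ)) t := by
  induction k with
  | zero =>
    simp only [expProd, Finset.range_zero, Finset.sum_empty, map_zero, zero_mul]
    exact hasDerivAt_const _ _
  | succ k ih =>
    have hc : HasDerivAt (fun s => coordNat n k (a s)) (coordNat n k a') t :=
      ((coordNat n k).restrictScalars ℝ).hasFDerivAt.comp_hasDerivAt t ha
    have h1 : HasDerivAt (fun s => exp (coordNat n k (a s) • i.mat (e k)))
        (coordNat n k a' • (i.mat (e k) * exp (coordNat n k (a t) • i.mat (e k)))) t :=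
      HasDerivAt.scomp (g₁ := fun u : ℂ => exp (u • i.mat (e k))) t
        (hasDerivAt_exp_smul_const' (𝕂 := ℂ) (i.mat (e k)) (coordNat n k (a t))) hc
    have h2 := ih.mul h1
    have e1 : ∀ s, ((expProd e (a s) (k + 1)).1 i : Matrix (Fin i.dim) (Fin i.dim) ℂ) =
        ((expProd e (a s) k).1 i : Matrix (Fin i.dim) (Fin i.dim) ℂ) *
          exp (coordNat n k (a s) • i.mat (e k)) := by
      intro s
      rw [← map_smul, ← gexp_apply]
      rfl
    simp only [e1]
    refine h2.congr_deriv ?_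
    rw [Finset.sum_range_succ, map_add, add_mul, map_smul, mul_assoc]
    congr 1
    rw [mul_smul_comm, ← mul_assoc, coe_mul_mat, smul_mul_assoc, mul_assoc]

omit [FiniteDimensional ℂ 𝔤] in
theorem expProd_mem {e : ℕ → 𝔤} {H : Subgroup (SCGroup 𝔤)} (h : ∀ k (c : ℂ), gexp (c • e k) ∈ H)
    (a : Fin n → ℂ) (k : ℕ) : expProd e a k ∈ H := by
  induction k with
  | zero => exact one_mem _
  | succ k ih => exact mul_mem ih (h k _)

end Products

variable [FiniteDimensional ℂ 𝔤]

/-- A path of products of exponentials whose logarithmic derivative is constant is a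
one-parameter group. -/
theorem expProd_eq_gexp {n : ℕ} {e : ℕ → 𝔤} {x : 𝔤} {a a' : ℝ → Fin n → ℂ} {ε : ℝ} (h0 : a 0 = 0)
    (ha : ∀ t ∈ Set.Icc 0 ε, HasDerivAt a (a' t) t)
    (hx : ∀ t ∈ Set.Icc 0 ε,
      ∑ j ∈ Finset.range n, coordNat n j (a' t) • groupRep 𝔤 𝔤 (expProd e (a t) j) (e j) = x)
    {t : ℝ} (ht : t ∈ Set.Icc 0 ε) : expProd e (a t) n = gexp ((t : ℂ) • x) := by
  refine SCGroup.ext_coe fun i => ?_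
  -- The product and exp(s x) solve the same linear equation, so exp(-s x) times the product has
  -- derivative zero.
  let u : ℝ → Matrix (Fin i.dim) (Fin i.dim) ℂ := fun s =>
    exp (s • (-i.mat x)) * ((expProd e (a s) n).1 i : Matrix (Fin i.dim) (Fin i.dim) ℂ)
  have hu : ∀ s ∈ Set.Icc 0 ε, HasDerivAt u 0 s := by
    intro s hs
    have h1 := hasDerivAt_expProd e i (ha s hs) n
    rw [hx s hs] at h1
    have h2 := (hasDerivAt_exp_smul_const (𝕂 := ℝ) (-i.mat x) s).mul h1
    refine h2.congr_deriv ?_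
    noncomm_ring
  have hc := constant_of_has_deriv_right_zero (f := u) (a := 0) (b := ε)
    (fun s hs => (hu s hs).continuousAt.continuousWithinAt)
    (fun s hs => (hu s ⟨hs.1, hs.2.le⟩).hasDerivWithinAt) t ht
  have hu0 : u 0 = 1 := by
    simp [u, h0, expProd_zero]
  rw [hu0] at hc
  have h3 : exp (t • i.mat x) * exp (t • (-i.mat x)) = 1 := by
    rw [← Matrix.exp_add_of_commute _ _ (by simp)]
    simp
  have h4 : ((expProd e (a t) n).1 i : Matrix (Fin i.dim) (Fin i.dim) ℂ) = exp (t • i.mat x) := by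
    calc _ = exp (t • i.mat x) * u t := by rw [← mul_assoc, h3, one_mul]
      _ = _ := by rw [hc, mul_one]
  rw [h4, gexp_apply, map_smul]
  congr 1

/-- The subgroup of `G` with Lie algebra `𝔟` is generated by the one-parameter groups of any
vectors that span `𝔟`. -/
theorem gexp_mem_closure_of_span_eq {s : Set 𝔤} (hs : ∀ (c : ℂ), ∀ x ∈ s, c • x ∈ s)
    {𝔟 : LieSubalgebra ℂ 𝔤} (h𝔟 : Submodule.span ℂ s = 𝔟.toSubmodule) {x : 𝔤} (hx : x ∈ 𝔟) :
    gexp x ∈ Subgroup.closure (gexp '' s) := by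
  obtain ⟨n, bas, hbas⟩ : ∃ (n : ℕ) (bas : Module.Basis (Fin n) ℂ 𝔟), ∀ i, (bas i : 𝔤) ∈ s := by
    obtain ⟨t, hts, hspan, hli⟩ := exists_linearIndependent ℂ s
    have hfin : Finite t := hli.finite
    let _ := Fintype.ofFinite t
    rw [h𝔟] at hspan
    have hsp : Submodule.span ℂ (Set.range ((↑) : t → 𝔤)) = 𝔟.toSubmodule := by
      rw [Subtype.range_coe]; exact hspan
    refine ⟨_, ((Module.Basis.span hli).map (LinearEquiv.ofEq _ _ hsp)).reindex
      (Fintype.equivFin t), fun i => ?_⟩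
    simp only [Module.Basis.reindex_apply, Module.Basis.map_apply]
    change ((Module.Basis.span hli ((Fintype.equivFin t).symm i) : _) : 𝔤) ∈ s
    rw [Module.Basis.span_apply]
    exact hts (Subtype.coe_prop _)
  let e : ℕ → 𝔤 := fun k => if h : k < n then (bas ⟨k, h⟩ : 𝔤) else 0
  have hei : ∀ i : Fin n, e i = bas i := fun i => by simp [e]
  have he𝔟 : ∀ k, e k ∈ 𝔟 := by
    intro k
    by_cases h : k < n
    · simp [e, h]
    · simp [e, h]
  have hgen : ∀ k (c : ℂ), gexp (c • e k) ∈ Subgroup.closure (gexp '' s) := by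
    intro k c
    by_cases h : k < n
    · exact Subgroup.subset_closure ⟨_, hs c _ (by simpa [e, h] using hbas ⟨k, h⟩), rfl⟩
    · simp [e, h, one_mem]
  have hAd : ∀ (a : Fin n → ℂ) (k : ℕ), groupRep 𝔤 𝔤 (expProd e a k) (e k) ∈ 𝔟 := by
    intro a k
    have : expProd e a k ∈ stab 𝔤 𝔟.toSubmodule :=
      expProd_mem (fun k c => mem_stab_of_forall_mem fun u hu => groupRep_gexp_mem
        (fun w hw => 𝔟.lie_mem (𝔟.smul_mem c (he𝔟 k)) hw) hu) a k
    exact groupRep_mem_of_mem_stab this (he𝔟 k)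
  -- The coordinates on 𝔟 are extended to all of 𝔤, so that the matrix below is visibly smooth in a.
  choose c hc using fun j => LinearMap.exists_extend (p := 𝔟.toSubmodule) (bas.coord j)
  have hcb : ∀ j (w : 𝔟), c j w = bas.repr w j := fun j w => LinearMap.congr_fun (hc j) w
  -- Column i holds the coordinates of the adjoint transform of e_i by the preceding factors: along
  -- a path a(t), the logarithmic derivative of the product has coordinates A(a) a'.
  let A : (Fin n → ℂ) → Matrix (Fin n) (Fin n) ℂ := fun a =>
    Matrix.of fun j i => c j (groupRep 𝔤 𝔤 (expProd e a i) (e i))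
  have hA : ContDiff ℂ 1 A := by
    refine (Matrix.ofLinearEquiv ℂ : (Fin n → Fin n → ℂ) ≃ₗ[ℂ] Matrix (Fin n) (Fin n)
      ℂ).toLinearMap.toContinuousLinearMap.contDiff.comp (f := fun a (j i : Fin n) =>
        c j (groupRep 𝔤 𝔤 (expProd e a i) (e i))) ?_
    refine contDiff_pi.2 fun j => contDiff_pi.2 fun i => ?_
    exact contDiff_groupRep_expProd e (c j) (e i) i
  have hA0 : A 0 = 1 := by
    ext j i
    simp only [A, expProd_zero, map_one, Module.End.one_apply, Matrix.of_apply, hei, hcb]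
    simp [Finsupp.single_apply, Matrix.one_apply, eq_comm]
  -- Since A 0 = 1, the equation A(a) a' = x can be solved for a' near 0. The Picard–Lindelöf
  -- theorem for a' = F(a), a(0) = 0 then writes exp(t x) as a product of the generators for small
  -- t.
  let F : (Fin n → ℂ) → (Fin n → ℂ) := fun a => (A a)⁻¹.mulVec (bas.repr ⟨x, hx⟩)
  have hF : ContDiffAt ℝ 1 F 0 := by
    have h1 : ContDiffAt ℂ 1 (fun a => Ring.inverse (A a)) 0 := by
      have := contDiffAt_ringInverse ℂ (n := 1) (1 : (Matrix (Fin n) (Fin n) ℂ)ˣ)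
      refine ContDiffAt.comp (x := (0 : Fin n → ℂ)) (g := Ring.inverse) (f := A) ?_ hA.contDiffAt
      rw [hA0]
      exact this
    let φ : Matrix (Fin n) (Fin n) ℂ →ₗ[ℂ] (Fin n → ℂ) :=
      (Matrix.mulVecBilin ℂ ℂ).flip (bas.repr ⟨x, hx⟩)
    have h2 : ContDiffAt ℂ 1 (fun a => φ.toContinuousLinearMap (Ring.inverse (A a))) 0 :=
      φ.toContinuousLinearMap.contDiff.contDiffAt.comp _ h1
    have h3 : F = fun a => φ.toContinuousLinearMap (Ring.inverse (A a)) := by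
      funext a
      simp [F, φ, Matrix.nonsing_inv_eq_ringInverse]
    rw [h3]
    exact h2.restrict_scalars ℝ
  obtain ⟨a, ha0, ε, hε, ha⟩ :=
    hF.exists_forall_mem_closedBall_exists_eq_forall_mem_Ioo_hasDerivAt₀ 0
  have hunit : ∀ᶠ t in 𝓝 (0 : ℝ), IsUnit (A (a t)) := by
    have hcont : ContinuousAt (fun t => A (a t)) 0 := by
      refine ContinuousAt.comp (f := a) (g := A) hA.continuous.continuousAt ?_
      exact (ha 0 (by simpa using hε)).continuousAt
    refine hcont.eventually ?_
    change ∀ᶠ y in 𝓝 (A (a 0)), IsUnit y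
    rw [ha0, hA0]
    exact Units.isOpen.mem_nhds isUnit_one
  obtain ⟨δ, hδ, hδu⟩ := Metric.eventually_nhds_iff.1 hunit
  let η := min ε δ / 2
  have hη : 0 < η := by positivity
  have hηε : η < ε := by
    have := min_le_left ε δ
    simp only [η]; linarith
  have hηδ : η < δ := by
    have := min_le_right ε δ
    simp only [η]; linarith
  have key : ∀ t ∈ Set.Icc 0 η, expProd e (a t) n = gexp ((t : ℂ) • x) := by
    intro t ht
    refine expProd_eq_gexp (a' := fun t => F (a t)) ha0 (fun t ht => ha t ?_) (fun t ht => ?_) ht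
    · exact ⟨by linarith [ht.1], by linarith [ht.2]⟩
    · have hu : IsUnit (A (a t)) := hδu (by
        rw [Real.dist_eq, sub_zero, abs_of_nonneg ht.1]; linarith [ht.2])
      have h1 : (A (a t)).mulVec (F (a t)) = bas.repr ⟨x, hx⟩ := by
        simp only [F]
        rw [Matrix.mulVec_mulVec, Matrix.mul_nonsing_inv _ ((Matrix.isUnit_iff_isUnit_det _).1 hu),
          Matrix.one_mulVec]
      rw [Finset.sum_range (fun j => coordNat n j (F (a t)) •
        groupRep 𝔤 𝔤 (expProd e (a t) j) (e j))]
      simp only [coordNat_val]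
      let w : 𝔟 := ∑ i : Fin n, F (a t) i • ⟨groupRep 𝔤 𝔤 (expProd e (a t) i) (e i), hAd _ _⟩
      have hw : w = ⟨x, hx⟩ := by
        refine bas.ext_elem fun j => ?_
        rw [← congrFun h1 j, map_sum, Finsupp.finsetSum_apply, Matrix.mulVec, dotProduct]
        refine Finset.sum_congr rfl fun i _ => ?_
        rw [map_smul, Finsupp.smul_apply, ← hcb, smul_eq_mul, mul_comm]
        rfl
      have h3 : (w : 𝔤) = x := by rw [hw]
      rw [← h3, AddSubmonoidClass.coe_finsetSum]
      rfl
  -- Small t suffices, as exp x is the N-th power of exp(x / N).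
  obtain ⟨N, hN⟩ := exists_nat_gt (1 / η)
  have hN0 : (0 : ℝ) < N := lt_trans (by positivity) hN
  have h1 := key (1 / N) ⟨by positivity, by rw [div_le_iff₀ hN0]; rw [div_lt_iff₀ hη] at hN; linarith⟩
  have h2 : x = N • ((((1 / N : ℝ)) : ℂ) • x) := by
    have : (N : ℂ) ≠ 0 := by exact_mod_cast hN0.ne'
    rw [← Nat.cast_smul_eq_nsmul ℂ, smul_smul]
    push_cast
    rw [mul_one_div_cancel this, one_smul]
  rw [h2, gexp_nsmul, ← h1]
  exact pow_mem (expProd_mem hgen _ _) _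

end Generation

end Cominuscule


namespace Cominuscule

/-! ### Root systems graded by z: the simple root ζ and coroot lengths -/

section Roots

variable {ι M N : Type*} [Finite ι] [AddCommGroup M] [Module ℂ M] [AddCommGroup N] [Module ℂ N]
  {P : RootPairing ι ℂ M N} {z : N} {f : ι → ℤ}

omit [Finite ι] in
theorem value_of_root_eq_add_zsmul (hf : ∀ i, P.root' i z = f i) {i j k : ι} {m : ℤ}
    (h : P.root k = P.root i + m • P.root j) : f k = f i + m * f j := by
  have : (f k : ℂ) = f i + m * f j := by
    rw [← hf, ← hf, ← hf]
    simp [RootPairing.root', h]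
  exact_mod_cast this

omit [Finite ι] in
theorem value_of_root_eq_neg (hf : ∀ i, P.root' i z = f i) {i k : ι}
    (h : P.root k = -P.root i) : f k = -f i := by
  have : (f k : ℂ) = -f i := by
    rw [← hf, ← hf]
    simp [RootPairing.root', h]
  exact_mod_cast this

section Height

variable {b : P.Base} {ζ : b.support}

omit [Finite ι] in
/-- The coefficient of `ζ` in a nonnegative combination of simple roots. -/
theorem exists_coord_eq_nat [P.IsRootSystem] (hf : ∀ i, P.root' i z = f i)
    (hb : ∀ β ∈ b.support, f β = 0 ∨ f β = 2) (hζ : f ζ = 2) {x : M}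
    (hx : x ∈ AddSubmonoid.closure (P.root '' b.support)) :
    ∃ n m : ℕ, b.toWeightBasis.coord ζ x = n ∧ P.toLinearMap x z = 2 * n + 2 * m := by
  -- Here n counts the occurrences of ζ and m those of the other simple roots on which z takes the
  -- value 2.
  classical
  induction hx using AddSubmonoid.closure_induction with
  | mem x hx =>
    obtain ⟨β, hβ, rfl⟩ := hx
    have h1 : P.toLinearMap (P.root β) z = f β := hf β
    rw [h1]
    have h2 := b.toWeightBasis_repr_root ⟨β, hβ⟩
    simp only at h2
    rw [Module.Basis.coord_apply, h2]
    by_cases h : (⟨β, hβ⟩ : b.support) = ζ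
    · refine ⟨1, 0, by simp [h], ?_⟩
      have : f β = 2 := by rw [← hζ, ← h]
      simp [this]
    · rcases hb β hβ with h3 | h3
      · exact ⟨0, 0, by simp [h], by simp [h3]⟩
      · exact ⟨0, 1, by simp [h], by simp [h3]⟩
  | zero => exact ⟨0, 0, by simp⟩
  | add x y _ _ hx hy =>
    obtain ⟨n, m, h1, h2⟩ := hx
    obtain ⟨n', m', h1', h2'⟩ := hy
    exact ⟨n + n', m + m', by rw [map_add, h1, h1']; push_cast; rfl,
      by rw [map_add, LinearMap.add_apply, h2, h2']; push_cast; ring⟩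

omit [Finite ι] in
theorem coord_eq_zero [P.IsRootSystem] (hf : ∀ i, P.root' i z = f i)
    (hb : ∀ β ∈ b.support, f β = 0 ∨ f β = 2) (hζ : f ζ = 2) {i : ι} (hi : f i = 0) :
    b.toWeightBasis.coord ζ (P.root i) = 0 := by
  have hi' : P.toLinearMap (P.root i) z = 0 := by
    rw [show P.toLinearMap (P.root i) z = f i from hf i, hi]; simp
  rcases b.root_mem_or_neg_mem i with h | h
  · obtain ⟨n, m, h1, h2⟩ := exists_coord_eq_nat hf hb hζ h
    rw [hi'] at h2
    have : 2 * n + 2 * m = 0 := by exact_mod_cast h2.symm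
    rw [h1, show n = 0 by omega]; simp
  · obtain ⟨n, m, h1, h2⟩ := exists_coord_eq_nat hf hb hζ h
    rw [map_neg, LinearMap.neg_apply, hi'] at h2
    have : 2 * n + 2 * m = 0 := by
      have : (2 * n + 2 * m : ℂ) = 0 := by rw [← h2]; simp
      exact_mod_cast this
    rw [map_neg, show n = 0 by omega] at h1
    simpa using h1

omit [Finite ι] in
-- A positive root with value 2 contains exactly one simple root of value 2, counted with
-- multiplicity; a negative root cannot have positive value.
theorem coord_eq_zero_or_one [P.IsRootSystem] (hf : ∀ i, P.root' i z = f i)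
    (hb : ∀ β ∈ b.support, f β = 0 ∨ f β = 2) (hζ : f ζ = 2) {i : ι} (hi : f i = 2) :
    b.toWeightBasis.coord ζ (P.root i) = 0 ∨ b.toWeightBasis.coord ζ (P.root i) = 1 := by
  have hi' : P.toLinearMap (P.root i) z = 2 := by
    rw [show P.toLinearMap (P.root i) z = f i from hf i, hi]; simp
  rcases b.root_mem_or_neg_mem i with h | h
  · obtain ⟨n, m, h1, h2⟩ := exists_coord_eq_nat hf hb hζ h
    rw [hi'] at h2
    have : 2 * n + 2 * m = 2 := by exact_mod_cast h2.symm
    rcases (by omega : n = 0 ∨ n = 1) with rfl | rfl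
    · left; simpa using h1
    · right; simpa using h1
  · obtain ⟨n, m, h1, h2⟩ := exists_coord_eq_nat hf hb hζ h
    rw [map_neg, LinearMap.neg_apply, hi'] at h2
    have : 2 * (n : ℤ) + 2 * m = -2 := by exact_mod_cast h2.symm
    omega

/-- In an irreducible root system on which `z` takes only the values `-2, 0, 2`, exactly one
simple root does not vanish on `z`. -/
theorem value_eq_zero_of_ne [P.IsRootSystem] [P.IsIrreducible] [P.IsCrystallographic] [P.IsReduced]
    (hf : ∀ i, P.root' i z = f i) (hf2 : ∀ i, f i = -2 ∨ f i = 0 ∨ f i = 2)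
    (hb : ∀ β ∈ b.support, f β = 0 ∨ f β = 2) (hζ : f ζ = 2) {β : ι} (hβ : β ∈ b.support)
    (hne : β ≠ ζ) : f β = 0 := by
  classical
  let φ := b.toWeightBasis.coord ζ
  -- By irreducibility these roots turn out to span. On them z equals twice the ζ-coefficient, hence
  -- so it does everywhere.
  let s : Set ι := {i | f i = 2 ∧ φ (P.root i) = 1}
  have hcr : ∀ i j : ι, P.root (P.reflectionPerm j i) =
      P.root i + (-P.pairingIn ℤ i j) • P.root j := by
    intro i j
    rw [RootPairing.root_reflectionPerm, neg_smul, RootPairing.reflection_apply_root' ℤ,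
      sub_eq_add_neg]
  -- If f j = 0, the reflection in j preserves s, so a nonzero pairing would place j in the span of
  -- s.
  have key : ∀ i ∈ s, ∀ j, f j = 0 ∨ f j = 2 → P.root j ∉ Submodule.span ℂ (P.root '' s) →
      P.pairingIn ℤ i j = 0 := by
    intro i hi j hj hjs
    rcases hj with hj | hj
    · by_contra hij
      refine hjs ?_
      have h1 : P.reflectionPerm j i ∈ s := by
        refine ⟨?_, ?_⟩
        · rw [value_of_root_eq_add_zsmul hf (hcr i j), hj, hi.1]; simp
        · rw [hcr, map_add, map_zsmul, hi.2, show φ (P.root j) = 0 from coord_eq_zero hf hb hζ hj]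
          simp
      have h2 : P.root j =
          ((P.pairingIn ℤ i j : ℂ)⁻¹) • (P.root i - P.root (P.reflectionPerm j i)) := by
        rw [hcr]
        have : (P.pairingIn ℤ i j : ℂ) ≠ 0 := by exact_mod_cast hij
        rw [neg_smul, sub_add_eq_sub_sub, sub_self, zero_sub, neg_neg,
          ← Int.cast_smul_eq_zsmul ℂ, smul_smul, inv_mul_cancel₀ this, one_smul]
      rw [h2]
      exact Submodule.smul_mem _ _ (Submodule.sub_mem _
        (Submodule.subset_span ⟨i, hi, rfl⟩) (Submodule.subset_span ⟨_, h1, rfl⟩))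
    · have hφ : φ (P.root j) = 0 := by
        rcases coord_eq_zero_or_one hf hb hζ hj with h | h
        · exact h
        · have : P.root j ∈ Submodule.span ℂ (P.root '' s) :=
            Submodule.subset_span ⟨j, ⟨hj, h⟩, rfl⟩
          exact absurd this hjs
      -- Now f j = 2 and j has ζ-coefficient 0. Were the pairing negative, i + j would be a root of
      -- value 4; were it positive, i - j would be a root of value 0 with ζ-coefficient 1.
      rcases lt_trichotomy (P.pairingIn ℤ i j) 0 with h | h | h
      · have hne' : P.root i ≠ -P.root j := by
          intro h'
          have := value_of_root_eq_neg hf h'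
          have := hi.1
          omega
        obtain ⟨k, hk⟩ := P.root_add_root_mem_of_pairingIn_neg h hne'
        have := value_of_root_eq_add_zsmul hf (m := 1) (i := i) (j := j) (k := k)
          (by rw [hk, one_smul])
        have h3 := hi.1
        have := hf2 k
        omega
      · exact h
      · have hne' : i ≠ j := by
          rintro rfl
          have := hi.2
          rw [hφ] at this
          simp at this
        obtain ⟨k, hk⟩ := P.root_sub_root_mem_of_pairingIn_pos h hne'
        have h4 := value_of_root_eq_add_zsmul hf (m := -1) (i := i) (j := j) (k := k)
          (by rw [hk, neg_smul, one_smul, sub_eq_add_neg])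
        have h3 := hi.1
        have h5 : φ (P.root k) = 0 := coord_eq_zero hf hb hζ (by omega)
        rw [hk, map_sub, hi.2, hφ] at h5
        simp at h5
  have hspan : Submodule.span ℂ (P.root '' s) = ⊤ := by
    refine P.span_root_image_eq_top_of_forall_orthogonal s ⟨ζ, hζ, ?_⟩ ?_
    · have h2 := b.toWeightBasis_repr_root ζ
      change b.toWeightBasis.coord ζ _ = 1
      rw [Module.Basis.coord_apply, h2]; simp
    · intro j hj i hi
      have h0 : P.pairingIn ℤ i j = 0 := by
        rcases hf2 j with h | h | h
        -- A root of value -2 is replaced by its negative.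
        · have hn : P.root (P.reflectionPerm j j) = -P.root j := by simp
          have h1 := key i hi (P.reflectionPerm j j)
            (Or.inr (by rw [value_of_root_eq_neg hf hn, h]; rfl))
            (by rw [hn]; exact fun h' => hj (by simpa using Submodule.neg_mem _ h'))
          simpa using h1
        · exact key i hi j (Or.inl h) hj
        · exact key i hi j (Or.inr h) hj
      have h1 : P.pairing i j = 0 := by
        rw [← P.algebraMap_pairingIn ℤ, h0]; simp
      exact ⟨(P.pairing_eq_zero_iff').1 h1, h1⟩
  let ψ : M →ₗ[ℂ] ℂ := (2 : ℂ) • φ - P.toLinearMap.flip z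
  have hψ : ψ = 0 := by
    have : Submodule.span ℂ (P.root '' s) ≤ LinearMap.ker ψ := by
      rw [Submodule.span_le]
      rintro _ ⟨i, hi, rfl⟩
      have h1 : P.toLinearMap (P.root i) z = f i := hf i
      simp [ψ, h1, hi.1, hi.2]
    rw [hspan, top_le_iff, LinearMap.ker_eq_top] at this
    exact this
  have h1 := LinearMap.congr_fun hψ (P.root β)
  have h2 := b.toWeightBasis_repr_root ⟨β, hβ⟩
  have h3 : P.toLinearMap (P.root β) z = f β := hf β
  have h4 : φ (P.root β) = 0 := by
    change b.toWeightBasis.coord ζ _ = 0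
    rw [Module.Basis.coord_apply]
    simp only at h2
    rw [h2, Finsupp.single_apply, if_neg]
    exact fun h => hne (congrArg Subtype.val h)
  simp only [ψ, LinearMap.sub_apply, LinearMap.smul_apply, h4, LinearMap.flip_apply, h3] at h1
  have : (f β : ℂ) = 0 := by simpa using h1
  exact_mod_cast this

end Height

section Length

variable (P) [P.IsCrystallographic]

/-- The squared length of a coroot for the canonical form. -/
noncomputable def corootLength (i : ι) : ℤ :=
  letI := Fintype.ofFinite ι
  (P.flip.posRootForm ℤ).rootLength i

theorem corootLength_pos (i : ι) : 0 < corootLength P i := by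
  let _ := Fintype.ofFinite ι
  exact (P.flip.posRootForm ℤ).rootLength_pos i

theorem pairingIn_mul_corootLength (i j : ι) :
    P.pairingIn ℤ i j * corootLength P i = P.pairingIn ℤ j i * corootLength P j := by
  let _ := Fintype.ofFinite ι
  exact (P.flip.posRootForm ℤ).pairingIn_mul_eq_pairingIn_mul_swap i j

theorem corootLength_eq [Fintype ι] (i : ι) :
    (corootLength P i : ℂ) = P.CorootForm (P.coroot i) (P.coroot i) := by
  have := (P.flip.posRootForm ℤ).algebraMap_rootLength i
  rw [corootLength, Subsingleton.elim (Fintype.ofFinite ι) ‹Fintype ι›]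
  exact this

theorem corootLength_reflectionPerm (i j : ι) :
    corootLength P (P.reflectionPerm j i) = corootLength P i := by
  let _ := Fintype.ofFinite ι
  have : (corootLength P (P.reflectionPerm j i) : ℂ) = corootLength P i := by
    rw [corootLength_eq, corootLength_eq]
    have := P.flip.rootForm_reflection_reflection_apply j (P.coroot i) (P.coroot i)
    rw [RootPairing.coroot_reflectionPerm]
    exact this
  exact_mod_cast this

/-- The canonical form identifies a root with twice its coroot divided by the squared length of the
coroot. -/
theorem two_mul_corootForm_coroot [Fintype ι] (z : N) (i : ι) :
    2 * P.CorootForm (P.coroot i) z = P.root' i z * corootLength P i := by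
  have h := congrArg (fun x => P.toLinearMap x z) (P.corootForm_self_smul_root i)
  simp only [map_nsmul, map_smul, LinearMap.smul_apply] at h
  rw [P.toLinearMap_apply_CoPolarization (P.coroot i)] at h
  rw [corootLength_eq, mul_comm (P.root' i z)]
  simpa only [smul_eq_mul, nsmul_eq_mul, Nat.cast_ofNat] using h.symm

variable {P}

/-- If `ω` is the fundamental coweight of `ζ` and only `ζ` does not vanish on `z`, then `ω` is
proportional to `z` for the canonical form. -/
theorem two_mul_apply_coroot_mul [P.IsRootSystem] {b : P.Base} {ζ : b.support}
    (hf : ∀ i, P.root' i z = f i) (hζ : f ζ = 2)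
    (h0 : ∀ β ∈ b.support, β ≠ ζ → f β = 0) (i : ι) :
    2 * b.toCoweightBasis.coord ζ (P.coroot i) * corootLength P ζ = f i * corootLength P i := by
  classical
  let _ := Fintype.ofFinite ι
  -- Both functionals are compared on the simple coroots, where the pairing with z vanishes except
  -- at ζ.
  have h1 : P.CorootForm.flip z = (corootLength P ζ : ℂ) • b.toCoweightBasis.coord ζ := by
    refine b.toCoweightBasis.ext fun β => ?_
    have h2 := two_mul_corootForm_coroot P z β
    rw [hf] at h2
    rw [RootPairing.Base.toCoweightBasis_apply, LinearMap.smul_apply, Module.Basis.coord_apply,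
      b.toCoweightBasis_repr_coroot, LinearMap.BilinForm.flip_apply, Finsupp.single_apply]
    by_cases h : β = ζ
    · subst h
      rw [hζ] at h2
      simp at h2 ⊢
      exact h2
    · rw [h0 β β.2 (fun h' => h (Subtype.ext h'))] at h2
      simpa [h] using h2
  have h2 := LinearMap.congr_fun h1 (P.coroot i)
  have h3 := two_mul_corootForm_coroot P z i
  rw [hf] at h3
  rw [LinearMap.BilinForm.flip_apply, LinearMap.smul_apply, smul_eq_mul] at h2
  rw [← h3, h2]
  ring

omit [Finite ι] [P.IsCrystallographic] in
theorem exists_int_apply_coroot [P.IsRootSystem] (b : P.Base) (ζ : b.support) (i : ι) :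
    ∃ n : ℤ, b.toCoweightBasis.coord ζ (P.coroot i) = n := by
  classical
  have h : ∀ x ∈ AddSubmonoid.closure (P.coroot '' b.support),
      ∃ n : ℤ, b.toCoweightBasis.coord ζ x = n := by
    intro x hx
    induction hx using AddSubmonoid.closure_induction with
    | mem x hx =>
      obtain ⟨β, hβ, rfl⟩ := hx
      have h2 := b.toCoweightBasis_repr_coroot ⟨β, hβ⟩
      simp only at h2
      rw [Module.Basis.coord_apply, h2, Finsupp.single_apply]
      split_ifs
      · exact ⟨1, by simp⟩
      · exact ⟨0, by simp⟩
    | zero => exact ⟨0, by simp⟩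
    | add x y _ _ hx hy =>
      obtain ⟨n, hn⟩ := hx
      obtain ⟨m, hm⟩ := hy
      exact ⟨n + m, by rw [map_add, hn, hm]; push_cast; rfl⟩
  rcases b.coroot_mem_or_neg_mem i with hi | hi
  · exact h _ hi
  · obtain ⟨n, hn⟩ := h _ hi
    refine ⟨-n, ?_⟩
    rw [map_neg] at hn
    push_cast
    rw [← hn, neg_neg]

end Length

end Roots

end Cominuscule


namespace Cominuscule

/-! ### Highest roots and dominant orthogonal sequences -/

section Cascade

variable {ι M N : Type*} [Finite ι] [AddCommGroup M] [Module ℂ M] [AddCommGroup N] [Module ℂ N]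
  {P : RootPairing ι ℂ M N} {z : N} {f : ι → ℤ}

omit [Finite ι] in
theorem root_reflectionPerm_eq_add [P.IsCrystallographic] (i j : ι) :
    P.root (P.reflectionPerm j i) = P.root i + (-P.pairingIn ℤ i j) • P.root j := by
  rw [RootPairing.root_reflectionPerm, neg_smul, RootPairing.reflection_apply_root' ℤ,
    sub_eq_add_neg]

-- The difference θ - ζ is a nonnegative combination of simple roots, so z is at least as large on θ
-- as on ζ, and 2 is the largest possible value.
omit [Finite ι] in
theorem IsHighestRoot.value_eq {b : P.Base} {ζ θ : ι} {S : Set ι} (hS : S ⊆ b.support)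
    (hf : ∀ i, P.root' i z = f i) (hf2 : ∀ i, f i = -2 ∨ f i = 0 ∨ f i = 2)
    (hb : ∀ β ∈ b.support, f β = 0 ∨ f β = 2) (hζ : f ζ = 2) (hζS : ζ ∈ S)
    (hθ : IsHighestRoot P S θ) : f θ = 2 := by
  have key : ∀ x ∈ AddSubmonoid.closure (P.root '' S), ∃ n : ℕ, P.toLinearMap x z = n := by
    intro x hx
    induction hx using AddSubmonoid.closure_induction with
    | mem x hx =>
      obtain ⟨β, hβ, rfl⟩ := hx
      have h1 : P.toLinearMap (P.root β) z = f β := hf β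
      rcases hb β (hS hβ) with h | h
      · exact ⟨0, by rw [h1, h]; simp⟩
      · exact ⟨2, by rw [h1, h]; simp⟩
    | zero => exact ⟨0, by simp⟩
    | add x y _ _ hx hy =>
      obtain ⟨n, hn⟩ := hx
      obtain ⟨m, hm⟩ := hy
      exact ⟨n + m, by rw [map_add, LinearMap.add_apply, hn, hm]; push_cast; rfl⟩
  obtain ⟨n, hn⟩ := key _ (hθ.2 ζ (Submodule.subset_span ⟨ζ, hζS, rfl⟩))
  have h1 : P.toLinearMap (P.root θ) z = f θ := hf θ
  have h2 : P.toLinearMap (P.root ζ) z = f ζ := hf ζ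
  rw [map_sub, LinearMap.sub_apply, h1, h2] at hn
  have : f θ - f ζ = n := by exact_mod_cast hn
  have := hf2 θ
  omega

/-- The highest root is compared with a dominant root γ of the same coroot length as ζ. Dominance
gives ⟨θ, γ^∨⟩ ≥ 2, the bound f ≥ -2 on a reflected root gives ⟨γ, θ^∨⟩ ≤ 2, and the ratio of these
pairings is the ratio of the squared lengths. -/
theorem IsHighestRoot.corootLength_le [P.IsCrystallographic] [P.IsReduced] {b : P.Base}
    {ζ θ : ι} {S : Set ι}
    (hS : S ⊆ b.support)
    (hf : ∀ i, P.root' i z = f i) (hf2 : ∀ i, f i = -2 ∨ f i = 0 ∨ f i = 2)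
    (hb : ∀ β ∈ b.support, f β = 0 ∨ f β = 2) (hζ : f ζ = 2) (hζS : ζ ∈ S)
    (hθ : IsHighestRoot P S θ) : corootLength P θ ≤ corootLength P ζ := by
  -- Maximal height forces dominance: reflecting in a simple root of S with negative pairing would
  -- stay in this set and increase the height.
  obtain ⟨γ, ⟨hγS, hγ2, hγl⟩, hmax⟩ := Set.exists_max_image
    {γ | γ ∈ rootsGenerated P S ∧ f γ = 2 ∧ corootLength P γ = corootLength P ζ} b.height
    (Set.toFinite _) ⟨ζ, Submodule.subset_span ⟨ζ, hζS, rfl⟩, hζ, rfl⟩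
  have hdom : ∀ β ∈ S, 0 ≤ P.pairingIn ℤ β γ := by
    intro β hβ
    by_contra! hneg
    rw [P.pairingIn_lt_zero_iff] at hneg
    have hr := root_reflectionPerm_eq_add (P := P) γ β
    have h1 : f (P.reflectionPerm β γ) = 2 := by
      have h2 := value_of_root_eq_add_zsmul hf hr
      rcases hb β (hS hβ) with h | h
      · rw [h2, h, hγ2]; simp
      · have := hf2 (P.reflectionPerm β γ)
        rw [h, hγ2] at h2
        omega
    have h2 := hmax (P.reflectionPerm β γ) ⟨?_, h1, ?_⟩
    · rw [b.height_add_zsmul hr,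
        b.height_one_of_mem_support (hS hβ)] at h2
      simp at h2
      omega
    · change P.root _ ∈ Submodule.span ℤ _
      rw [hr]
      exact add_mem hγS (Submodule.smul_mem _ _ (Submodule.subset_span ⟨β, hβ, rfl⟩))
    · rw [corootLength_reflectionPerm, hγl]
  have key : ∀ x ∈ AddSubmonoid.closure (P.root '' S),
      ∃ n : ℕ, P.toLinearMap x (P.coroot γ) = n := by
    intro x hx
    induction hx using AddSubmonoid.closure_induction with
    | mem x hx =>
      obtain ⟨β, hβ, rfl⟩ := hx
      obtain ⟨n, hn⟩ := Int.eq_ofNat_of_zero_le (hdom β hβ)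
      refine ⟨n, ?_⟩
      have := P.algebraMap_pairingIn ℤ β γ
      rw [hn] at this
      rw [RootPairing.root_coroot_eq_pairing, ← this]
      simp
    | zero => exact ⟨0, by simp⟩
    | add x y _ _ hx hy =>
      obtain ⟨n, hn⟩ := hx
      obtain ⟨m, hm⟩ := hy
      exact ⟨n + m, by rw [map_add, LinearMap.add_apply, hn, hm]; push_cast; rfl⟩
  obtain ⟨n, hn⟩ := key _ (hθ.2 γ hγS)
  have h1 : P.pairingIn ℤ θ γ = 2 + n := by
    rw [map_sub, LinearMap.sub_apply, RootPairing.root_coroot_eq_pairing,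
      RootPairing.root_coroot_eq_pairing, RootPairing.pairing_same,
      ← P.algebraMap_pairingIn ℤ] at hn
    have : ((P.pairingIn ℤ θ γ : ℤ) : ℂ) = 2 + n := by
      rw [← hn]; simp
    exact_mod_cast this
  -- Reflecting γ in θ gives a root of value 2 - 2⟨γ, θ^∨⟩, which is at least -2.
  have h2 : P.pairingIn ℤ γ θ ≤ 2 := by
    have := value_of_root_eq_add_zsmul hf (root_reflectionPerm_eq_add (P := P) γ θ)
    rw [hθ.value_eq hS hf hf2 hb hζ hζS, hγ2] at this
    have := hf2 (P.reflectionPerm θ γ)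
    omega
  have h3 := pairingIn_mul_corootLength P γ θ
  have h4 := corootLength_pos P θ
  have h5 := corootLength_pos P γ
  rw [← hγl]
  rw [h1] at h3
  nlinarith [mul_nonneg (Int.natCast_nonneg n) h4.le, mul_le_mul_of_nonneg_right h2 h5.le]

/-- Later highest roots are combinations of simple roots orthogonal to the earlier ones. For the
last claim, ϖ(α_i^∨) is the ratio of the squared lengths of α_i^∨ and ζ^∨; it is a positive integer
and at most 1. -/
theorem IsDominantOrthogonal.value_eq_and [P.IsRootSystem] [P.IsIrreducible]
    [P.IsCrystallographic] [P.IsReduced] {b : P.Base} {ζ : b.support} {r : ℕ} {α : Fin r → ι}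
    (hα : IsDominantOrthogonal b ζ α)
    (hf : ∀ i, P.root' i z = f i) (hf2 : ∀ i, f i = -2 ∨ f i = 0 ∨ f i = 2)
    (hb : ∀ β ∈ b.support, f β = 0 ∨ f β = 2) (hζ : f ζ = 2) :
    (∀ i, f (α i) = 2) ∧ (∀ i j, i ≠ j → P.pairing (α i) (α j) = 0) ∧
      ∀ i, b.toCoweightBasis.coord ζ (P.coroot (α i)) = 1 := by
  obtain ⟨S, hS0, hSα, hSS⟩ := hα
  have hmem : ∀ n (hn : n < r), (ζ : ι) ∈ S ⟨n, hn⟩ := by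
    intro n hn
    cases n with
    | zero => rw [hS0 ⟨0, hn⟩ rfl]; exact ζ.2
    | succ n =>
      rw [(hSS ⟨n, by omega⟩ ⟨n + 1, hn⟩ rfl).2]
      exact Relation.ReflTransGen.refl
  have hstep : ∀ n (hn : n + 1 < r), ∀ β ∈ S ⟨n + 1, hn⟩,
      β ∈ S ⟨n, by omega⟩ ∧ P.pairing β (α ⟨n, by omega⟩) = 0 := by
    intro n hn β hβ
    have h1 := hSS ⟨n, by omega⟩ ⟨n + 1, hn⟩ rfl
    rw [h1.2] at hβ
    -- The path of length zero reaches ζ without any condition; its membership comes from the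
    -- requirement that the algorithm goes on.
    have : β ∈ S ⟨n, by omega⟩ \ nonOrthogonal P (S ⟨n, by omega⟩) (α ⟨n, by omega⟩) := by
      rcases Relation.ReflTransGen.cases_tail hβ with rfl | ⟨_, _, h2, _⟩
      · exact ⟨hmem _ _, h1.1⟩
      · exact h2
    refine ⟨this.1, ?_⟩
    by_contra h2
    exact this.2 ⟨this.1, h2⟩
  have hanti : ∀ k n (hn : n + k < r), S ⟨n + k, hn⟩ ⊆ S ⟨n, by omega⟩ := by
    intro k
    induction k with
    | zero => intro n hn; exact subset_rfl
    | succ k ih => exact fun n hn β hβ => ih n (by omega) (hstep (n + k) hn β hβ).1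
  have hsub : ∀ i, S i ⊆ b.support := by
    rintro ⟨n, hn⟩
    have := hanti n 0 (by omega)
    simp only [zero_add] at this
    exact this.trans (hS0 _ rfl).subset
  have horth : ∀ i j, i < j → P.pairing (α j) (α i) = 0 := by
    rintro ⟨n, hn⟩ ⟨m, hm⟩ hlt
    have hlt' : n < m := hlt
    obtain ⟨k, rfl⟩ : ∃ k, m = (n + 1) + k := ⟨m - (n + 1), by omega⟩
    have h1 : ∀ x ∈ Submodule.span ℤ (P.root '' S ⟨n + 1 + k, hm⟩),
        P.toLinearMap x (P.coroot (α ⟨n, hn⟩)) = 0 := by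
      intro x hx
      induction hx using Submodule.span_induction with
      | mem x hx =>
        obtain ⟨β, hβ, rfl⟩ := hx
        rw [RootPairing.root_coroot_eq_pairing]
        exact (hstep n (by omega) β (hanti k (n + 1) hm hβ)).2
      | zero => simp
      | add x y _ _ hx hy => rw [map_add, LinearMap.add_apply, hx, hy, add_zero]
      | smul a x _ hx => rw [map_zsmul, LinearMap.smul_apply, hx, smul_zero]
    have := h1 _ (hSα ⟨n + 1 + k, hm⟩).1
    rwa [RootPairing.root_coroot_eq_pairing] at this
  have hval : ∀ i, f (α i) = 2 := fun i =>
    (hSα i).value_eq (hsub i) hf hf2 hb hζ (hmem i i.2)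
  refine ⟨hval, fun i j hij => ?_, fun i => ?_⟩
  · rcases lt_or_gt_of_ne hij with h | h
    · rw [P.pairing_eq_zero_iff']; exact horth i j h
    · exact horth j i h
  · obtain ⟨n, hn⟩ := exists_int_apply_coroot b ζ (α i)
    have h1 := two_mul_apply_coroot_mul hf hζ
      (fun β hβ hne => value_eq_zero_of_ne hf hf2 hb hζ hβ hne) (α i)
    rw [hn, hval i] at h1
    have h2 : 2 * n * corootLength P ζ = 2 * corootLength P (α i) := by exact_mod_cast h1
    have h3 := (hSα i).corootLength_le (hsub i) hf hf2 hb hζ (hmem i i.2)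
    have h4 := corootLength_pos P (α i)
    have h5 := corootLength_pos P ζ
    have : n = 1 := by
      apply le_antisymm
      · by_contra! hlt
        nlinarith
      · by_contra! hlt
        nlinarith
    rw [hn, this]; simp

omit [Finite ι] in
/-- The sum of the pairings with an orthogonal family on which `z` takes the value `2`. -/
theorem sum_pairingIn_le_two [P.IsCrystallographic] {r : ℕ} {α : Fin r → ι}
    (hf : ∀ i, P.root' i z = f i) (hf2 : ∀ i, f i = -2 ∨ f i = 0 ∨ f i = 2)
    (hα : ∀ i, f (α i) = 2) (horth : ∀ i j, i ≠ j → P.pairing (α i) (α j) = 0)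
    {δ : ι} (hδ : f δ = 2) : ∑ i, P.pairingIn ℤ δ (α i) ≤ 2 := by
  classical
  -- Reflecting δ successively in the α_i lowers z by twice each pairing, and orthogonality leaves
  -- the remaining pairings unchanged. After all reflections the value is still at least -2.
  have key : ∀ s : Finset (Fin r), ∃ k, f k = 2 - 2 * ∑ i ∈ s, P.pairingIn ℤ δ (α i) ∧
      ∀ i ∉ s, P.pairingIn ℤ k (α i) = P.pairingIn ℤ δ (α i) := by
    intro s
    induction s using Finset.induction_on with
    | empty => exact ⟨δ, by simp [hδ], fun _ _ => rfl⟩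
    | insert i s hi ih =>
      obtain ⟨k, hk1, hk2⟩ := ih
      have hr := root_reflectionPerm_eq_add (P := P) k (α i)
      refine ⟨P.reflectionPerm (α i) k, ?_, fun j hj => ?_⟩
      · rw [value_of_root_eq_add_zsmul hf hr, hk1, hk2 i hi, hα i, Finset.sum_insert hi]
        ring
      · rw [Finset.mem_insert, not_or] at hj
        rw [← hk2 j hj.2]
        have h1 : (P.pairingIn ℤ (P.reflectionPerm (α i) k) (α j) : ℂ) =
            P.pairingIn ℤ k (α j) := by
          have e1 := P.algebraMap_pairingIn ℤ (P.reflectionPerm (α i) k) (α j)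
          have e2 := P.algebraMap_pairingIn ℤ k (α j)
          simp only [algebraMap_int_eq, eq_intCast] at e1 e2
          rw [e1, e2, ← RootPairing.root_coroot_eq_pairing, hr, map_add, LinearMap.add_apply,
            map_zsmul, LinearMap.smul_apply, RootPairing.root_coroot_eq_pairing,
            RootPairing.root_coroot_eq_pairing, horth i j (Ne.symm hj.1), smul_zero, add_zero]
        exact_mod_cast h1
  obtain ⟨k, hk, -⟩ := key Finset.univ
  have := hf2 k
  omega

/-- There is a base all of whose elements take nonpositive values on a given integral element. -/
theorem exists_base_forall_nonpos [P.IsRootSystem] [P.IsCrystallographic] [P.IsReduced]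
    (hf : ∀ i, P.root' i z = f i) : ∃ b : P.Base, ∀ β ∈ b.support, f β ≤ 0 := by
  let _i : Module ℚ M := Module.compHom M (algebraMap ℚ ℂ)
  obtain ⟨f₀, hf₀⟩ : ∃ f : Module.Dual ℚ M, ∀ i, f (P.root i) ≠ 0 :=
    Module.exists_dual_forall_apply_ne_zero P.root <| by simp [P.ne_zero]
  -- A ℚ-linear retraction of ℂ onto ℚ turns evaluation at z into a rational-valued additive map on
  -- all of M.
  obtain ⟨π, hπ⟩ := (Algebra.linearMap ℚ ℂ).exists_leftInverse_of_injective
    (LinearMap.ker_eq_bot.2 (algebraMap ℚ ℂ).injective)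
  have hπ' : ∀ n : ℤ, π n = n := by
    intro n
    have := LinearMap.congr_fun hπ (n : ℚ)
    simpa using this
  obtain ⟨C, hC⟩ : ∃ C : ℚ, ∀ i, f₀ (P.root i) ≤ C := Finite.exists_le _
  obtain ⟨C', hC'⟩ : ∃ C : ℚ, ∀ i, -f₀ (P.root i) ≤ C := Finite.exists_le _
  -- This n exceeds |f₀| on all roots. As nonzero values of f have absolute value at least 1, the
  -- sign of f₀ - n f is opposite to that of f, and f₀ decides only where f = 0.
  let n : ℚ := max C C' + 1
  let g : M →+ ℚ := π.toAddMonoidHom.comp (P.toLinearMap.flip z).toAddMonoidHom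
  have hg : ∀ i, g (P.root i) = f i := by
    intro i
    change π (P.toLinearMap (P.root i) z) = f i
    rw [show P.toLinearMap (P.root i) z = f i from hf i, hπ']
  let F : M →+ ℚ := (f₀ : M →+ ℚ) - (AddMonoidHom.mulLeft n).comp g
  have hF : ∀ i, F (P.root i) = f₀ (P.root i) - n * f i := by
    intro i
    change f₀ (P.root i) - n * g (P.root i) = _
    rw [hg]
  have hn1 : ∀ i, f₀ (P.root i) < n := fun i =>
    (hC i).trans_lt (lt_of_le_of_lt (le_max_left C C') (lt_add_one _))
  have hn2 : ∀ i, -f₀ (P.root i) < n := fun i =>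
    (hC' i).trans_lt (lt_of_le_of_lt (le_max_right C C') (lt_add_one _))
  have hneg : ∀ i, 0 < f i → F (P.root i) < 0 := by
    intro i hi
    have h1 : (1 : ℚ) ≤ f i := by exact_mod_cast hi
    rw [hF]
    nlinarith [hn1 i, hn2 i]
  have hpos : ∀ i, f i < 0 → 0 < F (P.root i) := by
    intro i hi
    have h1 : (f i : ℚ) ≤ -1 := by exact_mod_cast Int.le_sub_one_of_lt hi
    rw [hF]
    nlinarith [hn1 i, hn2 i]
  have hF0 : ∀ i, F (P.root i) ≠ 0 := by
    intro i
    rcases lt_trichotomy (f i) 0 with h | h | h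
    · exact (hpos i h).ne'
    · rw [hF, h]; simpa using hf₀ i
    · exact (hneg i h).ne
  let := P.indexNeg
  refine ⟨RootPairing.Base.mk' P (IsAddIndecomposable.baseOf P.root F)
    (P.linearIndepOn_root_baseOf F hF0)
    (fun i ↦ IsAddIndecomposable.mem_or_neg_mem_closure_baseOf P.root F i (hF0 i) (by simp)),
    fun β hβ => ?_⟩
  have hβ' : β ∈ IsAddIndecomposable.baseOf P.root F := by
    simpa [RootPairing.Base.mk'] using hβ
  by_contra! hlt
  have h1 : 0 < F (P.root β) := hβ'.1
  exact absurd (hneg β hlt) (not_lt.2 h1.le)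

end Cascade

end Cominuscule


namespace Cominuscule

/-! ### Root spaces and 𝔰𝔩₂-triples -/

section RootSpaces

variable {𝔤 : Type*} [LieRing 𝔤] [LieAlgebra ℂ 𝔤] [FiniteDimensional ℂ 𝔤] [IsKilling ℂ 𝔤]
  {𝔱 : LieSubalgebra ℂ 𝔤} [𝔱.IsCartanSubalgebra]

/-- The root space of `α`, as a subspace of `𝔤`. -/
noncomputable abbrev rootLine (α : 𝔱.root) : Submodule ℂ 𝔤 :=
  (rootSpace 𝔱 (α : LieModule.Weight ℂ 𝔱 𝔤)).toSubmodule

theorem mem_rootLine {α : 𝔱.root} {x : 𝔤} :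
    x ∈ rootLine α ↔ ∀ t : 𝔱, ⁅(t : 𝔤), x⁆ = (rootSystem 𝔱).root α t • x := by
  constructor
  · exact fun h t => lie_eq_smul_of_mem_rootSpace h t
  · exact fun h => LieModule.weightSpace_le_genWeightSpace 𝔤 _
      ((LieModule.mem_weightSpace ..).2 fun t => h t)

theorem lie_of_mem_rootLine {α : 𝔱.root} {x : 𝔤} (h : x ∈ rootLine α) (t : 𝔱) :
    ⁅(t : 𝔤), x⁆ = (rootSystem 𝔱).root α t • x :=
  mem_rootLine.1 h t

theorem lie_of_mem_rootLine' {α : 𝔱.root} {x : 𝔤} (h : x ∈ rootLine α) (t : 𝔱) :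
    ⁅x, (t : 𝔤)⁆ = -((rootSystem 𝔱).root α t • x) := by
  rw [← lie_skew, lie_of_mem_rootLine h]

omit [IsKilling ℂ 𝔤] in
theorem weight_isNonZero (α : 𝔱.root) : (α : LieModule.Weight ℂ 𝔱 𝔤).IsNonZero := by
  have := α.2
  simpa only [LieSubalgebra.root, Finset.mem_filter, Finset.mem_univ, true_and] using this

theorem exists_eq_smul_of_mem_rootLine {α : 𝔱.root} {x y : 𝔤} (hx : x ∈ rootLine α) (hx0 : x ≠ 0)
    (hy : y ∈ rootLine α) : ∃ c : ℂ, y = c • x := by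
  obtain ⟨c, hc⟩ := (finrank_eq_one_iff_of_nonzero' (⟨x, hx⟩ : rootLine α) (by simpa using hx0)).1
    (finrank_rootSpace_eq_one (α : LieModule.Weight ℂ 𝔱 𝔤) (weight_isNonZero α)) ⟨y, hy⟩
  exact ⟨c, by simpa using (congrArg Subtype.val hc).symm⟩

theorem lie_eq_zero_of_mem_rootLine {α : 𝔱.root} {x y : 𝔤} (hx : x ∈ rootLine α)
    (hy : y ∈ rootLine α) : ⁅x, y⁆ = 0 := by
  rcases eq_or_ne x 0 with rfl | h
  · simp
  · obtain ⟨c, rfl⟩ := exists_eq_smul_of_mem_rootLine hx h hy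
    simp

/-- The negative of a root. -/
noncomputable def negRoot (α : 𝔱.root) : 𝔱.root := (rootSystem 𝔱).reflectionPerm α α

theorem root_negRoot (α : 𝔱.root) : (rootSystem 𝔱).root (negRoot α) = -(rootSystem 𝔱).root α := by
  rw [negRoot, RootPairing.root_reflectionPerm, RootPairing.reflection_apply_self]

theorem coroot_negRoot (α : 𝔱.root) :
    (rootSystem 𝔱).coroot (negRoot α) = -(rootSystem 𝔱).coroot α := by
  rw [negRoot, RootPairing.coroot_reflectionPerm, RootPairing.coreflection_apply_self]

theorem root_negRoot_apply (α : 𝔱.root) (t : 𝔱) :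
    (rootSystem 𝔱).root (negRoot α) t = -(rootSystem 𝔱).root α t := by
  rw [root_negRoot, LinearMap.neg_apply]

@[simp] theorem negRoot_negRoot (α : 𝔱.root) : negRoot (negRoot α) = α :=
  (rootSystem 𝔱).root.injective (by rw [root_negRoot, root_negRoot, neg_neg])

/-- Vectors `e ∈ 𝔤_α` and `f ∈ 𝔤_{-α}` with `⁅e, f⁆ = α^∨`. -/
structure IsTriple (α : 𝔱.root) (e f : 𝔤) : Prop where
  mem : e ∈ rootLine α
  mem_neg : f ∈ rootLine (negRoot α)
  lie : ⁅e, f⁆ = ((rootSystem 𝔱).coroot α : 𝔱)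

theorem mem_rootLine_neg {α : 𝔱.root} {x : 𝔤} :
    x ∈ rootLine (negRoot α) ↔
      x ∈ rootSpace 𝔱 (-((α : LieModule.Weight ℂ 𝔱 𝔤) : 𝔱 → ℂ)) := by
  rw [mem_rootLine]
  simp only [root_negRoot_apply]
  exact ⟨fun h => LieModule.weightSpace_le_genWeightSpace 𝔤 _
    ((LieModule.mem_weightSpace ..).2 fun t => h t), fun h t => lie_eq_smul_of_mem_rootSpace h t⟩

theorem exists_isTriple (α : 𝔱.root) : ∃ e f : 𝔤, IsTriple α e f := by
  obtain ⟨h, e, f, ht, he, hf⟩ := exists_isSl2Triple_of_weight_isNonZero (weight_isNonZero α)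
  refine ⟨e, f, he, mem_rootLine_neg.2 hf, ?_⟩
  rw [ht.lie_e_f]
  exact ht.h_eq_coroot (weight_isNonZero α) he hf

theorem coroot_ne_zero (α : 𝔱.root) : ((rootSystem 𝔱).coroot α : 𝔱) ≠ 0 :=
  (rootSystem 𝔱).flip.ne_zero α

namespace IsTriple

variable {α : 𝔱.root} {e f : 𝔤}

theorem ne_zero (h : IsTriple α e f) : e ≠ 0 := by
  rintro rfl
  have := h.lie
  rw [zero_lie] at this
  exact coroot_ne_zero α (by exact_mod_cast this.symm)

theorem ne_zero' (h : IsTriple α e f) : f ≠ 0 := by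
  rintro rfl
  have := h.lie
  rw [lie_zero] at this
  exact coroot_ne_zero α (by exact_mod_cast this.symm)

theorem smul (h : IsTriple α e f) {c : ℂ} (hc : c ≠ 0) : IsTriple α (c • e) (c⁻¹ • f) where
  mem := Submodule.smul_mem _ _ h.mem
  mem_neg := Submodule.smul_mem _ _ h.mem_neg
  lie := by rw [smul_lie, lie_smul, smul_smul, mul_inv_cancel₀ hc, one_smul, h.lie]

theorem neg (h : IsTriple α e f) : IsTriple α (-e) (-f) where
  mem := neg_mem h.mem
  mem_neg := neg_mem h.mem_neg
  lie := by simp [h.lie]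

theorem swap (h : IsTriple α e f) :
    IsTriple (negRoot α) f e where
  mem := h.mem_neg
  mem_neg := by rw [negRoot_negRoot]; exact h.mem
  lie := by rw [← lie_skew, h.lie, coroot_negRoot]; rfl

theorem lie_h (h : IsTriple α e f) : ⁅(((rootSystem 𝔱).coroot α : 𝔱) : 𝔤), e⁆ = (2 : ℂ) • e := by
  rw [lie_of_mem_rootLine h.mem]
  congr 1
  exact (rootSystem 𝔱).root_coroot_two α

theorem lie_h' (h : IsTriple α e f) :
    ⁅(((rootSystem 𝔱).coroot α : 𝔱) : 𝔤), f⁆ = -(2 : ℂ) • f := by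
  rw [lie_of_mem_rootLine h.mem_neg, root_negRoot_apply]
  congr 2
  exact (rootSystem 𝔱).root_coroot_two α

theorem exists_smul_eq (h : IsTriple α e f) {e' f' : 𝔤} (h' : IsTriple α e' f') :
    ∃ c : ℂ, c ≠ 0 ∧ e' = c • e ∧ f' = c⁻¹ • f := by
  obtain ⟨c, rfl⟩ := exists_eq_smul_of_mem_rootLine h.mem h.ne_zero h'.mem
  obtain ⟨d, rfl⟩ := exists_eq_smul_of_mem_rootLine h.mem_neg h.ne_zero' h'.mem_neg
  have h1 := h'.lie
  rw [smul_lie, lie_smul, smul_smul, h.lie] at h1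
  have h2 : (c * d - 1) • (((rootSystem 𝔱).coroot α : 𝔱) : 𝔤) = 0 := by
    rw [sub_smul, h1, one_smul, sub_self]
  have h3 : c * d = 1 := by
    rcases smul_eq_zero.1 h2 with h | h
    · exact sub_eq_zero.1 h
    · exact absurd (by exact_mod_cast h) (coroot_ne_zero α)
  have hc : c ≠ 0 := left_ne_zero_of_mul_eq_one h3
  exact ⟨c, hc, rfl, by rw [eq_inv_of_mul_eq_one_right h3]⟩

end IsTriple

/-- The representative `exp e exp (-f) exp e` of a reflection. -/
noncomputable def reflElt (e f : 𝔤) : SCGroup 𝔤 := gexp e * gexp (-f) * gexp e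

/-- On 𝔱 and on the triple the exponential series of e and -f stop by the quadratic term, so the
product can be computed explicitly. -/
theorem IsTriple.groupRep_reflElt {α : 𝔱.root} {e f : 𝔤} (h : IsTriple α e f) (x : 𝔱) :
    groupRep 𝔤 𝔤 (reflElt e f) x =
      ((x - (rootSystem 𝔱).root α x • (rootSystem 𝔱).coroot α : 𝔱) : 𝔤) := by
  set c := (rootSystem 𝔱).root α x
  set k : 𝔤 := (((rootSystem 𝔱).coroot α : 𝔱) : 𝔤) with hk
  have hek : ⁅e, k⁆ = -(2 : ℂ) • e := by rw [← lie_skew, h.lie_h, neg_smul]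
  have hfk : ⁅-f, k⁆ = -(2 : ℂ) • f := by rw [neg_lie, lie_skew, h.lie_h']
  have hex : ⁅e, (x : 𝔤)⁆ = -(c • e) := lie_of_mem_rootLine' h.mem x
  have hfx : ⁅-f, (x : 𝔤)⁆ = -(c • f) := by
    rw [neg_lie, lie_of_mem_rootLine' h.mem_neg x, root_negRoot_apply, neg_smul, neg_neg]
  have hef : ⁅-f, e⁆ = k := by rw [neg_lie, lie_skew, h.lie]
  have h1 : groupRep 𝔤 𝔤 (gexp e) x = x - c • e := by
    rw [groupRep_gexp_eq hex (v₂ := 0) (by simp) (by simp)]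
    simp [sub_eq_add_neg]
  have h2 : groupRep 𝔤 𝔤 (gexp (-f)) x = x - c • f := by
    rw [groupRep_gexp_eq hfx (v₂ := 0) (by simp) (by simp)]
    simp [sub_eq_add_neg]
  have h3 : groupRep 𝔤 𝔤 (gexp (-f)) e = e + k - f := by
    rw [groupRep_gexp_eq hef hfk (by simp)]
    module
  have h4 : groupRep 𝔤 𝔤 (gexp e) e = e := groupRep_gexp_of_lie_eq_zero (by simp)
  have h5 : groupRep 𝔤 𝔤 (gexp e) k = k - (2 : ℂ) • e := by
    rw [groupRep_gexp_eq hek (v₂ := 0) (by simp) (by simp)]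
    module
  rw [reflElt, map_mul, map_mul, Module.End.mul_apply, Module.End.mul_apply, h1, map_sub, map_smul,
    h2, h3]
  have h6 : (x : 𝔤) - c • f - c • (e + k - f) = x - c • e - c • k := by module
  rw [h6, map_sub, map_sub, map_smul, map_smul, h1, h4, h5]
  push_cast
  module

/-- The bracket has weight α + β, which is either not a weight of 𝔤, or zero, or a root. -/
theorem lie_mem_rootLine_cases {α β : 𝔱.root} {x y : 𝔤} (hx : x ∈ rootLine α)
    (hy : y ∈ rootLine β) : ⁅x, y⁆ = 0 ∨
      ((rootSystem 𝔱).root α = -(rootSystem 𝔱).root β ∧ ⁅x, y⁆ ∈ 𝔱) ∨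
      ∃ γ : 𝔱.root, (rootSystem 𝔱).root γ = (rootSystem 𝔱).root α + (rootSystem 𝔱).root β ∧
        ⁅x, y⁆ ∈ rootLine γ := by
  have h := lie_mem_genWeightSpace_of_mem_genWeightSpace hx hy
  by_cases h0 : rootSpace 𝔱 (((α : LieModule.Weight ℂ 𝔱 𝔤) : 𝔱 → ℂ) +
      ((β : LieModule.Weight ℂ 𝔱 𝔤) : 𝔱 → ℂ)) = ⊥
  · left
    change ⁅x, y⁆ ∈ rootSpace 𝔱 _ at h
    rw [h0] at h
    simpa using h
  right
  by_cases h1 : ((α : LieModule.Weight ℂ 𝔱 𝔤) : 𝔱 → ℂ) + ((β : LieModule.Weight ℂ 𝔱 𝔤) : 𝔱 → ℂ) = 0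
  · left
    change ⁅x, y⁆ ∈ rootSpace 𝔱 _ at h
    rw [h1, rootSpace_zero_eq] at h
    refine ⟨?_, h⟩
    ext t
    have := congrFun h1 t
    simpa using eq_neg_of_add_eq_zero_left this
  · right
    let w : LieModule.Weight ℂ 𝔱 𝔤 := ⟨_, h0⟩
    have hw : w ∈ 𝔱.root := by
      simp only [LieSubalgebra.root, Finset.mem_filter, Finset.mem_univ, true_and]
      exact h1
    exact ⟨⟨w, hw⟩, by ext t; simp [w], h⟩

end RootSpaces

end Cominuscule


namespace Cominuscule

/-! ### Representatives of the Weyl group and the exchange of letters -/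

section Reflections

variable {𝔤 : Type*} [LieRing 𝔤] [LieAlgebra ℂ 𝔤] [FiniteDimensional ℂ 𝔤] [IsKilling ℂ 𝔤]
  {𝔱 : LieSubalgebra ℂ 𝔤} [𝔱.IsCartanSubalgebra]

/-- `g` normalizes `𝔱` and permutes the root spaces by `σ`. -/
structure ActsBy (g : SCGroup 𝔤) (σ : Equiv.Perm 𝔱.root) : Prop where
  mem : ∀ α, ∀ x ∈ rootLine α, groupRep 𝔤 𝔤 g x ∈ rootLine (σ α)
  neg : ∀ α, σ (negRoot α) = negRoot (σ α)
  coroot : ∀ α, groupRep 𝔤 𝔤 g ((rootSystem 𝔱).coroot α : 𝔱) = ((rootSystem 𝔱).coroot (σ α) : 𝔱)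

namespace ActsBy

variable {g k : SCGroup 𝔤} {σ τ : Equiv.Perm 𝔱.root}

theorem one : ActsBy (1 : SCGroup 𝔤) (1 : Equiv.Perm 𝔱.root) where
  mem α x hx := by simpa using hx
  neg α := rfl
  coroot α := by simp

theorem mul (hg : ActsBy g σ) (hk : ActsBy k τ) : ActsBy (g * k) (σ * τ) where
  mem α x hx := by
    rw [map_mul]
    exact hg.mem _ _ (hk.mem _ _ hx)
  neg α := by rw [Equiv.Perm.mul_apply, hk.neg, hg.neg]; rfl
  coroot α := by rw [map_mul, Module.End.mul_apply, hk.coroot, hg.coroot]; rfl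

/-- Root spaces are lines, so g maps the root space of σ⁻¹ α onto that of α. -/
theorem inv_mem (hg : ActsBy g σ) {α : 𝔱.root} {x : 𝔤} (hx : x ∈ rootLine α) :
    groupRep 𝔤 𝔤 g⁻¹ x ∈ rootLine (σ⁻¹ α) := by
  obtain ⟨e, f, h⟩ := exists_isTriple (σ⁻¹ α)
  have h1 := hg.mem _ _ h.mem
  rw [show σ (σ⁻¹ α) = α from σ.apply_symm_apply α] at h1
  have h2 : groupRep 𝔤 𝔤 g e ≠ 0 := fun h' =>
    h.ne_zero (groupRep_injective g (h'.trans (map_zero _).symm))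
  obtain ⟨c, rfl⟩ := exists_eq_smul_of_mem_rootLine h1 h2 hx
  rw [map_smul, groupRep_inv_apply]
  exact Submodule.smul_mem _ _ h.mem

theorem inv (hg : ActsBy g σ) : ActsBy g⁻¹ σ⁻¹ where
  mem _ _ hx := hg.inv_mem hx
  neg α := by
    rw [Equiv.Perm.inv_eq_iff_eq, hg.neg, show σ (σ⁻¹ α) = α from σ.apply_symm_apply α]
  coroot α := by
    have := hg.coroot (σ⁻¹ α)
    rw [show σ (σ⁻¹ α) = α from σ.apply_symm_apply α] at this
    rw [← this, groupRep_inv_apply]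

theorem isTriple (hg : ActsBy g σ) {α : 𝔱.root} {e f : 𝔤} (h : IsTriple α e f) :
    IsTriple (σ α) (groupRep 𝔤 𝔤 g e) (groupRep 𝔤 𝔤 g f) where
  mem := hg.mem _ _ h.mem
  mem_neg := by rw [← hg.neg]; exact hg.mem _ _ h.mem_neg
  lie := by rw [← groupRep_lie, h.lie, hg.coroot]

end ActsBy

omit [IsKilling ℂ 𝔤] in
theorem mul_reflElt_mul_inv (g : SCGroup 𝔤) (e f : 𝔤) :
    g * reflElt e f * g⁻¹ = reflElt (groupRep 𝔤 𝔤 g e) (groupRep 𝔤 𝔤 g f) := by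
  rw [reflElt, reflElt, ← map_neg, ← mul_gexp_mul_inv, ← mul_gexp_mul_inv]
  group

theorem root_reflectionPerm_apply (α β : 𝔱.root) (t : 𝔱) :
    (rootSystem 𝔱).root ((rootSystem 𝔱).reflectionPerm α β) t =
      (rootSystem 𝔱).root β (t - (rootSystem 𝔱).root α t • (rootSystem 𝔱).coroot α) := by
  rw [RootPairing.root_reflectionPerm, RootPairing.reflection_apply, map_sub, map_smul,
    LinearMap.sub_apply, LinearMap.smul_apply, smul_eq_mul, smul_eq_mul, mul_comm]
  rfl

theorem IsTriple.actsBy {α : 𝔱.root} {e f : 𝔤} (h : IsTriple α e f) :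
    ActsBy (reflElt e f) ((rootSystem 𝔱).reflectionPerm α) where
  mem β x hx := by
    rw [mem_rootLine]
    intro t
    -- The reflection is an involution, so t is the image of its own reflection.
    have h1 : groupRep 𝔤 𝔤 (reflElt e f)
        ((t - (rootSystem 𝔱).root α t • (rootSystem 𝔱).coroot α : 𝔱) : 𝔤) = t := by
      rw [h.groupRep_reflElt]
      congr 1
      have h2 : (rootSystem 𝔱).root α ((rootSystem 𝔱).coroot α) = 2 :=
        (rootSystem 𝔱).root_coroot_two α
      rw [map_sub, map_smul, h2]
      module
    rw [root_reflectionPerm_apply, ← map_smul, ← lie_of_mem_rootLine hx, groupRep_lie, h1]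
  neg β := by
    apply (rootSystem 𝔱).root.injective
    rw [root_negRoot, RootPairing.root_reflectionPerm, RootPairing.root_reflectionPerm,
      root_negRoot, map_neg]
  coroot β := by
    rw [h.groupRep_reflElt, RootPairing.coroot_reflectionPerm, RootPairing.coreflection_apply]
    rfl

variable (𝔱) in
/-- The maximal torus with Lie algebra `𝔱`. -/
def torus : Subgroup (SCGroup 𝔤) := connectedSubgroup 𝔱.toSubmodule

omit [FiniteDimensional ℂ 𝔤] [IsKilling ℂ 𝔤] [𝔱.IsCartanSubalgebra] in
theorem gexp_mem_torus (t : 𝔱) : gexp (t : 𝔤) ∈ torus 𝔱 :=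
  Subgroup.subset_closure ⟨t, t.2, rfl⟩

theorem IsTriple.mul_mul_inv_mem_torus {α : 𝔱.root} {e f : 𝔤} (h : IsTriple α e f)
    {t : SCGroup 𝔤} (ht : t ∈ torus 𝔱) : reflElt e f * t * (reflElt e f)⁻¹ ∈ torus 𝔱 := by
  have : torus 𝔱 ≤ (torus 𝔱).comap (MulAut.conj (reflElt e f)).toMonoidHom := by
    refine (Subgroup.closure_le _).2 ?_
    rintro _ ⟨x, hx, rfl⟩
    change reflElt e f * gexp x * (reflElt e f)⁻¹ ∈ torus 𝔱
    rw [mul_gexp_mul_inv, h.groupRep_reflElt ⟨x, hx⟩]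
    exact gexp_mem_torus _
  exact this ht

/-- Two triples for the same root differ by a scaling, which is the adjoint action of a torus
element; reflections normalize the torus. -/
theorem IsTriple.exists_torus_mul {α : 𝔱.root} {e f e' f' : 𝔤} (h : IsTriple α e f)
    (h' : IsTriple α e' f') : ∃ t ∈ torus 𝔱, reflElt e' f' = t * reflElt e f := by
  obtain ⟨c, hc, rfl, rfl⟩ := h.exists_smul_eq h'
  -- Half the logarithm, because α takes the value 2 on α^∨.
  let s := Complex.log c / 2
  let x : 𝔱 := s • (rootSystem 𝔱).coroot α
  have h1 : groupRep 𝔤 𝔤 (gexp (x : 𝔤)) e = c • e := by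
    rw [groupRep_gexp_of_lie_eq_smul (c := Complex.log c), Complex.exp_log hc]
    change ⁅s • (((rootSystem 𝔱).coroot α : 𝔱) : 𝔤), e⁆ = _
    rw [smul_lie, h.lie_h, smul_smul, div_mul_cancel₀ _ two_ne_zero]
  have h2 : groupRep 𝔤 𝔤 (gexp (x : 𝔤)) f = c⁻¹ • f := by
    rw [groupRep_gexp_of_lie_eq_smul (c := -Complex.log c), Complex.exp_neg, Complex.exp_log hc]
    change ⁅s • (((rootSystem 𝔱).coroot α : 𝔱) : 𝔤), f⁆ = _
    rw [smul_lie, h.lie_h', smul_smul, mul_neg, div_mul_cancel₀ _ two_ne_zero]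
  rw [← h1, ← h2, ← mul_reflElt_mul_inv]
  refine ⟨gexp (x : 𝔤) * (reflElt e f * (gexp (x : 𝔤))⁻¹ * (reflElt e f)⁻¹),
    mul_mem (gexp_mem_torus _) (h.mul_mul_inv_mem_torus (inv_mem (gexp_mem_torus _))), by group⟩

omit [FiniteDimensional ℂ 𝔤] [IsKilling ℂ 𝔤] in
theorem reflElt_neg (e f : 𝔤) : reflElt (-e) (-f) = (reflElt e f)⁻¹ := by
  simp only [reflElt, gexp_neg]
  group

/-- The inverse of `reflElt e f` comes from the triple (-e, -f), so it agrees up to the torus with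
`reflElt e' f'`. -/
theorem IsTriple.mul_self_mem_torus {α : 𝔱.root} {e f e' f' : 𝔤} (h : IsTriple α e f)
    (h' : IsTriple α e' f') : reflElt e' f' * reflElt e f ∈ torus 𝔱 := by
  obtain ⟨t, ht, h1⟩ := h.neg.exists_torus_mul h'
  rw [h1, reflElt_neg, inv_mul_cancel_right]
  exact ht

/-- A representative of the reflection in `α`. -/
noncomputable def weylElt (α : 𝔱.root) : SCGroup 𝔤 :=
  reflElt (exists_isTriple α).choose (exists_isTriple α).choose_spec.choose

theorem exists_weylElt_eq (α : 𝔱.root) :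
    ∃ e f : 𝔤, IsTriple α e f ∧ weylElt α = reflElt e f :=
  ⟨_, _, (exists_isTriple α).choose_spec.choose_spec, rfl⟩

theorem actsBy_weylElt (α : 𝔱.root) : ActsBy (weylElt α) ((rootSystem 𝔱).reflectionPerm α) := by
  obtain ⟨e, f, h, he⟩ := exists_weylElt_eq α
  rw [he]
  exact h.actsBy

theorem weylElt_mul_mul_inv_mem_torus (α : 𝔱.root) {t : SCGroup 𝔤} (ht : t ∈ torus 𝔱) :
    weylElt α * t * (weylElt α)⁻¹ ∈ torus 𝔱 := by
  obtain ⟨e, f, h, he⟩ := exists_weylElt_eq α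
  rw [he]
  exact h.mul_mul_inv_mem_torus ht

theorem IsTriple.weylElt_mul_mem_torus {α : 𝔱.root} {e f : 𝔤} (h : IsTriple α e f) :
    weylElt α * reflElt e f ∈ torus 𝔱 := by
  obtain ⟨e', f', h', he⟩ := exists_weylElt_eq α
  rw [he]
  exact h.mul_self_mem_torus h'

theorem weylElt_mul_self_mem_torus (α : 𝔱.root) : weylElt α * weylElt α ∈ torus 𝔱 := by
  obtain ⟨e', f', h', he⟩ := exists_weylElt_eq α
  nth_rewrite 2 [he]
  exact h'.weylElt_mul_mem_torus

/-- The product of representatives of reflections. -/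
noncomputable def weylWord (l : List 𝔱.root) : SCGroup 𝔤 := (l.map weylElt).prod

/-- The product of reflections. -/
noncomputable def wordPerm (l : List 𝔱.root) : Equiv.Perm 𝔱.root :=
  (l.map (rootSystem 𝔱).reflectionPerm).prod

theorem actsBy_weylWord (l : List 𝔱.root) : ActsBy (weylWord l) (wordPerm l) := by
  induction l with
  | nil => exact ActsBy.one
  | cons α l ih => simpa [weylWord, wordPerm] using (actsBy_weylElt α).mul ih

theorem weylWord_mul_mul_inv_mem_torus (l : List 𝔱.root) {t : SCGroup 𝔤} (ht : t ∈ torus 𝔱) :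
    weylWord l * t * (weylWord l)⁻¹ ∈ torus 𝔱 := by
  induction l with
  | nil => simpa [weylWord] using ht
  | cons α l ih =>
    have := weylElt_mul_mul_inv_mem_torus α ih
    simpa [weylWord, mul_assoc] using this

/-- If a word in the simple reflections maps the simple root `β` to a negative root, then one
of its letters can be cancelled against `β`. -/
theorem exists_eq_append_of_not_isPos {b : (rootSystem 𝔱).Base} {β : 𝔱.root} (hβ : b.IsPos β) :
    ∀ l : List 𝔱.root, (∀ δ ∈ l, δ ∈ b.support) → ¬ b.IsPos (wordPerm l β) →
      ∃ l₁ δ l₂, l = l₁ ++ δ :: l₂ ∧ wordPerm l₂ β = δ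
  | [], _, h => absurd hβ h
  | δ :: l, hl, h => by
    by_cases hpos : b.IsPos (wordPerm l β)
    -- The reflection in the simple root δ makes only one positive root negative, namely δ.
    · refine ⟨[], δ, l, rfl, ?_⟩
      by_contra hne
      refine h ?_
      have := hpos.reflectionPerm (hl δ (by simp)) hne
      simpa [wordPerm] using this
    · obtain ⟨l₁, δ', l₂, rfl, h2⟩ :=
        exists_eq_append_of_not_isPos hβ l (fun δ' hδ' => hl δ' (by simp [hδ'])) hpos
      exact ⟨δ :: l₁, δ', l₂, rfl, h2⟩

/-- Deletion of two letters from a word. -/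
theorem exists_torus_mul_weylWord {β δ : 𝔱.root} (l₁ l₂ : List 𝔱.root) (h : wordPerm l₂ β = δ) :
    ∃ t ∈ torus 𝔱, weylWord (l₁ ++ δ :: l₂ ++ [β]) = t * weylWord (l₁ ++ l₂) := by
  obtain ⟨e, f, hef, he⟩ := exists_weylElt_eq β
  have h1 := (actsBy_weylWord l₂).isTriple hef
  rw [h] at h1
  -- Conjugating the representative of β by the word l₂ gives one for δ, which cancels the letter δ
  -- up to the torus.
  have h2 := weylWord_mul_mul_inv_mem_torus l₁ h1.weylElt_mul_mem_torus
  refine ⟨_, h2, ?_⟩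
  rw [← mul_reflElt_mul_inv, ← he]
  simp only [weylWord, List.map_append, List.map_cons, List.prod_append, List.prod_cons,
    List.map_nil, List.prod_nil, mul_one]
  group

end Reflections

end Cominuscule


namespace Cominuscule

/-! ### Borel subgroups and the Bruhat decomposition -/

section Bruhat

variable {𝔤 : Type*} [LieRing 𝔤] [LieAlgebra ℂ 𝔤] [FiniteDimensional ℂ 𝔤] [IsSimple ℂ 𝔤]
  {𝔱 : LieSubalgebra ℂ 𝔤} [𝔱.IsCartanSubalgebra]

omit [IsSimple ℂ 𝔤] in
theorem rootSum_le {p : 𝔱.root → Prop} {U : Submodule ℂ 𝔤} :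
    rootSum 𝔱 p ≤ U ↔ ∀ α, p α → ∀ x ∈ rootLine α, x ∈ U :=
  iSup₂_le_iff

omit [IsSimple ℂ 𝔤] in
theorem mem_rootSum {p : 𝔱.root → Prop} {α : 𝔱.root} (hα : p α) {x : 𝔤} (hx : x ∈ rootLine α) :
    x ∈ rootSum 𝔱 p :=
  rootSum_le.1 le_rfl α hα x hx

variable (𝔱) in
/-- The elements of `𝔱` and the root vectors for the roots in `p`. -/
def rootGens (p : 𝔱.root → Prop) : Set 𝔤 :=
  {x | x ∈ 𝔱 ∨ ∃ α, p α ∧ x ∈ rootLine α}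

omit [IsSimple ℂ 𝔤] in
theorem span_rootGens (p : 𝔱.root → Prop) :
    Submodule.span ℂ (rootGens 𝔱 p) = 𝔱.toSubmodule ⊔ rootSum 𝔱 p := by
  apply le_antisymm
  · rw [Submodule.span_le]
    rintro x (hx | ⟨α, hα, hx⟩)
    · exact Submodule.mem_sup_left hx
    · exact Submodule.mem_sup_right (mem_rootSum hα hx)
  · refine sup_le (fun x hx => Submodule.subset_span (Or.inl hx)) (rootSum_le.2 ?_)
    exact fun α hα x hx => Submodule.subset_span (Or.inr ⟨α, hα, hx⟩)

omit [IsSimple ℂ 𝔤] in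
theorem smul_mem_rootGens {p : 𝔱.root → Prop} (c : ℂ) (x : 𝔤) (hx : x ∈ rootGens 𝔱 p) :
    c • x ∈ rootGens 𝔱 p := by
  rcases hx with hx | ⟨α, hα, hx⟩
  · exact Or.inl (𝔱.smul_mem c hx)
  · exact Or.inr ⟨α, hα, Submodule.smul_mem _ c hx⟩

omit [IsSimple ℂ 𝔤] in
theorem top_eq_sup_rootSum : (⊤ : Submodule ℂ 𝔤) = 𝔱.toSubmodule ⊔ rootSum 𝔱 fun _ => True := by
  have h1 := congrArg LieSubmodule.toSubmodule (LieModule.iSup_genWeightSpace_eq_top' ℂ 𝔱 𝔤)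
  rw [LieSubmodule.iSup_toSubmodule, LieSubmodule.top_toSubmodule] at h1
  rw [eq_comm, eq_top_iff, ← h1]
  refine iSup_le fun χ => ?_
  by_cases h : χ.IsZero
  · have h2 : rootSpace 𝔱 (χ : 𝔱 → ℂ) = 𝔱.toLieSubmodule := by
      rw [h, rootSpace_zero_eq]
    change (rootSpace 𝔱 (χ : 𝔱 → ℂ)).toSubmodule ≤ _
    rw [h2]
    exact le_sup_left
  · have hχ : χ ∈ 𝔱.root := by
      simpa only [LieSubalgebra.root, Finset.mem_filter, Finset.mem_univ, true_and] using h
    exact fun x hx => Submodule.mem_sup_right (mem_rootSum (α := ⟨χ, hχ⟩) trivial hx)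

/-- The subalgebra `𝔱 ⊕ ⨁ 𝔤_α`, for a set of roots that is closed under addition. -/
noncomputable def closedSubalgebra (p : 𝔱.root → Prop)
    (hp : ∀ α β γ, (rootSystem 𝔱).root γ = (rootSystem 𝔱).root α + (rootSystem 𝔱).root β →
      p α → p β → p γ) : LieSubalgebra ℂ 𝔤 where
  __ := 𝔱.toSubmodule ⊔ rootSum 𝔱 p
  lie_mem' := by
    intro x y hx hy
    change x ∈ 𝔱.toSubmodule ⊔ rootSum 𝔱 p at hx
    change y ∈ 𝔱.toSubmodule ⊔ rootSum 𝔱 p at hy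
    change ⁅x, y⁆ ∈ 𝔱.toSubmodule ⊔ rootSum 𝔱 p
    rw [← span_rootGens] at hx hy
    induction hx, hy using Submodule.span_induction₂ with
    | mem_mem x y hx hy =>
      rcases hx with hx | ⟨α, hα, hx⟩ <;> rcases hy with hy | ⟨β, hβ, hy⟩
      · exact Submodule.mem_sup_left (𝔱.lie_mem hx hy)
      · rw [lie_of_mem_rootLine hy ⟨x, hx⟩]
        exact Submodule.smul_mem _ _ (Submodule.mem_sup_right (mem_rootSum hβ hy))
      · rw [lie_of_mem_rootLine' hx ⟨y, hy⟩]
        exact neg_mem (Submodule.smul_mem _ _ (Submodule.mem_sup_right (mem_rootSum hα hx)))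
      · rcases lie_mem_rootLine_cases hx hy with h | ⟨-, h⟩ | ⟨γ, hγ, h⟩
        · rw [h]; exact zero_mem _
        · exact Submodule.mem_sup_left h
        · exact Submodule.mem_sup_right (mem_rootSum (hp _ _ _ hγ hα hβ) h)
    | zero_left y hy => simp
    | zero_right x hx => simp
    | add_left x y z _ _ _ h1 h2 => rw [add_lie]; exact add_mem h1 h2
    | add_right x y z _ _ _ h1 h2 => rw [lie_add]; exact add_mem h1 h2
    | smul_left r x y _ _ h => rw [smul_lie]; exact Submodule.smul_mem _ _ h
    | smul_right r x y _ _ h => rw [lie_smul]; exact Submodule.smul_mem _ _ h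

theorem gexp_mem_closure_rootGens {p : 𝔱.root → Prop}
    (hp : ∀ α β γ, (rootSystem 𝔱).root γ = (rootSystem 𝔱).root α + (rootSystem 𝔱).root β →
      p α → p β → p γ) {x : 𝔤} (hx : x ∈ 𝔱.toSubmodule ⊔ rootSum 𝔱 p) :
    gexp x ∈ Subgroup.closure (gexp '' rootGens 𝔱 p) :=
  gexp_mem_closure_of_span_eq (𝔟 := closedSubalgebra p hp) smul_mem_rootGens
    (span_rootGens p) hx

variable (b : (rootSystem 𝔱).Base)

/-- The Borel subalgebra of a base. -/
noncomputable def borelSub : Submodule ℂ 𝔤 := 𝔱.toSubmodule ⊔ rootSum 𝔱 b.IsPos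

/-- The Borel subgroup of a base. -/
noncomputable def borel : Subgroup (SCGroup 𝔤) := connectedSubgroup (borelSub b)

variable {b}

theorem gexp_mem_borel {x : 𝔤} (hx : x ∈ borelSub b) : gexp x ∈ borel b :=
  Subgroup.subset_closure ⟨x, hx, rfl⟩

theorem gexp_mem_borel_of_isPos {α : 𝔱.root} (hα : b.IsPos α) {x : 𝔤} (hx : x ∈ rootLine α) :
    gexp x ∈ borel b :=
  gexp_mem_borel (Submodule.mem_sup_right (mem_rootSum hα hx))

theorem torus_le_borel : torus 𝔱 ≤ borel b :=
  Subgroup.closure_mono (Set.image_mono fun _ hx => Submodule.mem_sup_left hx)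

theorem borel_le_closure_rootGens : borel b ≤ Subgroup.closure (gexp '' rootGens 𝔱 b.IsPos) := by
  refine (Subgroup.closure_le _).2 ?_
  rintro _ ⟨x, hx, rfl⟩
  exact gexp_mem_closure_rootGens (fun α β γ h hα hβ => hα.add hβ h) hx

theorem lie_mem_rootSum_ne {β : 𝔱.root} (hβ : b.IsPos β) {x y : 𝔤} (hx : x ∈ rootLine β)
    (hy : y ∈ rootSum 𝔱 fun α => b.IsPos α ∧ α ≠ β) :
    ⁅x, y⁆ ∈ rootSum 𝔱 fun α => b.IsPos α ∧ α ≠ β := by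
  have : rootSum 𝔱 (fun α => b.IsPos α ∧ α ≠ β) ≤
      (rootSum 𝔱 fun α => b.IsPos α ∧ α ≠ β).comap (LieModule.toEnd ℂ 𝔤 𝔤 x) := by
    refine rootSum_le.2 fun α hα y hy => ?_
    change ⁅x, y⁆ ∈ rootSum 𝔱 fun α => b.IsPos α ∧ α ≠ β
    rcases lie_mem_rootLine_cases hx hy with h | ⟨h, -⟩ | ⟨γ, hγ, h⟩
    · rw [h]; exact zero_mem _
    · exfalso
      rw [← root_negRoot] at h
      have h1 := (rootSystem 𝔱).root.injective h
      rw [h1] at hβ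
      exact (RootPairing.Base.IsPos.neg_iff_not b α).1 hβ hα.1
    · refine mem_rootSum ⟨hβ.add hα.1 hγ, ?_⟩ h
      rintro rfl
      simp at hγ
  exact this hy

theorem weylElt_mul_gexp_mul_inv_mem_borel {β : 𝔱.root} (hβ : β ∈ b.support) {y : 𝔤}
    (hy : y ∈ rootSum 𝔱 fun α => b.IsPos α ∧ α ≠ β) :
    weylElt β * gexp y * (weylElt β)⁻¹ ∈ borel b := by
  rw [mul_gexp_mul_inv]
  refine gexp_mem_borel (Submodule.mem_sup_right ?_)
  have : rootSum 𝔱 (fun α => b.IsPos α ∧ α ≠ β) ≤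
      (rootSum 𝔱 b.IsPos).comap (groupRep 𝔤 𝔤 (weylElt β)) :=
    rootSum_le.2 fun α hα y hy =>
      mem_rootSum (hα.1.reflectionPerm hβ hα.2) ((actsBy_weylElt β).mem α y hy)
  exact this hy

theorem rootSum_ne_le_borelSub {β : 𝔱.root} :
    (rootSum 𝔱 fun α => b.IsPos α ∧ α ≠ β) ≤ borelSub b :=
  rootSum_le.2 fun _ hα _ hx => Submodule.mem_sup_right (mem_rootSum hα.1 hx)

/-- The elements of the Borel subgroup that the reflection in `β` conjugates into it. -/
noncomputable def borelInf (b : (rootSystem 𝔱).Base) (β : 𝔱.root) : Subgroup (SCGroup 𝔤) :=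
  borel b ⊓ (borel b).comap (MulAut.conj (weylElt β)).toMonoidHom

theorem mem_borelInf {β : 𝔱.root} {c : SCGroup 𝔤} :
    c ∈ borelInf b β ↔ c ∈ borel b ∧ weylElt β * c * (weylElt β)⁻¹ ∈ borel b := Iff.rfl

/-- The factor from the root group of β is kept on the right. Torus elements normalize it, and a
generator of another positive root, moved past it, stays in the sum of the positive root spaces
other than β, which the reflection in β permutes. -/
theorem exists_eq_mul_gexp {β : 𝔱.root} (hβ : β ∈ b.support) {c : SCGroup 𝔤}
    (hc : c ∈ borel b) : ∃ c' ∈ borelInf b β, ∃ x ∈ rootLine β, c = c' * gexp x := by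
  have hpos := b.isPos_of_mem_support hβ
  have hstep : ∀ y ∈ rootGens 𝔱 b.IsPos, ∀ c : SCGroup 𝔤,
      (∃ c' ∈ borelInf b β, ∃ x ∈ rootLine β, c = c' * gexp x) →
      ∃ c' ∈ borelInf b β, ∃ x ∈ rootLine β, c * gexp y = c' * gexp x := by
    rintro y hy c ⟨c', hc', x, hx, rfl⟩
    rcases hy with hy | ⟨α, hα, hy⟩
    · refine ⟨c' * gexp y, mul_mem hc' (mem_borelInf.2 ⟨torus_le_borel (gexp_mem_torus ⟨y, hy⟩),
        torus_le_borel (weylElt_mul_mul_inv_mem_torus β (gexp_mem_torus ⟨y, hy⟩))⟩),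
        groupRep 𝔤 𝔤 (gexp y)⁻¹ x, ?_, by rw [mul_assoc, mul_assoc, gexp_mul]⟩
      rw [← gexp_neg]
      refine groupRep_gexp_mem (fun u hu => ?_) hx
      rw [neg_lie, lie_of_mem_rootLine hu ⟨y, hy⟩]
      exact neg_mem (Submodule.smul_mem _ _ hu)
    · rcases eq_or_ne α β with rfl | hne
      · exact ⟨c', hc', x + y, add_mem hx hy,
          by rw [mul_assoc, gexp_add (lie_eq_zero_of_mem_rootLine hx hy)]⟩
      · have h1 : groupRep 𝔤 𝔤 (gexp x) y ∈ rootSum 𝔱 fun α => b.IsPos α ∧ α ≠ β :=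
          groupRep_gexp_mem (fun u hu => lie_mem_rootSum_ne hpos hx hu) (mem_rootSum ⟨hα, hne⟩ hy)
        exact ⟨c' * gexp (groupRep 𝔤 𝔤 (gexp x) y), mul_mem hc' (mem_borelInf.2
          ⟨gexp_mem_borel (rootSum_ne_le_borelSub h1), weylElt_mul_gexp_mul_inv_mem_borel hβ h1⟩),
          x, hx, by rw [mul_assoc, mul_assoc, mul_gexp]⟩
  replace hc := borel_le_closure_rootGens hc
  induction hc using Subgroup.closure_induction_right with
  | one => exact ⟨1, one_mem _, 0, zero_mem _, by simp⟩
  | mul_right c hcc y hy ih =>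
    obtain ⟨y, hy, rfl⟩ := hy
    exact hstep y hy c ih
  | mul_inv_cancel c hcc y hy ih =>
    obtain ⟨y, hy, rfl⟩ := hy
    rw [← gexp_neg]
    exact hstep (-y) (by simpa using smul_mem_rootGens (-1) y hy) c ih

-- The root groups of simple roots lie in the Borel subgroup, and conjugation by simple reflections
-- reaches those of all roots. Both signs are carried along because the induction over roots has a
-- step for negation.
variable (b) in
theorem closure_borel_union :
    Subgroup.closure ((borel b : Set (SCGroup 𝔤)) ∪ weylElt '' (b.support : Set 𝔱.root)) = ⊤ := by
  set G₁ := Subgroup.closure ((borel b : Set (SCGroup 𝔤)) ∪ weylElt '' (b.support : Set 𝔱.root))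
  have hB : borel b ≤ G₁ := fun c hc => Subgroup.subset_closure (Or.inl hc)
  have hw : ∀ β ∈ b.support, weylElt β ∈ G₁ := fun β hβ =>
    Subgroup.subset_closure (Or.inr ⟨β, hβ, rfl⟩)
  have hconj : ∀ β ∈ b.support, ∀ α : 𝔱.root, (∀ x ∈ rootLine α, gexp x ∈ G₁) →
      ∀ x ∈ rootLine ((rootSystem 𝔱).reflectionPerm β α), gexp x ∈ G₁ := by
    intro β hβ α hα x hx
    have h1 := (actsBy_weylElt β).inv_mem hx
    have h2 : ((rootSystem 𝔱).reflectionPerm β)⁻¹ ((rootSystem 𝔱).reflectionPerm β α) = α :=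
      Equiv.symm_apply_apply _ _
    rw [h2] at h1
    have h3 := mul_mem (mul_mem (hw β hβ) (hα _ h1)) (inv_mem (hw β hβ))
    rwa [mul_gexp_mul_inv, groupRep_apply_inv] at h3
  have hroot : ∀ α : 𝔱.root, (∀ x ∈ rootLine α, gexp x ∈ G₁) ∧
      ∀ x ∈ rootLine (negRoot α), gexp x ∈ G₁ := by
    intro α
    refine b.induction_reflect α (p := fun α => (∀ x ∈ rootLine α, gexp x ∈ G₁) ∧
      ∀ x ∈ rootLine (negRoot α), gexp x ∈ G₁) ?_ ?_ ?_
    · intro α h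
      change (∀ x ∈ rootLine (negRoot α), gexp x ∈ G₁) ∧
        ∀ x ∈ rootLine (negRoot (negRoot α)), gexp x ∈ G₁
      rw [negRoot_negRoot]
      exact ⟨h.2, h.1⟩
    · intro β hβ
      have h1 : ∀ x ∈ rootLine β, gexp x ∈ G₁ := fun x hx =>
        hB (gexp_mem_borel_of_isPos (b.isPos_of_mem_support hβ) hx)
      exact ⟨h1, hconj β hβ β h1⟩
    · intro α β h hβ
      refine ⟨hconj β hβ α h.1, ?_⟩
      rw [← (actsBy_weylElt β).neg]
      exact hconj β hβ _ h.2
  rw [eq_top_iff, ← closure_range_gexp, Subgroup.closure_le]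
  rintro _ ⟨x, rfl⟩
  have h1 := gexp_mem_closure_rootGens (𝔱 := 𝔱) (p := fun _ => True) (by simp)
    (x := x) (by rw [← top_eq_sup_rootSum]; trivial)
  refine (Subgroup.closure_le _).2 ?_ h1
  rintro _ ⟨y, hy | ⟨α, -, hy⟩, rfl⟩
  · exact hB (torus_le_borel (gexp_mem_torus ⟨y, hy⟩))
  · exact (hroot α).1 y hy

/-- Words in the simple reflections. -/
def IsSimpleWord (b : (rootSystem 𝔱).Base) (l : List 𝔱.root) : Prop := ∀ β ∈ l, β ∈ b.support

/-- The union of the double cosets of the words in the simple reflections. -/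
def bruhatSet (b : (rootSystem 𝔱).Base) : Set (SCGroup 𝔤) :=
  {g | ∃ l, IsSimpleWord b l ∧ ∃ c ∈ borel b, ∃ c' ∈ borel b, g = c * weylWord l * c'}

theorem mul_mem_bruhatSet {c g : SCGroup 𝔤} (hc : c ∈ borel b) (hg : g ∈ bruhatSet b) :
    c * g ∈ bruhatSet b := by
  obtain ⟨l, hl, c₁, h₁, c₂, h₂, rfl⟩ := hg
  exact ⟨l, hl, c * c₁, mul_mem hc h₁, c₂, h₂, by simp only [mul_assoc]⟩

theorem mem_bruhatSet_mul {c g : SCGroup 𝔤} (hc : c ∈ borel b) (hg : g ∈ bruhatSet b) :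
    g * c ∈ bruhatSet b := by
  obtain ⟨l, hl, c₁, h₁, c₂, h₂, rfl⟩ := hg
  exact ⟨l, hl, c₁, h₁, c₂ * c, mul_mem h₂ hc, by simp only [mul_assoc]⟩

theorem weylWord_mem_bruhatSet {l : List 𝔱.root} (hl : IsSimpleWord b l) :
    weylWord l ∈ bruhatSet b :=
  ⟨l, hl, 1, one_mem _, 1, one_mem _, by simp⟩

/-- This is the multiplication rule s B w ⊆ B w B ∪ B s w B, reduced to the root group of the simple
root. If w⁻¹β is positive, the root group moves through w to the right. Otherwise a computation in
SL₂ removes the reflection. -/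
theorem weylElt_mul_gexp_mul_weylWord_mem {β : 𝔱.root} (hβ : β ∈ b.support) {x : 𝔤}
    (hx : x ∈ rootLine β) {l : List 𝔱.root} (hl : IsSimpleWord b l) :
    weylElt β * gexp x * weylWord l ∈ bruhatSet b := by
  have hcons : weylElt β * weylWord l ∈ bruhatSet b := by
    have : IsSimpleWord b (β :: l) := by
      intro δ hδ
      rcases List.mem_cons.1 hδ with rfl | h
      · exact hβ
      · exact hl δ h
    simpa [weylWord] using weylWord_mem_bruhatSet this
  by_cases hpos : b.IsPos ((wordPerm l)⁻¹ β)
  · rw [mul_assoc, gexp_mul, ← mul_assoc]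
    exact mem_bruhatSet_mul (gexp_mem_borel_of_isPos hpos ((actsBy_weylWord l).inv_mem hx)) hcons
  · have h1 : weylElt β * gexp x * weylWord l =
        gexp (groupRep 𝔤 𝔤 (weylElt β) x) * (weylElt β * weylWord l) := by
      rw [mul_gexp, mul_assoc]
    rw [h1]
    have hy : groupRep 𝔤 𝔤 (weylElt β) x ∈ rootLine (negRoot β) := (actsBy_weylElt β).mem β x hx
    set y := groupRep 𝔤 𝔤 (weylElt β) x
    rcases eq_or_ne y 0 with h0 | h0
    · rw [h0, gexp_zero, one_mul]; exact hcons
    obtain ⟨e, f, hef⟩ := exists_isTriple β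
    obtain ⟨d, hd⟩ := exists_eq_smul_of_mem_rootLine hef.mem_neg hef.ne_zero' hy
    have hd0 : d ≠ 0 := by
      rintro rfl
      exact h0 (by simpa using hd)
    -- The scaling makes -y the negative member of the triple, so that `reflElt e' (-y)` has exp y
    -- as its middle factor.
    have h2 := hef.smul (c := -d⁻¹) (by simpa using hd0)
    set e' := (-d⁻¹) • e
    have h3 : (-d⁻¹)⁻¹ • f = -y := by rw [hd, inv_neg, inv_inv, neg_smul]
    rw [h3] at h2
    have h4 : gexp y = gexp (-e') * reflElt e' (-y) * gexp (-e') := by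
      rw [reflElt, neg_neg, gexp_neg]; group
    obtain ⟨e₁, f₁, hef₁, he₁⟩ := exists_weylElt_eq β
    obtain ⟨t, ht, h5⟩ := hef₁.exists_torus_mul h2
    rw [← he₁] at h5
    have hposβ := b.isPos_of_mem_support hβ
    have h6 := ((actsBy_weylElt β).mul (actsBy_weylWord l)).inv_mem (neg_mem h2.mem)
    -- The right factor exp(-e') is carried through s_β w to the root -w⁻¹β, which is positive in
    -- this case.
    have h7 : ((rootSystem 𝔱).reflectionPerm β * wordPerm l)⁻¹ β =
        negRoot ((wordPerm l)⁻¹ β) := by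
      rw [← (actsBy_weylWord l).inv.neg, mul_inv_rev, Equiv.Perm.mul_apply]
      congr 1
    rw [h7] at h6
    have h8 : b.IsPos (negRoot ((wordPerm l)⁻¹ β)) :=
      (RootPairing.Base.IsPos.neg_iff_not b _).2 hpos
    have h9 := gexp_mem_borel_of_isPos h8 h6
    have h10 : gexp y * (weylElt β * weylWord l) = gexp (-e') * t * (weylElt β * weylElt β) *
        (weylWord l * gexp (groupRep 𝔤 𝔤 (weylElt β * weylWord l)⁻¹ (-e'))) := by
      rw [h4, h5, mul_assoc, gexp_mul (weylElt β * weylWord l)]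
      simp only [mul_assoc]
    rw [h10]
    refine mul_mem_bruhatSet (mul_mem (mul_mem (gexp_mem_borel_of_isPos hposβ (neg_mem h2.mem))
      (torus_le_borel ht)) (torus_le_borel (weylElt_mul_self_mem_torus β)))
      (mem_bruhatSet_mul h9 (weylWord_mem_bruhatSet hl))

variable (b) in
/-- The Bruhat decomposition. -/
theorem mem_bruhatSet (g : SCGroup 𝔤) : g ∈ bruhatSet b := by
  have hw : ∀ β ∈ b.support, ∀ g ∈ bruhatSet b, weylElt β * g ∈ bruhatSet b := by
    rintro β hβ _ ⟨l, hl, c, hc, c', hc', rfl⟩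
    obtain ⟨c₁, hc₁, x, hx, rfl⟩ := exists_eq_mul_gexp hβ hc
    have : weylElt β * (c₁ * gexp x * weylWord l * c') =
        (weylElt β * c₁ * (weylElt β)⁻¹) * ((weylElt β * gexp x * weylWord l) * c') := by
      group
    rw [this]
    exact mul_mem_bruhatSet hc₁.2
      (mem_bruhatSet_mul hc' (weylElt_mul_gexp_mul_weylWord_mem hβ hx hl))
  have hg : g ∈ Subgroup.closure ((borel b : Set (SCGroup 𝔤)) ∪ weylElt '' (b.support : Set 𝔱.root)) := by
    rw [closure_borel_union]; trivial
  induction hg using Subgroup.closure_induction_left with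
  | one => exact ⟨[], by simp [IsSimpleWord], 1, one_mem _, 1, one_mem _, by simp [weylWord]⟩
  | mul_left c hc g _ ih =>
    rcases hc with hc | ⟨β, hβ, rfl⟩
    · exact mul_mem_bruhatSet hc ih
    · exact hw β hβ g ih
  | inv_mul_cancel c hc g _ ih =>
    rcases hc with hc | ⟨β, hβ, rfl⟩
    · exact mul_mem_bruhatSet (inv_mem hc) ih
    · have : (weylElt β)⁻¹ * g = (weylElt β * weylElt β)⁻¹ * (weylElt β * g) := by group
      rw [this]
      exact mul_mem_bruhatSet (inv_mem (torus_le_borel (weylElt_mul_self_mem_torus β)))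
        (hw β hβ g ih)

/-- Induction on the length of w = w's_β. If w'β is positive, w⁻¹ maps it to -β, so p holds for -β
and the last letter lies in Q. Otherwise two letters cancel up to the torus. -/
theorem weylWord_mem_of_mem {S Q : Subgroup (SCGroup 𝔤)} (hQS : Q ≤ S) (hB : borel b ≤ Q)
    {p : 𝔱.root → Prop}
    (hS : ∀ g ∈ S, ∀ σ : Equiv.Perm 𝔱.root, ActsBy g σ → ∀ α, p α → p (σ α))
    (hpos : ∀ α, b.IsPos α → p α) (hQ : ∀ β ∈ b.support, p (negRoot β) → weylElt β ∈ Q) :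
    ∀ n : ℕ, ∀ l : List 𝔱.root, l.length = n → IsSimpleWord b l → weylWord l ∈ S →
      weylWord l ∈ Q := by
  intro n
  induction n using Nat.strong_induction_on with
  | _ n ih =>
  intro l hn hl hlS
  rcases List.eq_nil_or_concat l with rfl | ⟨l', β, rfl⟩
  · simp [weylWord]
  rw [List.concat_eq_append] at *
  have hl' : IsSimpleWord b l' := fun δ hδ => hl δ (by simp [hδ])
  have hβ : β ∈ b.support := hl β (by simp)
  have hposβ := b.isPos_of_mem_support hβ
  by_cases h : b.IsPos (wordPerm l' β)
  · have h1 := hS _ (inv_mem hlS) _ (actsBy_weylWord _).inv _ (hpos _ h)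
    have h2 : (wordPerm (l' ++ [β]))⁻¹ (wordPerm l' β) = negRoot β := by
      rw [Equiv.Perm.inv_eq_iff_eq]
      change _ = wordPerm (l' ++ [β]) ((rootSystem 𝔱).reflectionPerm β β)
      simp [wordPerm]
    rw [h2] at h1
    have h3 := hQ β hβ h1
    have h4 : weylWord (l' ++ [β]) = weylWord l' * weylElt β := by simp [weylWord]
    rw [h4] at hlS ⊢
    refine mul_mem (ih l'.length (by simp at hn; omega) l' rfl hl' ?_) h3
    exact (Subgroup.mul_mem_cancel_right _ (hQS h3)).1 hlS
  · obtain ⟨l₁, δ, l₂, rfl, h2⟩ := exists_eq_append_of_not_isPos hposβ l' hl' h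
    obtain ⟨t, ht, h3⟩ := exists_torus_mul_weylWord l₁ l₂ h2
    rw [h3] at hlS ⊢
    have htQ := hB (torus_le_borel ht)
    refine mul_mem htQ (ih (l₁ ++ l₂).length (by simp at hn ⊢; omega) _ rfl
      (fun δ hδ => hl' δ ?_) ((Subgroup.mul_mem_cancel_left _ (hQS htQ)).1 hlS))
    simp only [List.mem_append, List.mem_cons] at hδ ⊢
    tauto

/-- A subgroup containing a Borel subgroup is determined by the simple reflections in it. -/
theorem le_of_forall_actsBy {S Q : Subgroup (SCGroup 𝔤)} (hQS : Q ≤ S) (hB : borel b ≤ Q)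
    {p : 𝔱.root → Prop}
    (hS : ∀ g ∈ S, ∀ σ : Equiv.Perm 𝔱.root, ActsBy g σ → ∀ α, p α → p (σ α))
    (hpos : ∀ α, b.IsPos α → p α) (hQ : ∀ β ∈ b.support, p (negRoot β) → weylElt β ∈ Q) :
    S ≤ Q := by
  intro g hg
  obtain ⟨l, hl, c, hc, c', hc', rfl⟩ := mem_bruhatSet b g
  have h1 : weylWord l ∈ S :=
    (Subgroup.mul_mem_cancel_left _ (hQS (hB hc))).1
      ((Subgroup.mul_mem_cancel_right _ (hQS (hB hc'))).1 hg)
  exact mul_mem (mul_mem (hB hc) (weylWord_mem_of_mem hQS hB hS hpos hQ _ l rfl hl h1)) (hB hc')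

end Bruhat

end Cominuscule


namespace Cominuscule

/-! ### Weight decomposition of a module -/

section WeightSpaces

variable {𝔤 : Type*} [LieRing 𝔤] [LieAlgebra ℂ 𝔤] {𝔱 : LieSubalgebra ℂ 𝔤} [LieRing.IsNilpotent 𝔱]
  {E : Type*} [AddCommGroup E] [Module ℂ E] [LieRingModule 𝔤 E] [LieModule ℂ 𝔤 E]

variable (E) in
/-- The weight space of `χ`, as a subspace of `E`. -/
noncomputable abbrev wtSpace (χ : Module.Dual ℂ 𝔱) : Submodule ℂ E :=
  (LieModule.weightSpace E (χ : 𝔱 → ℂ)).toSubmodule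

omit [LieRing.IsNilpotent 𝔱] in
theorem mem_wtSpace {χ : Module.Dual ℂ 𝔱} {v : E} :
    v ∈ wtSpace E χ ↔ ∀ t : 𝔱, ⁅(t : 𝔤), v⁆ = χ t • v :=
  LieModule.mem_weightSpace ..

theorem iSupIndep_wtSpace : iSupIndep (wtSpace E : Module.Dual ℂ 𝔱 → Submodule ℂ E) := by
  have h := (LieModule.iSupIndep_genWeightSpace ℂ 𝔱 E)
  rw [← LieSubmodule.iSupIndep_toSubmodule] at h
  exact (h.comp (f := fun χ : Module.Dual ℂ 𝔱 => (χ : 𝔱 → ℂ)) DFunLike.coe_injective).mono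
    fun χ => LieModule.weightSpace_le_genWeightSpace E _

/-- Independence of the weight spaces forces (χ t - c) f χ = 0 in every component. -/
theorem apply_eq_of_lie_sum_eq {f : Module.Dual ℂ 𝔱 →₀ E} (hf : ∀ χ, f χ ∈ wtSpace E χ)
    {t : 𝔱} {c : ℂ} (h : ⁅(t : 𝔤), f.sum fun _ x => x⁆ = c • f.sum fun _ x => x)
    {χ : Module.Dual ℂ 𝔱} (hχ : f χ ≠ 0) : χ t = c := by
  have h1 : ∑ χ ∈ f.support, (χ t - c) • f χ = 0 := by
    simp only [Finsupp.sum, lie_sum, Finset.smul_sum] at h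
    rw [← sub_eq_zero, ← Finset.sum_sub_distrib] at h
    rw [← h]
    exact Finset.sum_congr rfl fun χ _ => by rw [mem_wtSpace.1 (hf χ), sub_smul]
  have h2 := (iSupIndep_iff_finsetSum_eq_zero_imp_eq_zero _).1 (iSupIndep_wtSpace (E := E) (𝔱 := 𝔱))
    f.support (fun χ => (χ t - c) • f χ) (fun χ _ => Submodule.smul_mem _ _ (hf χ)) h1 χ
    (Finsupp.mem_support_iff.2 hχ)
  exact sub_eq_zero.1 ((smul_eq_zero.1 h2).resolve_right hχ)

/-- A vector is a sum of weight vectors for weights with the same eigenvalues. -/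
theorem mem_iSup_wtSpace {X : Set (Module.Dual ℂ 𝔱)} (htop : ⨆ χ ∈ X, wtSpace E χ = ⊤) (v : E) :
    v ∈ ⨆ (χ : Module.Dual ℂ 𝔱) (_ : χ ∈ X ∧ ∀ (t : 𝔱) (c : ℂ), ⁅(t : 𝔤), v⁆ = c • v → χ t = c),
      wtSpace E χ := by
  have hv : v ∈ ⨆ χ ∈ X, wtSpace E χ := by rw [htop]; trivial
  obtain ⟨f, hf, rfl⟩ := (Submodule.mem_iSup_iff_exists_finsupp _ _).1 hv
  have hf' : ∀ χ, f χ ∈ wtSpace E χ := fun χ =>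
    (iSup_le fun _ => le_rfl : (⨆ _ : χ ∈ X, wtSpace E χ) ≤ wtSpace E χ) (hf χ)
  refine Submodule.sum_mem _ fun χ hχ => ?_
  rw [Finsupp.mem_support_iff] at hχ
  refine Submodule.mem_iSup_of_mem χ (Submodule.mem_iSup_of_mem ⟨?_, fun t c h => ?_⟩ (hf' χ))
  · by_contra hX
    have := hf χ
    rw [iSup_neg hX] at this
    exact hχ (by simpa using this)
  · exact apply_eq_of_lie_sum_eq hf' h hχ

theorem exists_weight_of_ne_zero {X : Set (Module.Dual ℂ 𝔱)} (htop : ⨆ χ ∈ X, wtSpace E χ = ⊤)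
    {v : E} (hv : v ≠ 0) :
    ∃ χ ∈ X, ∀ (t : 𝔱) (c : ℂ), ⁅(t : 𝔤), v⁆ = c • v → χ t = c := by
  by_contra! hne
  have h := mem_iSup_wtSpace htop v
  refine hv ?_
  rw [← Submodule.mem_bot ℂ]
  refine (iSup₂_le fun χ hχ => ?_ : _ ≤ (⊥ : Submodule ℂ E)) h
  obtain ⟨t, c, h1, h2⟩ := hne χ hχ.1
  exact absurd (hχ.2 t c h1) h2

end WeightSpaces

/-! ### The cominuscule module generated by lowering steps -/

section Module

variable {𝔤 : Type*} [LieRing 𝔤] [LieAlgebra ℂ 𝔤] [FiniteDimensional ℂ 𝔤] [IsSimple ℂ 𝔤]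
  {𝔱 : LieSubalgebra ℂ 𝔤} [𝔱.IsCartanSubalgebra]
  {E : Type*} [AddCommGroup E] [Module ℂ E] [LieRingModule 𝔤 E] [LieModule ℂ 𝔤 E]

theorem lie_lie_of_mem_rootLine {α : 𝔱.root} {x : 𝔤} (hx : x ∈ rootLine α) {t : 𝔱} {c : ℂ} {v : E}
    (hv : ⁅(t : 𝔤), v⁆ = c • v) :
    ⁅(t : 𝔤), ⁅x, v⁆⁆ = ((rootSystem 𝔱).root α t + c) • ⁅x, v⁆ := by
  rw [leibniz_lie, lie_of_mem_rootLine hx, hv, smul_lie, lie_smul, add_smul]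

omit [IsSimple ℂ 𝔤] in
/-- A subspace that is stable under `𝔱` and all root vectors is a submodule. -/
theorem eq_top_of_stable (hE : LieModule.IsIrreducible ℂ 𝔤 E) {U : Submodule ℂ E}
    (h𝔱 : ∀ t ∈ 𝔱, ∀ u ∈ U, ⁅t, u⁆ ∈ U)
    (hroot : ∀ α : 𝔱.root, ∀ x ∈ rootLine α, ∀ u ∈ U, ⁅x, u⁆ ∈ U) {v : E} (hv : v ∈ U)
    (hv0 : v ≠ 0) : U = ⊤ := by
  have h : ∀ x : 𝔤, ∀ u ∈ U, ⁅x, u⁆ ∈ U := by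
    intro x u hu
    have hle : 𝔱.toSubmodule ⊔ rootSum 𝔱 (fun _ => True) ≤
        U.comap ((LieModule.toEnd ℂ 𝔤 E : 𝔤 →ₗ[ℂ] Module.End ℂ E).flip u) :=
      sup_le (fun t ht => h𝔱 t ht u hu) (rootSum_le.2 fun α _ x hx => hroot α x hx u hu)
    rw [← top_eq_sup_rootSum] at hle
    exact hle (Submodule.mem_top (x := x))
  let N : LieSubmodule ℂ 𝔤 E := { U with lie_mem := fun {x u} hu => h x u hu }
  have : N = ⊤ := by
    rcases IsSimpleOrder.eq_bot_or_eq_top N with h | h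
    · exfalso
      have hvN : v ∈ N := hv
      rw [h] at hvN
      exact hv0 (by simpa using hvN)
    · exact h
  exact congrArg LieSubmodule.toSubmodule this

/-- A highest weight vector of weight `0` for an `𝔰𝔩₂`-triple is killed by it. -/
theorem IsTriple.lie_f_eq_zero [FiniteDimensional ℂ E] {α : 𝔱.root} {e f : 𝔤}
    (h : IsTriple α e f) {v : E} (he : ⁅e, v⁆ = 0)
    (hh : ⁅(((rootSystem 𝔱).coroot α : 𝔱) : 𝔤), v⁆ = 0) : ⁅f, v⁆ = 0 := by
  rcases eq_or_ne v 0 with rfl | hv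
  · simp
  have t : IsSl2Triple (((rootSystem 𝔱).coroot α : 𝔱) : 𝔤) e f :=
    { h_ne_zero := fun h0 => coroot_ne_zero α (by exact_mod_cast h0)
      lie_e_f := h.lie
      lie_h_e_nsmul := by rw [h.lie_h, two_smul, two_nsmul]
      lie_h_f_nsmul := by rw [h.lie_h', neg_smul, two_smul, two_nsmul] }
  have P : t.HasPrimitiveVectorWith v (0 : ℂ) := ⟨hv, by rw [hh, zero_smul], he⟩
  simpa using P.pow_toEnd_f_eq_zero_of_eq_nat (n := 0) (by simp)

variable (E) in
/-- The data of the statement: `z` takes the values `f`, and the sum `h` of the coroots of the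
dominant orthogonal sequence takes the values `g`; `v` is a highest weight vector. -/
structure CominusculeData (b : (rootSystem 𝔱).Base) (z h : 𝔱) (ϖ : Module.Dual ℂ 𝔱) {r : ℕ}
    (α : Fin r → 𝔱.root) (f g : 𝔱.root → ℤ) (v : E) : Prop where
  root_z : ∀ γ, (rootSystem 𝔱).root γ z = f γ
  root_h : ∀ γ, (rootSystem 𝔱).root γ h = g γ
  cases : ∀ γ, f γ = -2 ∨ f γ = 0 ∨ f γ = 2
  nonneg : ∀ γ, b.IsPos γ → 0 ≤ f γ
  le_two : ∀ γ, f γ = 2 → g γ ≤ 2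
  weight_coroot : ∀ γ, ϖ ((rootSystem 𝔱).coroot γ) = 0 ↔ f γ = 0
  weight_h : ϖ h = r
  h_eq : h = ∑ i, (rootSystem 𝔱).coroot (α i)
  f_seq : ∀ i, f (α i) = 2
  g_seq : ∀ i, g (α i) = 2
  weight_seq : ∀ i, ϖ ((rootSystem 𝔱).coroot (α i)) = 1
  irreducible : LieModule.IsIrreducible ℂ 𝔤 E
  ne_zero : v ≠ 0
  lie_weight : ∀ t : 𝔱, ⁅(t : 𝔤), v⁆ = ϖ t • v
  lie_pos : ∀ γ, b.IsPos γ → ∀ x ∈ rootLine γ, ⁅x, v⁆ = 0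

/-- The sum of the weight spaces reached from `v` by `k` lowering steps. -/
def lowerSpace (𝔱 : LieSubalgebra ℂ 𝔤) [𝔱.IsCartanSubalgebra] (f : 𝔱.root → ℤ) (v : E) :
    ℕ → Submodule ℂ E
  | 0 => Submodule.span ℂ {v}
  | k + 1 => Submodule.span ℂ
      {u | ∃ δ : 𝔱.root, f δ = -2 ∧ ∃ x ∈ rootLine δ, ∃ w ∈ lowerSpace 𝔱 f v k, ⁅x, w⁆ = u}

/-- The weights that can occur. -/
def lowerWeights (z h : 𝔱) (ϖ : Module.Dual ℂ 𝔱) : Set (Module.Dual ℂ 𝔱) :=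
  {χ | ∃ k n : ℕ, χ z = ϖ z - 2 * k ∧ χ (h - z) = ϖ (h - z) + n}

namespace CominusculeData

variable {b : (rootSystem 𝔱).Base} {z h : 𝔱} {ϖ : Module.Dual ℂ 𝔱} {r : ℕ}
  {α : Fin r → 𝔱.root} {f g : 𝔱.root → ℤ} {v : E} (H : CominusculeData E b z h ϖ α f g v)

include H

omit [LieModule ℂ 𝔤 E] in
theorem f_add {i j k : 𝔱.root}
    (hk : (rootSystem 𝔱).root k = (rootSystem 𝔱).root i + (rootSystem 𝔱).root j) :
    f k = f i + f j := by
  have : (f k : ℂ) = f i + f j := by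
    rw [← H.root_z, ← H.root_z, ← H.root_z, hk, LinearMap.add_apply]
  exact_mod_cast this

omit [LieModule ℂ 𝔤 E] in
theorem f_neg (i : 𝔱.root) : f (negRoot i) = -f i := by
  have : (f (negRoot i) : ℂ) = -f i := by
    rw [← H.root_z, ← H.root_z, root_negRoot_apply]
  exact_mod_cast this

omit [LieModule ℂ 𝔤 E] in
theorem g_neg (i : 𝔱.root) : g (negRoot i) = -g i := by
  have : (g (negRoot i) : ℂ) = -g i := by
    rw [← H.root_h, ← H.root_h, root_negRoot_apply]
  exact_mod_cast this

omit [LieModule ℂ 𝔤 E] in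
theorem isPos_of_f_eq_two {γ : 𝔱.root} (hγ : f γ = 2) : b.IsPos γ := by
  by_contra hneg
  have h1 : b.IsPos (negRoot γ) := (RootPairing.Base.IsPos.neg_iff_not b γ).2 hneg
  have := H.nonneg _ h1
  rw [H.f_neg] at this
  omega

/-- For negative γ, the opposite root space kills v and ϖ(γ^∨) = 0, so v generates the trivial
module of the 𝔰𝔩₂ of γ. -/
theorem lie_eq_zero_of_f_eq_zero [FiniteDimensional ℂ E] {γ : 𝔱.root} (hγ : f γ = 0) {x : 𝔤}
    (hx : x ∈ rootLine γ) : ⁅x, v⁆ = 0 := by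
  by_cases hpos : b.IsPos γ
  · exact H.lie_pos γ hpos x hx
  have h1 : b.IsPos (negRoot γ) := (RootPairing.Base.IsPos.neg_iff_not b γ).2 hpos
  obtain ⟨e, e', he⟩ := exists_isTriple γ
  have h2 := he.swap.lie_f_eq_zero (H.lie_pos _ h1 e' he.mem_neg) (by
    rw [H.lie_weight, (H.weight_coroot _).2 (by rw [H.f_neg, hγ, neg_zero]), zero_smul])
  obtain ⟨c, rfl⟩ := exists_eq_smul_of_mem_rootLine he.mem he.ne_zero hx
  rw [smul_lie, h2, smul_zero]

/-- The line of v is stable under 𝔨, and brackets with 𝔨 keep a root vector of value -2 inside 𝔲₋;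
the Leibniz rule does the rest. This handles the brackets ⁅𝔲₊, 𝔲₋⁆ ⊆ 𝔨 met when raising. -/
theorem levi_lie_mem [FiniteDimensional ℂ E] (k : ℕ) :
    (∀ t ∈ 𝔱, ∀ w ∈ lowerSpace 𝔱 f v k, ⁅t, w⁆ ∈ lowerSpace 𝔱 f v k) ∧
    ∀ γ, f γ = 0 → ∀ x ∈ rootLine γ, ∀ w ∈ lowerSpace 𝔱 f v k, ⁅x, w⁆ ∈ lowerSpace 𝔱 f v k := by
  induction k with
  | zero =>
    constructor
    · intro t ht w hw
      obtain ⟨c, rfl⟩ := Submodule.mem_span_singleton.1 hw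
      rw [lie_smul, H.lie_weight ⟨t, ht⟩]
      exact Submodule.smul_mem _ _ (Submodule.smul_mem _ _ (Submodule.mem_span_singleton_self v))
    · intro γ hγ x hx w hw
      obtain ⟨c, rfl⟩ := Submodule.mem_span_singleton.1 hw
      rw [lie_smul, H.lie_eq_zero_of_f_eq_zero hγ hx, smul_zero]
      exact zero_mem _
  | succ k ih =>
    constructor
    · intro t ht w hw
      refine Submodule.span_induction (p := fun w _ => ⁅t, w⁆ ∈ lowerSpace 𝔱 f v (k + 1))
        ?_ ?_ ?_ ?_ hw
      · rintro _ ⟨δ, hδ, y, hy, w, hw, rfl⟩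
        rw [leibniz_lie, lie_of_mem_rootLine hy ⟨t, ht⟩, smul_lie]
        exact add_mem (Submodule.smul_mem _ _ (Submodule.subset_span ⟨δ, hδ, y, hy, w, hw, rfl⟩))
          (Submodule.subset_span ⟨δ, hδ, y, hy, _, ih.1 t ht w hw, rfl⟩)
      · rw [lie_zero]; exact zero_mem _
      · intro a c _ _ h1 h2; rw [lie_add]; exact add_mem h1 h2
      · intro a c _ h1; rw [lie_smul]; exact Submodule.smul_mem _ _ h1
    · intro γ hγ x hx w hw
      refine Submodule.span_induction (p := fun w _ => ⁅x, w⁆ ∈ lowerSpace 𝔱 f v (k + 1))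
        ?_ ?_ ?_ ?_ hw
      · rintro _ ⟨δ, hδ, y, hy, w, hw, rfl⟩
        rw [leibniz_lie]
        refine add_mem ?_ (Submodule.subset_span ⟨δ, hδ, y, hy, _, ih.2 γ hγ x hx w hw, rfl⟩)
        rcases lie_mem_rootLine_cases hx hy with h1 | ⟨h1, -⟩ | ⟨ε, hε, h1⟩
        · rw [h1, zero_lie]; exact zero_mem _
        · exfalso
          rw [← root_negRoot] at h1
          rw [(rootSystem 𝔱).root.injective h1, H.f_neg] at hγ
          omega
        · exact Submodule.subset_span ⟨ε, by rw [H.f_add hε, hγ, hδ, zero_add], _, h1, w, hw, rfl⟩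
      · rw [lie_zero]; exact zero_mem _
      · intro a c _ _ h1 h2; rw [lie_add]; exact add_mem h1 h2
      · intro a c _ h1; rw [lie_smul]; exact Submodule.smul_mem _ _ h1

theorem raise_lie_mem [FiniteDimensional ℂ E] (k : ℕ) {γ : 𝔱.root} (hγ : f γ = 2) {x : 𝔤}
    (hx : x ∈ rootLine γ) :
    (∀ w ∈ lowerSpace 𝔱 f v 0, ⁅x, w⁆ = 0) ∧
      ∀ w ∈ lowerSpace 𝔱 f v (k + 1), ⁅x, w⁆ ∈ lowerSpace 𝔱 f v k := by
  have h0 : ∀ w ∈ lowerSpace 𝔱 f v 0, ⁅x, w⁆ = 0 := by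
    intro w hw
    obtain ⟨c, rfl⟩ := Submodule.mem_span_singleton.1 hw
    rw [lie_smul, H.lie_pos γ (H.isPos_of_f_eq_two hγ) x hx, smul_zero]
  refine ⟨h0, ?_⟩
  have hgen : ∀ k, (∀ δ : 𝔱.root, f δ = -2 → ∀ y ∈ rootLine δ, ∀ w ∈ lowerSpace 𝔱 f v k,
      ⁅y, ⁅x, w⁆⁆ ∈ lowerSpace 𝔱 f v k) →
      ∀ w ∈ lowerSpace 𝔱 f v (k + 1), ⁅x, w⁆ ∈ lowerSpace 𝔱 f v k := by
    intro k hk w hw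
    refine Submodule.span_induction (p := fun w _ => ⁅x, w⁆ ∈ lowerSpace 𝔱 f v k) ?_ ?_ ?_ ?_ hw
    · rintro _ ⟨δ, hδ, y, hy, w, hw, rfl⟩
      rw [leibniz_lie]
      refine add_mem ?_ (hk δ hδ y hy w hw)
      rcases lie_mem_rootLine_cases hx hy with h1 | ⟨-, h1⟩ | ⟨ε, hε, h1⟩
      · rw [h1, zero_lie]; exact zero_mem _
      · exact (H.levi_lie_mem k).1 _ h1 w hw
      · exact (H.levi_lie_mem k).2 ε (by rw [H.f_add hε, hγ, hδ]; rfl) _ h1 w hw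
    · rw [lie_zero]; exact zero_mem _
    · intro a c _ _ h1 h2; rw [lie_add]; exact add_mem h1 h2
    · intro a c _ h1; rw [lie_smul]; exact Submodule.smul_mem _ _ h1
  induction k with
  | zero =>
    refine hgen 0 fun δ hδ y hy w hw => ?_
    rw [h0 w hw, lie_zero]
    exact zero_mem _
  | succ k ih =>
    exact hgen (k + 1) fun δ hδ y hy w hw =>
      Submodule.subset_span ⟨δ, hδ, y, hy, _, ih w hw, rfl⟩

/-- Root vectors of values -2, 0 and 2 respectively move down, preserve, and move up the steps, so
the sum is a nonzero submodule of an irreducible module. -/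
theorem iSup_lowerSpace [FiniteDimensional ℂ E] : ⨆ k, lowerSpace 𝔱 f v k = ⊤ := by
  refine eq_top_of_stable (𝔱 := 𝔱) H.irreducible ?_ ?_ (v := v)
    (Submodule.mem_iSup_of_mem 0 (Submodule.mem_span_singleton_self v)) H.ne_zero
  · intro t ht u hu
    induction hu using Submodule.iSup_induction' with
    | mem k u hu => exact Submodule.mem_iSup_of_mem k ((H.levi_lie_mem k).1 t ht u hu)
    | zero => rw [lie_zero]; exact zero_mem _
    | add a c _ _ h1 h2 => rw [lie_add]; exact add_mem h1 h2
  · intro γ x hx u hu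
    induction hu using Submodule.iSup_induction' with
    | mem k u hu =>
      rcases H.cases γ with h | h | h
      · exact Submodule.mem_iSup_of_mem (k + 1) (Submodule.subset_span ⟨γ, h, x, hx, u, hu, rfl⟩)
      · exact Submodule.mem_iSup_of_mem k ((H.levi_lie_mem k).2 γ h x hx u hu)
      · cases k with
        | zero => rw [(H.raise_lie_mem 0 h hx).1 u hu]; exact zero_mem _
        | succ k => exact Submodule.mem_iSup_of_mem k ((H.raise_lie_mem k h hx).2 u hu)
    | zero => rw [lie_zero]; exact zero_mem _
    | add a c _ _ h1 h2 => rw [lie_add]; exact add_mem h1 h2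

/-- A step by δ lowers z by 2 and adds g δ + 2 to h - z, which is nonnegative because g(-δ) ≤ 2. -/
theorem lowerSpace_le (k : ℕ) : lowerSpace 𝔱 f v k ≤
    ⨆ (χ : Module.Dual ℂ 𝔱) (_ : χ z = ϖ z - 2 * k ∧ ∃ n : ℕ, χ (h - z) = ϖ (h - z) + n),
      wtSpace E χ := by
  induction k with
  | zero =>
    refine (Submodule.span_singleton_le_iff_mem _ _).2 ?_
    exact Submodule.mem_iSup_of_mem ϖ (Submodule.mem_iSup_of_mem ⟨by simp, 0, by simp⟩
      (mem_wtSpace.2 H.lie_weight))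
  | succ k ih =>
    refine Submodule.span_le.2 ?_
    rintro _ ⟨δ, hδ, x, hx, w, hw, rfl⟩
    refine Submodule.iSup_induction (motive := fun w => ⁅x, w⁆ ∈
      ⨆ (χ : Module.Dual ℂ 𝔱) (_ : χ z = ϖ z - 2 * (k + 1 : ℕ) ∧
        ∃ n : ℕ, χ (h - z) = ϖ (h - z) + n), wtSpace E χ) _ (ih hw) ?_ ?_ ?_
    · intro χ u hu
      by_cases hχ : χ z = ϖ z - 2 * k ∧ ∃ n : ℕ, χ (h - z) = ϖ (h - z) + n
      · rw [iSup_pos hχ] at hu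
        obtain ⟨h1, n, h2⟩ := hχ
        have hδ2 : g (negRoot δ) ≤ 2 := H.le_two _ (by rw [H.f_neg, hδ]; rfl)
        rw [H.g_neg] at hδ2
        obtain ⟨m, hm⟩ := Int.eq_ofNat_of_zero_le (by omega : 0 ≤ g δ + 2)
        have hm' : (g δ : ℂ) + 2 = m := by exact_mod_cast hm
        refine Submodule.mem_iSup_of_mem ((rootSystem 𝔱).root δ + χ)
          (Submodule.mem_iSup_of_mem ⟨?_, n + m, ?_⟩ (mem_wtSpace.2 fun t =>
            lie_lie_of_mem_rootLine hx (mem_wtSpace.1 hu t)))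
        · rw [LinearMap.add_apply, H.root_z, hδ, h1]; push_cast; ring
        · rw [LinearMap.add_apply, h2, map_sub, H.root_z, H.root_h, hδ]
          push_cast
          linear_combination hm'
      · rw [iSup_neg hχ] at hu
        rw [(Submodule.mem_bot ℂ).1 hu, lie_zero]
        exact zero_mem _
    · rw [lie_zero]; exact zero_mem _
    · intro a c h1 h2; rw [lie_add]; exact add_mem h1 h2

theorem iSup_wtSpace [FiniteDimensional ℂ E] : ⨆ χ ∈ lowerWeights z h ϖ, wtSpace E χ = ⊤ := by
  rw [eq_top_iff, ← H.iSup_lowerSpace]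
  refine iSup_le fun k => (H.lowerSpace_le k).trans (iSup₂_le fun χ hχ => ?_)
  obtain ⟨h1, n, h2⟩ := hχ
  exact le_iSup₂_of_le χ ⟨k, n, h1, h2⟩ le_rfl

end CominusculeData

end Module

end Cominuscule


namespace Cominuscule

/-! ### The subspace V, its grading and its stabilizer -/

section Graded

variable {𝔤 : Type*} [LieRing 𝔤] [LieAlgebra ℂ 𝔤] [FiniteDimensional ℂ 𝔤] [IsSimple ℂ 𝔤]
  {𝔱 : LieSubalgebra ℂ 𝔤} [𝔱.IsCartanSubalgebra]
  {E : Type*} [AddCommGroup E] [Module ℂ E] [LieRingModule 𝔤 E] [LieModule ℂ 𝔤 E]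
  [FiniteDimensional ℂ E]

namespace CominusculeData

variable {b : (rootSystem 𝔱).Base} {z h : 𝔱} {ϖ : Module.Dual ℂ 𝔱} {r : ℕ}
  {α : Fin r → 𝔱.root} {f g : 𝔱.root → ℤ} {v : E} (H : CominusculeData E b z h ϖ α f g v)

include H

/-- Nothing in E lies below ϖ(h - z): all eigenvalues of h - z are this number plus a natural
number. -/
theorem eq_zero_of_lie_eq {n : ℕ} (hn : 0 < n) {u : E}
    (hu : ⁅((h - z : 𝔱) : 𝔤), u⁆ = (ϖ (h - z) - n) • u) : u = 0 := by
  by_contra h0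
  obtain ⟨χ, ⟨k, m, -, h1⟩, h2⟩ := exists_weight_of_ne_zero H.iSup_wtSpace h0
  rw [h2 _ _ hu] at h1
  have h3 : (m : ℂ) + n = 0 := by linear_combination -h1
  have h4 : m + n = 0 := by exact_mod_cast h3
  omega

theorem mem_gradedPiece {i : ℤ} {u : E} : u ∈ gradedPiece E ϖ z h r i ↔
    ⁅(z : 𝔤), u⁆ = (ϖ z - 2 * i) • u ∧ ⁅(h : 𝔤), u⁆ = ((r : ℂ) - 2 * i) • u := by
  constructor
  · intro hu
    have h1 : gradedPiece E ϖ z h r i ≤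
        (LieModule.toEnd ℂ 𝔤 E z).eigenspace (ϖ z - 2 * i) ⊓
          (LieModule.toEnd ℂ 𝔤 E h).eigenspace ((r : ℂ) - 2 * i) := by
      refine iSup₂_le fun χ hχ w hw => ?_
      rw [Submodule.mem_inf, Module.End.mem_eigenspace_iff, Module.End.mem_eigenspace_iff,
        ← hχ.1, ← hχ.2]
      exact ⟨mem_wtSpace.1 hw z, mem_wtSpace.1 hw h⟩
    have h2 := h1 hu
    rwa [Submodule.mem_inf, Module.End.mem_eigenspace_iff, Module.End.mem_eigenspace_iff] at h2
  · rintro ⟨h1, h2⟩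
    refine (iSup₂_le fun χ hχ => ?_ :
      _ ≤ gradedPiece E ϖ z h r i) (mem_iSup_wtSpace H.iSup_wtSpace u)
    exact le_iSup₂_of_le χ ⟨hχ.2 z _ h1, hχ.2 h _ h2⟩ le_rfl

/-- Every weight has z-value ϖ(z) - 2k for some natural number k, and a weight with the extremal
value on h - z then has h-value r - 2k. So the whole eigenspace is exhausted by the graded pieces.
-/
theorem mem_gradedSubspace {u : E} : u ∈ gradedSubspace E ϖ z h r ↔
    ⁅((h - z : 𝔱) : 𝔤), u⁆ = ϖ (h - z) • u := by
  constructor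
  · intro hu
    have h1 : gradedSubspace E ϖ z h r ≤
        (LieModule.toEnd ℂ 𝔤 E (h - z : 𝔱)).eigenspace (ϖ (h - z)) := by
      refine iSup_le fun i w hw => ?_
      obtain ⟨h2, h3⟩ := H.mem_gradedPiece.1 hw
      rw [Module.End.mem_eigenspace_iff]
      change ⁅(h : 𝔤) - (z : 𝔤), w⁆ = _
      rw [sub_lie, h2, h3, ← sub_smul, map_sub, H.weight_h]
      congr 1
      ring
    simpa [Module.End.mem_eigenspace_iff] using h1 hu
  · intro hu
    refine (iSup₂_le fun χ hχ => ?_ :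
      _ ≤ gradedSubspace E ϖ z h r) (mem_iSup_wtSpace H.iSup_wtSpace u)
    obtain ⟨⟨k, n, h1, -⟩, h2⟩ := hχ
    have h3 := h2 _ _ hu
    refine le_iSup_of_le (k : ℤ) (le_iSup₂_of_le χ ⟨by rw [h1]; simp, ?_⟩ le_rfl)
    rw [map_sub, map_sub, h1, H.weight_h] at h3
    push_cast
    linear_combination h3

omit [FiniteDimensional ℂ 𝔤] [IsSimple ℂ 𝔤] [𝔱.IsCartanSubalgebra] [FiniteDimensional ℂ E] H in
theorem gradedPiece_le (i : ℤ) : gradedPiece E ϖ z h r i ≤ gradedSubspace E ϖ z h r :=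
  le_iSup (fun i => gradedPiece E ϖ z h r i) i

omit [LieModule ℂ 𝔤 E] [FiniteDimensional ℂ E] in
theorem root_sub (γ : 𝔱.root) : (rootSystem 𝔱).root γ (h - z) = g γ - f γ := by
  rw [map_sub, H.root_h, H.root_z]

/-- The image would have an eigenvalue of h - z below the smallest one. -/
theorem lie_eq_zero_of_lt {γ : 𝔱.root} (hγ : g γ < f γ) {x : 𝔤} (hx : x ∈ rootLine γ) {u : E}
    (hu : u ∈ gradedSubspace E ϖ z h r) : ⁅x, u⁆ = 0 := by
  obtain ⟨n, hn⟩ := Int.eq_ofNat_of_zero_le (by omega : 0 ≤ f γ - g γ)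
  have hn' : (f γ : ℂ) - g γ = n := by exact_mod_cast hn
  refine H.eq_zero_of_lie_eq (n := n) (by omega) ?_
  rw [lie_lie_of_mem_rootLine hx (H.mem_gradedSubspace.1 hu), H.root_sub, ← hn']
  congr 1
  ring

theorem lie_mem_of_eq {γ : 𝔱.root} (hγ : g γ = f γ) {x : 𝔤} (hx : x ∈ rootLine γ) {u : E}
    (hu : u ∈ gradedSubspace E ϖ z h r) : ⁅x, u⁆ ∈ gradedSubspace E ϖ z h r := by
  rw [H.mem_gradedSubspace, lie_lie_of_mem_rootLine hx (H.mem_gradedSubspace.1 hu), H.root_sub,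
    hγ, sub_self, zero_add]

theorem lie_mem_of_le {γ : 𝔱.root} (hγ : g γ ≤ f γ) {x : 𝔤} (hx : x ∈ rootLine γ) {u : E}
    (hu : u ∈ gradedSubspace E ϖ z h r) : ⁅x, u⁆ ∈ gradedSubspace E ϖ z h r := by
  rcases hγ.lt_or_eq with h1 | h1
  · rw [H.lie_eq_zero_of_lt h1 hx hu]; exact zero_mem _
  · exact H.lie_mem_of_eq h1 hx hu

theorem cartan_lie_mem {t : 𝔤} (ht : t ∈ 𝔱) {u : E} (hu : u ∈ gradedSubspace E ϖ z h r) :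
    ⁅t, u⁆ ∈ gradedSubspace E ϖ z h r := by
  have hc : ⁅((h - z : 𝔱) : 𝔤), t⁆ = 0 := by
    have h1 : ⁅h - z, (⟨t, ht⟩ : 𝔱)⁆ = 0 := trivial_lie_zero 𝔱 𝔱 _ _
    exact congrArg Subtype.val h1
  rw [H.mem_gradedSubspace, leibniz_lie, hc, zero_lie, zero_add, H.mem_gradedSubspace.1 hu,
    lie_smul]

omit [LieModule ℂ 𝔤 E] [FiniteDimensional ℂ E] in
theorem qSub_eq_sup : qSub z h = 𝔱.toSubmodule ⊔ rootSum 𝔱 fun γ => g γ ≤ f γ := by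
  rw [qSub]
  congr 2
  ext γ
  rw [H.root_h, H.root_z, Complex.intCast_re, Complex.intCast_re, Int.cast_le]

theorem qSub_lie_mem {x : 𝔤} (hx : x ∈ qSub z h) {u : E} (hu : u ∈ gradedSubspace E ϖ z h r) :
    ⁅x, u⁆ ∈ gradedSubspace E ϖ z h r := by
  have hle : 𝔱.toSubmodule ⊔ rootSum 𝔱 (fun γ => g γ ≤ f γ) ≤
      (gradedSubspace E ϖ z h r).comap
        ((LieModule.toEnd ℂ 𝔤 E : 𝔤 →ₗ[ℂ] Module.End ℂ E).flip u) :=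
    sup_le (fun t ht => H.cartan_lie_mem ht hu)
      (rootSum_le.2 fun γ hγ x hx => H.lie_mem_of_le hγ hx hu)
  rw [H.qSub_eq_sup] at hx
  exact hle hx

theorem mem_gradedPiece_iff {i : ℤ} {u : E} : u ∈ gradedPiece E ϖ z h r i ↔
    u ∈ gradedSubspace E ϖ z h r ∧ ⁅(z : 𝔤), u⁆ = (ϖ z - 2 * i) • u := by
  constructor
  · exact fun hu => ⟨gradedPiece_le i hu, (H.mem_gradedPiece.1 hu).1⟩
  · rintro ⟨h1, h2⟩
    refine H.mem_gradedPiece.2 ⟨h2, ?_⟩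
    have h3 := H.mem_gradedSubspace.1 h1
    change ⁅(h : 𝔤) - (z : 𝔤), u⁆ = _ at h3
    rw [sub_lie, sub_eq_iff_eq_add, h2, ← add_smul] at h3
    rw [h3, map_sub, H.weight_h]
    congr 1
    ring

omit [FiniteDimensional ℂ E] H in
theorem kAlg_lie_mem {x : 𝔤} (hx : x ∈ kAlg z) {c : ℂ} {u : E}
    (hu : u ∈ (LieModule.toEnd ℂ 𝔤 E z).eigenspace c) :
    ⁅x, u⁆ ∈ (LieModule.toEnd ℂ 𝔤 E z).eigenspace c := by
  rw [Module.End.mem_eigenspace_iff] at hu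
  change ⁅(z : 𝔤), u⁆ = c • u at hu
  have hle : kAlg z ≤ ((LieModule.toEnd ℂ 𝔤 E z).eigenspace c).comap
        ((LieModule.toEnd ℂ 𝔤 E : 𝔤 →ₗ[ℂ] Module.End ℂ E).flip u) := by
    refine sup_le (fun t ht => ?_) (rootSum_le.2 fun γ hγ x hx => ?_)
    · rw [Submodule.mem_comap, Module.End.mem_eigenspace_iff]
      change ⁅(z : 𝔤), ⁅t, u⁆⁆ = c • ⁅t, u⁆
      have hc : ⁅(z : 𝔤), t⁆ = 0 := by
        have h1 : ⁅z, (⟨t, ht⟩ : 𝔱)⁆ = 0 := trivial_lie_zero 𝔱 𝔱 _ _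
        exact congrArg Subtype.val h1
      rw [leibniz_lie, hc, zero_lie, zero_add, hu, lie_smul]
    · rw [Submodule.mem_comap, Module.End.mem_eigenspace_iff]
      change ⁅(z : 𝔤), ⁅x, u⁆⁆ = c • ⁅x, u⁆
      rw [lie_lie_of_mem_rootLine hx hu, hγ, zero_add]
  exact hle hx

/-- V_i is the intersection of V, stable under Q, with an eigenspace of z, stable under K because 𝔨
centralizes z. -/
theorem inf_apply_mem {g : SCGroup 𝔤}
    (hg : g ∈ connectedSubgroup (kAlg z) ⊓ connectedSubgroup (qSub z h)) {i : ℤ} {u : E}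
    (hu : u ∈ gradedPiece E ϖ z h r i) : groupRep 𝔤 E g u ∈ gradedPiece E ϖ z h r i := by
  rw [H.mem_gradedPiece_iff] at hu ⊢
  refine ⟨groupRep_mem_of_mem_stab
    (connectedSubgroup_le_stab (fun x hx u hu => H.qSub_lie_mem hx hu) hg.2) hu.1, ?_⟩
  have h1 : u ∈ (LieModule.toEnd ℂ 𝔤 E z).eigenspace (ϖ z - 2 * i) :=
    Module.End.mem_eigenspace_iff.2 hu.2
  have h2 := groupRep_mem_of_mem_stab
    (connectedSubgroup_le_stab (fun x hx u hu => kAlg_lie_mem hx hu) hg.1) h1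
  exact Module.End.mem_eigenspace_iff.1 h2

theorem lie_mem_gradedPiece {γ : 𝔱.root} {i m : ℤ} (hf : f γ = -2 * m) (hg : g γ = -2 * m) {x : 𝔤}
    (hx : x ∈ rootLine γ) {u : E} (hu : u ∈ gradedPiece E ϖ z h r i) :
    ⁅x, u⁆ ∈ gradedPiece E ϖ z h r (i + m) := by
  rw [H.mem_gradedPiece] at hu ⊢
  constructor
  · rw [lie_lie_of_mem_rootLine hx hu.1, H.root_z, hf]
    congr 1
    push_cast
    ring
  · rw [lie_lie_of_mem_rootLine hx hu.2, H.root_h, hg]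
    congr 1
    push_cast
    ring

theorem uPlus_lie_mem {x : 𝔤} (hx : x ∈ uPlus z) {i : ℤ} {u : E}
    (hu : u ∈ gradedPiece E ϖ z h r i) : ⁅x, u⁆ ∈ gradedPiece E ϖ z h r (i - 1) := by
  have hle : uPlus z ≤ (gradedPiece E ϖ z h r (i - 1)).comap
      ((LieModule.toEnd ℂ 𝔤 E : 𝔤 →ₗ[ℂ] Module.End ℂ E).flip u) := by
    refine rootSum_le.2 fun γ hγ x hx => ?_
    change ⁅x, u⁆ ∈ gradedPiece E ϖ z h r (i - 1)
    rw [H.root_z] at hγ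
    have hf : f γ = 2 := by exact_mod_cast hγ
    rcases (H.le_two γ hf).lt_or_eq with h1 | h1
    · rw [H.lie_eq_zero_of_lt (by omega) hx (gradedPiece_le i hu)]
      exact zero_mem _
    · exact H.lie_mem_gradedPiece (m := -1) hf h1 hx hu
  exact hle hx

theorem highest_mem : v ∈ gradedSubspace E ϖ z h r :=
  H.mem_gradedSubspace.2 (H.lie_weight _)

/-- A root space that maps the graded subspace into itself lies in the parabolic subalgebra. -/
theorem le_of_stable {γ : 𝔱.root} {x : 𝔤} (hx : x ∈ rootLine γ) (hx0 : x ≠ 0)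
    (hstab : ∀ u ∈ gradedSubspace E ϖ z h r, ⁅x, u⁆ ∈ gradedSubspace E ϖ z h r) : g γ ≤ f γ := by
  by_contra! hlt
  obtain ⟨e, e', he⟩ := exists_isTriple γ
  have hxu : ∀ u ∈ gradedSubspace E ϖ z h r, ⁅x, u⁆ = 0 := by
    intro u hu
    have h1 := H.mem_gradedSubspace.1 (hstab u hu)
    rw [lie_lie_of_mem_rootLine hx (H.mem_gradedSubspace.1 hu), H.root_sub, add_smul,
      add_eq_right, smul_eq_zero, sub_eq_zero, Int.cast_inj] at h1
    exact h1.resolve_left hlt.ne'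
  have heu : ∀ u ∈ gradedSubspace E ϖ z h r, ⁅e, u⁆ = 0 := by
    intro u hu
    obtain ⟨c, rfl⟩ := exists_eq_smul_of_mem_rootLine hx hx0 he.mem
    rw [smul_lie, hxu u hu, smul_zero]
  have he'u : ∀ u ∈ gradedSubspace E ϖ z h r, ⁅e', u⁆ = 0 := fun u hu =>
    H.lie_eq_zero_of_lt (by rw [H.f_neg, H.g_neg]; omega) he.mem_neg hu
  have hhu : ∀ u ∈ gradedSubspace E ϖ z h r,
      ⁅(((rootSystem 𝔱).coroot γ : 𝔱) : 𝔤), u⁆ = 0 := by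
    intro u hu
    rw [← he.lie, lie_lie, heu u hu, he'u u hu, lie_zero, lie_zero, sub_zero]
  have hϖ : ϖ ((rootSystem 𝔱).coroot γ) = 0 := by
    have h1 := hhu v H.highest_mem
    rw [H.lie_weight] at h1
    exact (smul_eq_zero.1 h1).resolve_right H.ne_zero
  have hf0 := (H.weight_coroot γ).1 hϖ
  obtain ⟨i, hi⟩ : ∃ i, (rootSystem 𝔱).pairing γ (α i) ≠ 0 := by
    by_contra! h0
    have h1 : (g γ : ℂ) = 0 := by
      rw [← H.root_h, H.h_eq, map_sum]
      exact Finset.sum_eq_zero fun i _ => h0 i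
    have h2 : g γ = 0 := by exact_mod_cast h1
    omega
  have hi' : (rootSystem 𝔱).root (α i) ((rootSystem 𝔱).coroot γ) ≠ 0 := by
    change (rootSystem 𝔱).pairing (α i) γ ≠ 0
    rwa [Ne, (rootSystem 𝔱).pairing_eq_zero_iff']
  obtain ⟨k, k', hk⟩ := exists_isTriple (α i)
  -- Otherwise α_i^∨ would kill v, against ϖ(α_i^∨) = 1.
  have hne : ⁅k', v⁆ ≠ 0 := by
    intro h0
    have h1 : ⁅(((rootSystem 𝔱).coroot (α i) : 𝔱) : 𝔤), v⁆ = 0 := by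
      rw [← hk.lie, lie_lie, h0, H.lie_pos _ (H.isPos_of_f_eq_two (H.f_seq i)) k hk.mem, lie_zero,
        lie_zero, sub_zero]
    rw [H.lie_weight, H.weight_seq, one_smul] at h1
    exact H.ne_zero h1
  have h2 := hhu _ (H.lie_mem_of_eq (by rw [H.f_neg, H.g_neg, H.f_seq, H.g_seq]) hk.mem_neg
    H.highest_mem)
  rw [lie_lie_of_mem_rootLine hk.mem_neg (H.lie_weight _), hϖ, add_zero, root_negRoot_apply,
    smul_eq_zero, neg_eq_zero] at h2
  exact h2.elim hi' hne

/-- The stabilizer of the graded subspace is the parabolic subgroup. -/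
theorem stab_eq : stab E (gradedSubspace E ϖ z h r) = connectedSubgroup (qSub z h) := by
  have hQS : connectedSubgroup (qSub z h) ≤ stab E (gradedSubspace E ϖ z h r) :=
    connectedSubgroup_le_stab fun x hx u hu => H.qSub_lie_mem hx hu
  refine le_antisymm ?_ hQS
  have hd : ∀ γ : 𝔱.root, (rootSystem 𝔱).root' γ (h - z) = ((g γ - f γ : ℤ) : ℂ) := by
    intro γ
    push_cast
    exact H.root_sub γ
  -- A base adapted to 𝔮 instead of the given one: its positive roots all lie in 𝔮, so its Borel
  -- subgroup lies in Q.
  obtain ⟨b', hb'⟩ := exists_base_forall_nonpos hd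
  have hpos : ∀ γ, b'.IsPos γ → g γ ≤ f γ := by
    intro γ hγ
    have : g γ - f γ ≤ 0 := by
      refine hγ.induction_on_add (p := fun γ => g γ - f γ ≤ 0) (fun i hi => hb' i hi) ?_
      intro i j k hk hi hj
      have h1 : g k - f k = g i - f i + 1 * (g j - f j) :=
        value_of_root_eq_add_zsmul hd (by rw [hk, one_smul])
      have h2 : g j - f j ≤ 0 := hb' j hj
      omega
    omega
  have hroot : ∀ γ, g γ ≤ f γ → ∀ x ∈ rootLine γ, gexp x ∈ connectedSubgroup (qSub z h) := by
    intro γ hγ x hx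
    refine Subgroup.subset_closure ⟨x, ?_, rfl⟩
    rw [SetLike.mem_coe, H.qSub_eq_sup]
    exact Submodule.mem_sup_right (mem_rootSum hγ hx)
  refine le_of_forall_actsBy (b := b') (p := fun γ => g γ ≤ f γ) hQS ?_ ?_ hpos ?_
  · refine Subgroup.closure_mono (Set.image_mono ?_)
    rw [H.qSub_eq_sup]
    exact sup_le_sup le_rfl (rootSum_le.2 fun γ hγ x hx => mem_rootSum (hpos γ hγ) hx)
  -- If k stabilizes V, so does the adjoint transform by k of a root vector of 𝔮; this transform is
  -- a root vector for σ γ.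
  · intro k hk σ hσ γ hγ
    obtain ⟨e, e', he⟩ := exists_isTriple γ
    refine H.le_of_stable (hσ.mem γ e he.mem)
      (fun h0 => he.ne_zero (groupRep_injective k (h0.trans (map_zero _).symm))) fun u hu => ?_
    have h1 := groupRep_mem_of_mem_stab hk
      (H.lie_mem_of_le hγ he.mem (groupRep_mem_of_mem_stab (inv_mem hk) hu))
    rwa [groupRep_lie, groupRep_apply_inv] at h1
  -- The roots β and -β both belong to 𝔮, and the representative of the reflection is a product of
  -- their exponentials.
  · intro β hβ hneg
    obtain ⟨e, e', he, hw⟩ := exists_weylElt_eq β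
    rw [hw, reflElt]
    have h1 := hroot β (hpos β (b'.isPos_of_mem_support hβ)) e he.mem
    exact mul_mem (mul_mem h1 (hroot _ hneg _ (neg_mem he.mem_neg))) h1

end CominusculeData

end Graded

end Cominuscule


namespace Cominuscule

/-! ### The nilradical of the parabolic subalgebra -/

section Nilradical

variable {𝔤 : Type*} [LieRing 𝔤] [LieAlgebra ℂ 𝔤] [FiniteDimensional ℂ 𝔤] [IsSimple ℂ 𝔤]
  {𝔱 : LieSubalgebra ℂ 𝔤} [𝔱.IsCartanSubalgebra]

omit [FiniteDimensional ℂ 𝔤] [IsSimple ℂ 𝔤] in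
-- A nilpotent operator has no nonzero eigenvalue. Only this consequence of nilpotency is used for
-- ideals of 𝔮.
theorem eq_zero_of_lie_eq_smul_of_isNilpotent [LieRing.IsNilpotent 𝔤] {a b : 𝔤} {c : ℂ}
    (hc : c ≠ 0) (h : ⁅a, b⁆ = c • b) : b = 0 := by
  obtain ⟨n, hn⟩ := LieModule.isNilpotent_toEnd_of_isNilpotent ℂ 𝔤 𝔤 a
  have hp : ∀ n : ℕ, (LieModule.toEnd ℂ 𝔤 𝔤 a ^ n) b = c ^ n • b := by
    intro n
    induction n with
    | zero => simp
    | succ n ih =>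
      rw [pow_succ', Module.End.mul_apply, ih, map_smul, LieModule.toEnd_apply_apply, h, smul_smul,
        pow_succ]
  have h1 := hp n
  rw [hn, LinearMap.zero_apply, eq_comm, smul_eq_zero] at h1
  exact h1.resolve_left (pow_ne_zero n hc)

theorem eq_zero_of_forall_root {t : 𝔱} (h : ∀ γ : 𝔱.root, (rootSystem 𝔱).root γ t = 0) : t = 0 := by
  rw [← Module.forall_dual_apply_eq_zero_iff ℂ]
  intro φ
  have hφ : φ ∈ Submodule.span ℂ (Set.range (rootSystem 𝔱).root) := by
    rw [RootPairing.IsRootSystem.span_root_eq_top]; trivial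
  induction hφ using Submodule.span_induction with
  | mem φ hφ => obtain ⟨γ, rfl⟩ := hφ; exact h γ
  | zero => rfl
  | add φ ψ _ _ h1 h2 => rw [LinearMap.add_apply, h1, h2, add_zero]
  | smul c φ _ h1 => rw [LinearMap.smul_apply, h1, smul_zero]

namespace CominusculeData

variable {E : Type*} [AddCommGroup E] [Module ℂ E] [LieRingModule 𝔤 E] [LieModule ℂ 𝔤 E]
  [FiniteDimensional ℂ E]
  {b : (rootSystem 𝔱).Base} {z h : 𝔱} {ϖ : Module.Dual ℂ 𝔱} {r : ℕ}
  {α : Fin r → 𝔱.root} {f g : 𝔱.root → ℤ} {v : E} (H : CominusculeData E b z h ϖ α f g v)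

include H

/-- A nilpotent ideal of the parabolic subalgebra kills the graded subspace. -/
theorem lie_eq_zero_of_mem_nilpotent {J : Submodule ℂ 𝔤} (hJq : J ≤ qSub z h)
    (hJ : ∀ x ∈ qSub z h, ∀ y ∈ J, ⁅x, y⁆ ∈ J)
    (hnil : ∀ a ∈ J, ∀ b ∈ J, ∀ c : ℂ, c ≠ 0 → ⁅a, b⁆ = c • b → b = 0)
    {x : 𝔤} (hx : x ∈ J) {u : E} (hu : u ∈ gradedSubspace E ϖ z h r) : ⁅x, u⁆ = 0 := by
  have h𝔱 : ∀ t ∈ 𝔱, t ∈ qSub z h := fun t ht => Submodule.mem_sup_left ht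
  have hroot : ∀ γ : 𝔱.root, g γ ≤ f γ → ∀ x ∈ rootLine γ, x ∈ qSub z h := by
    intro γ hγ x hx
    rw [H.qSub_eq_sup]
    exact Submodule.mem_sup_right (mem_rootSum hγ hx)
  -- The ideal is stable under 𝔱, so it is the sum of its intersections with the weight spaces, and
  -- each can be treated separately.
  let N : LieSubmodule ℂ 𝔱 𝔤 := { J with lie_mem := fun {t y} hy => hJ t (h𝔱 _ t.2) y hy }
  have hxN : x ∈ N := hx
  rw [LieModule.eq_iSup_inf_genWeightSpace (N := N)] at hxN
  rw [← LieSubmodule.mem_toSubmodule, LieSubmodule.iSup_toSubmodule] at hxN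
  refine (iSup_le fun χ y hy => ?_ : _ ≤ LinearMap.ker
    ((LieModule.toEnd ℂ 𝔤 E : 𝔤 →ₗ[ℂ] Module.End ℂ E).flip u)) hxN
  obtain ⟨hyJ, hyχ⟩ : y ∈ J ∧ y ∈ rootSpace 𝔱 (χ : 𝔱 → ℂ) := hy
  change ⁅y, u⁆ = 0
  by_cases hχ : χ.IsZero
  · have hy𝔱 : y ∈ 𝔱 := by
      rw [hχ, rootSpace_zero_eq] at hyχ
      exact hyχ
    -- If γ(y) ≠ 0, then ⁅y, e⁆ = γ(y) e is an eigenvector of ad y in the ideal with nonzero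
    -- eigenvalue. As γ or -γ is always a root of 𝔮, y is annihilated by all roots.
    have key : ∀ γ : 𝔱.root, g γ ≤ f γ → (rootSystem 𝔱).root γ ⟨y, hy𝔱⟩ = 0 := by
      intro γ hγ
      by_contra h0
      obtain ⟨e, e', he⟩ := exists_isTriple γ
      have h1 := lie_of_mem_rootLine he.mem ⟨y, hy𝔱⟩
      have h2 : ⁅y, e⁆ ∈ J := by
        rw [← lie_skew]
        exact neg_mem (hJ e (hroot γ hγ e he.mem) y hyJ)
      have h3 := hnil y hyJ _ h2 _ h0 (by rw [h1, lie_smul, h1])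
      rw [h1, smul_eq_zero] at h3
      exact h3.elim h0 he.ne_zero
    have hy0 : (⟨y, hy𝔱⟩ : 𝔱) = 0 := by
      refine eq_zero_of_forall_root fun γ => ?_
      rcases le_total (g γ) (f γ) with h1 | h1
      · exact key γ h1
      · have := key (negRoot γ) (by rw [H.f_neg, H.g_neg]; omega)
        rwa [root_negRoot_apply, neg_eq_zero] at this
    have : y = 0 := congrArg Subtype.val hy0
    rw [this, zero_lie]
  · have hχ' : χ ∈ 𝔱.root := by
      simpa only [LieSubalgebra.root, Finset.mem_filter, Finset.mem_univ, true_and] using hχ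
    have hyγ : y ∈ rootLine (⟨χ, hχ'⟩ : 𝔱.root) := hyχ
    generalize (⟨χ, hχ'⟩ : 𝔱.root) = γ at hyγ
    rcases eq_or_ne y 0 with rfl | hy0
    · rw [zero_lie]
    have hle : g γ ≤ f γ :=
      H.le_of_stable hyγ hy0 fun u hu => H.qSub_lie_mem (hJq hyJ) hu
    rcases hle.lt_or_eq with h1 | h1
    · exact H.lie_eq_zero_of_lt h1 hyγ hu
    exfalso
    obtain ⟨e, e', he⟩ := exists_isTriple γ
    obtain ⟨c, rfl⟩ := exists_eq_smul_of_mem_rootLine he.mem he.ne_zero hyγ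
    have hc : c ≠ 0 := by
      rintro rfl
      exact hy0 (zero_smul _ _)
    -- Since g γ = f γ, the root -γ also belongs to 𝔮. Bracketing with its root vector puts γ^∨ into
    -- the ideal, where it has the eigenvector e with eigenvalue 2.
    have hk : (((rootSystem 𝔱).coroot γ : 𝔱) : 𝔤) ∈ J := by
      have h2 := hJ e' (hroot (negRoot γ) (by rw [H.f_neg, H.g_neg, h1]) e' he.mem_neg) _ hyJ
      have h3 : (((rootSystem 𝔱).coroot γ : 𝔱) : 𝔤) = (-c⁻¹) • ⁅e', c • e⁆ := by
        rw [lie_smul, smul_smul, neg_mul, inv_mul_cancel₀ hc, neg_smul, one_smul, lie_skew, he.lie]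
      rw [h3]
      exact Submodule.smul_mem _ _ h2
    exact hy0 (hnil _ hk _ hyJ 2 two_ne_zero (by rw [lie_smul, he.lie_h, smul_comm]))

theorem nilradical_lie_eq_zero {x : qAlg z h} (hx : x ∈ nilradical (qAlg z h)) {u : E}
    (hu : u ∈ gradedSubspace E ϖ z h r) : ⁅(x : 𝔤), u⁆ = 0 := by
  have hle : (nilradical (qAlg z h)).toSubmodule ≤ LinearMap.ker
      ((LieModule.toEnd ℂ 𝔤 E : 𝔤 →ₗ[ℂ] Module.End ℂ E).flip u ∘ₗ
        (qAlg z h).toSubmodule.subtype) := by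
    rw [nilradical, LieSubmodule.sSup_toSubmodule_eq_iSup]
    refine iSup₂_le fun I hI x hx => ?_
    have hI' : LieRing.IsNilpotent I := hI
    change ⁅(x : 𝔤), u⁆ = 0
    refine H.lie_eq_zero_of_mem_nilpotent
      (J := I.toSubmodule.map (qAlg z h).toSubmodule.subtype) ?_ ?_ ?_ ⟨x, hx, rfl⟩ hu
    · rintro _ ⟨y, -, rfl⟩
      exact y.2
    · rintro x hx _ ⟨y, hy, rfl⟩
      exact ⟨⁅(⟨x, hx⟩ : qAlg z h), y⁆, I.lie_mem hy, rfl⟩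
    · rintro _ ⟨a, ha, rfl⟩ _ ⟨b, hb, rfl⟩ c hc hab
      have h1 : ⁅(⟨a, ha⟩ : I), (⟨b, hb⟩ : I)⁆ = c • (⟨b, hb⟩ : I) :=
        Subtype.ext (Subtype.ext hab)
      have h2 := eq_zero_of_lie_eq_smul_of_isNilpotent hc h1
      have h3 : b = 0 := congrArg Subtype.val h2
      rw [h3, map_zero]
  exact hle hx

end CominusculeData

end Nilradical

/-! ### Root-theoretic data of the theorem -/

section Data

variable {𝔤 : Type*} [LieRing 𝔤] [LieAlgebra ℂ 𝔤] [FiniteDimensional ℂ 𝔤] [IsSimple ℂ 𝔤]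
  {𝔱 : LieSubalgebra ℂ 𝔤} [𝔱.IsCartanSubalgebra]
  {E : Type*} [AddCommGroup E] [Module ℂ E] [LieRingModule 𝔤 E] [LieModule ℂ 𝔤 E]

/-- All root combinatorics is converted here into the few numerical facts that the module arguments
use. In particular ϖ(γ^∨) and f γ vanish together because they differ by a ratio of positive coroot
lengths. -/
theorem exists_cominusculeData {b : (rootSystem 𝔱).Base} {z : 𝔱} (hz : IsHermitianElement b z)
    {ζ : b.support} (hζ : (rootSystem 𝔱).root ζ z ≠ 0)
    (hE : IsIrreducibleOfHighestWeight E b (fundamentalWeight b ζ)) {r : ℕ} {α : Fin r → 𝔱.root}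
    (hα : IsDominantOrthogonal b ζ α) :
    ∃ (f g : 𝔱.root → ℤ) (v : E), CominusculeData E b z (∑ i, (rootSystem 𝔱).coroot (α i))
      (fundamentalWeight b ζ) α f g v := by
  obtain ⟨f, hf⟩ : ∃ f : 𝔱.root → ℤ, ∀ γ, (rootSystem 𝔱).root γ z = f γ := by
    have : ∀ γ : 𝔱.root, ∃ n : ℤ, (rootSystem 𝔱).root γ z = n := by
      intro γ
      rcases hz.root_apply γ with h | h | h
      · exact ⟨-2, by rw [h]; norm_num⟩
      · exact ⟨0, by rw [h]; norm_num⟩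
      · exact ⟨2, by rw [h]; norm_num⟩
    exact ⟨fun γ => (this γ).choose, fun γ => (this γ).choose_spec⟩
  have hf' : ∀ γ, (rootSystem 𝔱).root' γ z = f γ := hf
  have hf2 : ∀ γ, f γ = -2 ∨ f γ = 0 ∨ f γ = 2 := by
    intro γ
    have h := hz.root_apply γ
    rw [hf] at h
    exact_mod_cast h
  have hb : ∀ β ∈ b.support, f β = 0 ∨ f β = 2 := by
    intro β hβ
    have h1 := hz.base β hβ
    rw [hf] at h1
    exact (hf2 β).resolve_left fun h => h1 (by rw [h]; norm_num)
  have hζ2 : f ζ = 2 := by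
    refine (hb ζ ζ.2).resolve_left fun h => hζ ?_
    rw [hf, h, Int.cast_zero]
  obtain ⟨hα2, horth, hw⟩ := hα.value_eq_and hf' hf2 hb hζ2
  have hg : ∀ γ, (rootSystem 𝔱).root γ (∑ i, (rootSystem 𝔱).coroot (α i)) =
      ((∑ i, (rootSystem 𝔱).pairingIn ℤ γ (α i) : ℤ) : ℂ) := by
    intro γ
    rw [map_sum, Int.cast_sum]
    exact Finset.sum_congr rfl fun i _ => ((rootSystem 𝔱).algebraMap_pairingIn ℤ γ (α i)).symm
  obtain ⟨hirr, v, hv0, hv, hvpos⟩ := hE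
  refine ⟨f, fun γ => ∑ i, (rootSystem 𝔱).pairingIn ℤ γ (α i), v,
    { root_z := hf
      root_h := hg
      cases := hf2
      nonneg := ?_
      le_two := fun γ hγ => sum_pairingIn_le_two hf' hf2 hα2 horth hγ
      weight_coroot := ?_
      weight_h := ?_
      h_eq := rfl
      f_seq := hα2
      g_seq := ?_
      weight_seq := hw
      irreducible := hirr
      ne_zero := hv0
      lie_weight := mem_wtSpace.1 hv
      lie_pos := hvpos }⟩
  · intro γ hγ
    refine hγ.induction_on_add (p := fun γ => 0 ≤ f γ) (fun i hi => ?_) ?_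
    · have := hb i hi
      omega
    · intro i j k hk hi hj
      have h1 := value_of_root_eq_add_zsmul hf' (m := 1) (i := i) (j := j) (k := k)
        (by rw [hk, one_smul])
      have h2 := hb j hj
      omega
  · intro γ
    have h1 := two_mul_apply_coroot_mul hf' hζ2
      (fun β hβ hne => value_eq_zero_of_ne hf' hf2 hb hζ2 hβ hne) γ
    have h2 : (corootLength (rootSystem 𝔱) ζ : ℂ) ≠ 0 := by
      exact_mod_cast (corootLength_pos (rootSystem 𝔱) ζ).ne'
    have h3 : (corootLength (rootSystem 𝔱) γ : ℂ) ≠ 0 := by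
      exact_mod_cast (corootLength_pos (rootSystem 𝔱) γ).ne'
    change b.toCoweightBasis.coord ζ _ = 0 ↔ _
    constructor
    · intro h
      rw [h, mul_zero, zero_mul, eq_comm, mul_eq_zero] at h1
      exact_mod_cast h1.resolve_right h3
    · intro h
      rw [h, Int.cast_zero, zero_mul, mul_eq_zero, mul_eq_zero] at h1
      exact (h1.resolve_right h2).resolve_left two_ne_zero
  · rw [map_sum]
    have : ∀ i, fundamentalWeight b ζ ((rootSystem 𝔱).coroot (α i)) = 1 := hw
    rw [Finset.sum_congr rfl fun i _ => this i, Finset.sum_const, Finset.card_univ,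
      Fintype.card_fin, nsmul_one]
  · intro i
    rw [Finset.sum_eq_single i]
    · have := (rootSystem 𝔱).algebraMap_pairingIn ℤ (α i) (α i)
      rw [RootPairing.pairing_same, algebraMap_int_eq, eq_intCast] at this
      exact_mod_cast this
    · intro j _ hj
      have := (rootSystem 𝔱).algebraMap_pairingIn ℤ (α i) (α j)
      rw [horth i j hj.symm, algebraMap_int_eq, eq_intCast] at this
      exact_mod_cast this
    · simp

end Data

end Cominuscule

/-! ### The main theorem -/

theorem mainTheorem7
    {𝔤 : Type*} [LieRing 𝔤] [LieAlgebra ℂ 𝔤] [FiniteDimensional ℂ 𝔤] [LieAlgebra.IsSimple ℂ 𝔤]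
    {𝔱 : LieSubalgebra ℂ 𝔤} [𝔱.IsCartanSubalgebra]
    (b : (LieAlgebra.IsKilling.rootSystem 𝔱).Base)
    (z : 𝔱) (hz : Cominuscule.IsHermitianElement b z)
    (ζ : b.support) (hζ : (LieAlgebra.IsKilling.rootSystem 𝔱).root ζ z ≠ 0)
    (ϖ : Module.Dual ℂ 𝔱) (hϖ : ϖ = Cominuscule.fundamentalWeight b ζ)
    (E : Type*) [AddCommGroup E] [Module ℂ E] [LieRingModule 𝔤 E] [LieModule ℂ 𝔤 E]
    [FiniteDimensional ℂ E] (hE : Cominuscule.IsIrreducibleOfHighestWeight E b ϖ)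
    (r : ℕ) (α : Fin r → 𝔱.root) (hα : Cominuscule.IsDominantOrthogonal b ζ α)
    (e : Fin r → 𝔤) (he : ∀ i, e i ≠ 0 ∧
      e i ∈ LieAlgebra.rootSpace 𝔱 (-((α i : LieModule.Weight ℂ 𝔱 𝔤) : 𝔱 → ℂ)))
    (y : 𝔤) (hy : y = ∑ i, e i)
    (h : 𝔱) (hh : h = ∑ i, (LieAlgebra.IsKilling.rootSystem 𝔱).coroot (α i))
    (V : Submodule ℂ E) (hV : V = Cominuscule.gradedSubspace E ϖ z h r)
    (Vi : ℤ → Submodule ℂ E) (hVi : ∀ i, Vi i = Cominuscule.gradedPiece E ϖ z h r i)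
    (𝔮 : LieSubalgebra ℂ 𝔤) (hq : 𝔮 = Cominuscule.qAlg z h)
    (K Q : Subgroup (Cominuscule.SCGroup 𝔤))
    (hK : K = Cominuscule.connectedSubgroup (Cominuscule.kAlg z))
    (hQ : Q = Cominuscule.connectedSubgroup 𝔮.toSubmodule) :
    -- `V` is stable under `𝔮`
    (∀ x ∈ 𝔮, ∀ v ∈ V, ⁅x, v⁆ ∈ V) ∧
    -- each `V_i` is a `K ∩ Q`-module
    (∀ i, ∀ g ∈ K ⊓ Q, ∀ v ∈ Vi i, Cominuscule.groupRep 𝔤 E g v ∈ Vi i) ∧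
    -- the nilradical of `𝔮` acts trivially on `V`
    (∀ x ∈ Cominuscule.nilradical 𝔮, ∀ v ∈ V, ⁅(x : 𝔤), v⁆ = 0) ∧
    -- the stabilizer of `V` in `G` is exactly `Q`
    (∀ g : Cominuscule.SCGroup 𝔤, V.map (Cominuscule.groupRep 𝔤 E g) = V ↔ g ∈ Q) ∧
    -- the action of `y` and of `𝔲₊` on the graded pieces
    (∀ i, ∀ v ∈ Vi i, ⁅y, v⁆ ∈ Vi (i + 1)) ∧
    (∀ i, ∀ x ∈ Cominuscule.uPlus z, ∀ v ∈ Vi i, ⁅x, v⁆ ∈ Vi (i - 1)) := by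
  subst hy hh hV hq hK hQ hϖ
  obtain ⟨f, g, v, H⟩ := Cominuscule.exists_cominusculeData hz hζ hE hα
  refine ⟨fun x hx v hv => H.qSub_lie_mem hx hv, fun i k hk v hv => ?_,
    fun x hx v hv => H.nilradical_lie_eq_zero hx hv, fun k => ?_, fun i v hv => ?_,
    fun i x hx v hv => ?_⟩
  · rw [hVi] at hv ⊢
    exact H.inf_apply_mem hk hv
  · rw [← Cominuscule.mem_stab, H.stab_eq]
    rfl
  · rw [hVi] at hv ⊢
    rw [sum_lie]
    refine sum_mem fun j _ => ?_
    exact H.lie_mem_gradedPiece (m := 1) (by rw [H.f_neg, H.f_seq]; rfl)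
      (by rw [H.g_neg, H.g_seq]; rfl) (Cominuscule.mem_rootLine_neg.2 (he j).2) hv
  · rw [hVi] at hv ⊢
    exact H.uPlus_lie_mem hx hv
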